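/- **Setting.** Fix $K\ge 2$ regressors, $M\ge 1$ observations per intersection, numbers $\zeta>1$, $\delta>0$, and $\beta\in\mathbb R^K$. Let $H\subset\mathbb R^2$ be a lattice. For each $N$ let the units $1,\dots,N$ have distinct known locations in $H$, such that the sampling region expands in two non-opposing directions (its width in every direction tends to infinity). A data generating process (DGP) $f$ consists of the law of a strictly stationary random field on $H$ with uniform $[0,1]$ marginals, whose value at the location of unit $i$ is $\alpha_i$; the law of a strictly stationary sequence $(\xi_t)_{t\ge 1}$ with uniform $[0,1]$ marginals; and Borel functions $f_{NT}$, one for each sample size. With $(\varepsilon_{it})$ i.i.d. uniform on $[0,1]$ and $(\alpha_i)$, $(\xi_t)$, $(\varepsilon_{it})$ mutually independent, $(X_{it},u_{it})=f_{NT}(\alpha_i,\xi_t,\varepsilon_{it})\in\mathbb R^{M\times K}\times\mathbb R^M$ and $y_{it}=X_{it}\beta+u_{it}$. The observed data are $(y_{it},X_{it})_{i\le N,\,t\le T}$, with law $P_{NT,f}$, and $\hat\beta=(X^\top X)^{-1}X^\top y$ is the OLS estimator. Let $s_{it}=X_{it}^\top u_{it}$, with Hoeffding components $a_i=E(s_{it}\mid\alpha_i)-E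 s_{it}$, $d_t=E(s_{it}\mid\xi_t)-E s_{it}$, $v_{it}=E(s_{it}\mid\alpha_i,\xi_t)-E(s_{it}\mid\alpha_i)-E(s_{it}\mid\xi_t)+E s_{it}$, $e_{it}=s_{it}-E(s_{it}\mid\alpha_i,\xi_t)$, and set $\sigma_a^2=\frac1N\sum_{i,j}E(a_ia_j^\top)$, $\sigma_d^2=\frac1T\sum_{t,t'}E(d_td_{t'}^\top)$, $\sigma_v^2=\frac1{NT}\sum_{i,i',t,t'}E(v_{it}v_{i't'}^\top)$, $\sigma_e^2=\frac1{NT}\sum_{i,i',t,t'}E(e_{it}e_{i't'}^\top)$, with $k$-th diagonal entries $\sigma_{ak}^2$, $\sigma_{dk}^2$, $\sigma_{vk}^2$, $\sigma_{ek}^2$ (all depending on $f,N,T$). Let $\mathcal B_0$ be the class of all DGPs $f$ with the following properties. 1. (Spectral representation.) For each $k$ there are sequences $(\phi_{l,k})_l$, $(\psi_{l,k})_l$, each orthonormal in $L^2[0,1]$ and with first three absolute moments bounded uniformly in $l$ and $k$, such that $v_{it,k}=\sum_{l,l'}c_{ll',k}\,\phi_{l,k}(\alpha_i)\psi_{l',k}(\xi_t)$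 in mean square for all $N,T$, where the coefficients may depend on $(N,T)$ and satisfy $|c_{ll',k}|\le\bar c_{ll'}$ for all $N,T,k$ with $\sum_{l,l'}\bar c_{ll'}^2<\infty$. 2. (Moments.) $E(X_{it}^\top u_{it})=0$; $\lambda_{\min}\bigl(E(X_{it}^\top X_{it})\bigr)$ is bounded away from $0$ uniformly in $(N,T)$; $E\|X_{it}\|^{8(\zeta+\delta)}$ and $E\|u_{it}\|^{8(\zeta+\delta)}$ are bounded uniformly in $(N,T)$; so are the absolute moments of order $8(\zeta+\delta)$ of $a_{ik}/\sigma_{ak}$, $d_{tk}/\sigma_{dk}$, $e_{it,k}/\sigma_{ek}$, $v_{it,k}/\sigma_{vk}$ for each $k$, over those $(N,T)$ for which the respective denominator is positive. 3. (Variance.) $\liminf_{N,T\to\infty}\lambda_{\min}\bigl(T\sigma_a^2+N\sigma_d^2+\sigma_v^2+\sigma_e^2\bigr)>0$. 4. (Mixing in time.) $(\xi_t)$ is $\alpha$-mixing with coefficients $O(s^{-\lambda})$ for some $\lambda>2\zeta/(\zeta-1)$. 5. (Mixing in space.) Let $\alpha_{\infty,\infty}(r)$ be the supremum of the strong mixing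 coefficients between the families $(\alpha_i)_{i\in A}$ and $(\alpha_j)_{j\in B}$, over all $N$ and all sets $A,B$ of sampled units at distance at least $r$. Then $\alpha_{\infty,\infty}(r)^{1-1/(2(\zeta+\delta)-1)}=o(r^{-4})$ as $r\to\infty$. 6. (No I&N regime.) For no coordinate $k$ and no sequence of sample sizes with $N,T\to\infty$ does $\max\{T\sigma_{ak}^2,N\sigma_{dk}^2\}$ converge to a number in $(0,\infty)$ while $\sigma_{vk}^2$ stays bounded away from $0$. 7. (Limit laws.) For each $k$ there are deterministic $a_{NT}>0$ such that $a_{NT}(\hat\beta_k-\beta_k)$ converges in distribution, as $N,T\to\infty$, to a nondegenerate law. It is not required that $\lambda_{\max}/\lambda_{\min}$ of the variance matrix of $\frac1{NT}\sum_{i,t}s_{it}$ be bounded. **Proposition.** For all $f\in\mathcal B_0$ and all $k$, choose any deterministic $a_{NTk,f}>0$ for which $a_{NTk,f}(\hat\beta_k-\beta_k)$ converges in distribution to a nondegenerate law as $N,T\to\infty$, and let $G_{kf}$ be the distribution function of that limit. Let $\mathcal D$ be the set of all measurable maps of the observed data into distribution functions on $\mathbb R$. Then there exist $\varepsilon>0$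 and $k$ such that $$\liminf_{N,T\to\infty}\ \inf_{\hat D\in\mathcal D}\ \sup_{f\in\mathcal B_0}P_{NT,f}\bigl(\|\hat D-G_{kf}\|_\infty>\varepsilon\bigr)>0 .$$ Moreover, this already holds for a two-element subclass that does not depend on $(N,T)$: there are $f_1,f_2\in\mathcal B_0$ such that, with the same $\varepsilon$ and $k$, $$\liminf_{N,T\to\infty}\ \inf_{\hat D\in\mathcal D}\ \max_{f\in\{f_1,f_2\}}P_{NT,f}\bigl(\|\hat D-G_{kf}\|_\infty>\varepsilon\bigr)>0 .$$ -/

import Mathlib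

open Filter Topology MeasureTheory ProbabilityTheory unitInterval
open scoped NNReal ENNReal

namespace TwoWay

/-- The plane in which the cross-sectional units are located. -/
abbrev Plane : Type := EuclideanSpace ℝ (Fin 2)

/-- The observed data: an outcome vector of length `M` and an `M × K` regressor matrix for every
intersection `(i, t)`. -/
abbrev Data (N T M K : ℕ) : Type := Fin N → Fin T → (Fin M → ℝ) × (Fin M → Fin K → ℝ)

/-- The ordinary least squares estimator `(XᵀX)⁻¹ Xᵀy` computed from the stacked data. -/
noncomputable def ols {N T M K : ℕ} (x : Data N T M K) : Fin K → ℝ :=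
  (∑ i, ∑ t, (Matrix.of (x i t).2).transpose * Matrix.of (x i t).2)⁻¹.mulVec
    (∑ i, ∑ t, (Matrix.of (x i t).2).transpose.mulVec (x i t).1)

/-- A data generating process in Aldous-Hoover-Kallenberg form: the law of the field of unit effects
on the lattice `H`, the law of the sequence of time effects, and, for every sample size `(N, T)`,
the function that maps the latent triple `(α_i, ξ_t, ε_it)` to the regressors and the errors of the
intersection `(i, t)`. The outcomes are then `y = X β + u`. -/
structure DGP (H : Submodule ℤ Plane) (M K : ℕ) where
  alphaLaw : ProbabilityMeasure (H → I)
  xiLaw : ProbabilityMeasure (ℕ → I)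
  fn : ℕ → ℕ → I × I × I → (Fin M → Fin K → ℝ) × (Fin M → ℝ)

/-- The space of all latent variables. -/
abbrev Latent (H : Submodule ℤ Plane) : Type := (H → I) × (ℕ → I) × (ℕ × ℕ → I)

/-- A design: the locations of the `N` units in a sample with `N` units. -/
abbrev Design (H : Submodule ℤ Plane) : Type := (N : ℕ) → Fin N → H

/-- The sampling region expands in two non-opposing directions (hence genuinely in two dimensions):
its width along every direction of the plane tends to infinity. -/
def Expands {H : Submodule ℤ Plane} (loc : Design H) : Prop :=
  ∀ w : Plane, w ≠ 0 → ∀ r : ℝ, ∀ᶠ N in atTop, ∃ i j : Fin N,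
    r ≤ inner ℝ w ((loc N i : Plane) - (loc N j : Plane))

/-- Euclidean norm of a vector given by its coordinates. -/
noncomputable def vecNorm {m : ℕ} (u : Fin m → ℝ) : ℝ := √(∑ j, u j ^ 2)

/-- Frobenius norm of a matrix given by its entries. -/
noncomputable def matNorm {m k : ℕ} (X : Fin m → Fin k → ℝ) : ℝ := √(∑ j, ∑ l, X j l ^ 2)

/-- Strong mixing coefficient between the coordinates in `A` and the coordinates in `B` of a random
field with law `P`. -/
noncomputable def mixing {ι : Type} (P : Measure (ι → I)) (A B : Set ι) : ℝ :=
  sSup {r : ℝ | ∃ G L : Set (ι → I),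
    MeasurableSet[⨆ i ∈ A, MeasurableSpace.comap (fun ω : ι → I => ω i) inferInstance] G ∧
    MeasurableSet[⨆ i ∈ B, MeasurableSpace.comap (fun ω : ι → I => ω i) inferInstance] L ∧
    r = |P.real (G ∩ L) - P.real G * P.real L|}

namespace DGP

variable {H : Submodule ℤ Plane} {M K : ℕ}

/-- The unit effects, the time effects and the idiosyncratic effects are mutually independent, the
idiosyncratic ones are i.i.d. uniform. -/
noncomputable def latentLaw (f : DGP H M K) : Measure (Latent H) :=
  (f.alphaLaw : Measure (H → I)).prod
    ((f.xiLaw : Measure (ℕ → I)).prod (Measure.infinitePi fun _ : ℕ × ℕ => (volume : Measure I)))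

instance (f : DGP H M K) : IsProbabilityMeasure f.latentLaw := by
  unfold latentLaw; infer_instance

/-- The latent triple `(α_i, ξ_t, ε_it)`. -/
def cell (loc : Design H) (N T : ℕ) (i : Fin N) (t : Fin T) (ω : Latent H) : I × I × I :=
  (ω.1 (loc N i), ω.2.1 t, ω.2.2 (i, t))

/-- The observed data when the true parameter is `β`. -/
def obs (f : DGP H M K) (loc : Design H) (β : Fin K → ℝ) (N T : ℕ) (ω : Latent H) :
    Data N T M K := fun i t =>
  let p := f.fn N T (cell loc N T i t ω)
  ((Matrix.of p.1).mulVec β + p.2, p.1)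

/-- The law of the observed data. -/
noncomputable def dataLaw (f : DGP H M K) (loc : Design H) (β : Fin K → ℝ) (N T : ℕ) :
    Measure (Data N T M K) := f.latentLaw.map (f.obs loc β N T)

/-- The score `Xᵀu`, as a function of the latent triple. -/
def score (f : DGP H M K) (N T : ℕ) (k : Fin K) (p : I × I × I) : ℝ :=
  ∑ m, (f.fn N T p).1 m k * (f.fn N T p).2 m

/-- The mean of the score. -/
noncomputable def meanS (f : DGP H M K) (N T : ℕ) (k : Fin K) : ℝ :=
  ∫ p : I × I × I, f.score N T k p

/-- Conditional mean of the score given `α_i = x`; the three latent variables of a cell are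
independent and uniform. -/
noncomputable def condA (f : DGP H M K) (N T : ℕ) (k : Fin K) (x : I) : ℝ :=
  ∫ p : I × I, f.score N T k (x, p.1, p.2)

/-- Conditional mean of the score given `ξ_t = y`. -/
noncomputable def condD (f : DGP H M K) (N T : ℕ) (k : Fin K) (y : I) : ℝ :=
  ∫ p : I × I, f.score N T k (p.1, y, p.2)

/-- Conditional mean of the score given `(α_i, ξ_t) = (x, y)`. -/
noncomputable def condAD (f : DGP H M K) (N T : ℕ) (k : Fin K) (x y : I) : ℝ :=
  ∫ z : I, f.score N T k (x, y, z)

/-- The components `a`, `d`, `v`, `e` of the Hoeffding decomposition of the score, as functions of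
the latent triple. -/
noncomputable def compA (f : DGP H M K) (N T : ℕ) (k : Fin K) (p : I × I × I) : ℝ :=
  f.condA N T k p.1 - f.meanS N T k

noncomputable def compD (f : DGP H M K) (N T : ℕ) (k : Fin K) (p : I × I × I) : ℝ :=
  f.condD N T k p.2.1 - f.meanS N T k

noncomputable def compV (f : DGP H M K) (N T : ℕ) (k : Fin K) (p : I × I × I) : ℝ :=
  f.condAD N T k p.1 p.2.1 - f.condA N T k p.1 - f.condD N T k p.2.1 + f.meanS N T k

noncomputable def compE (f : DGP H M K) (N T : ℕ) (k : Fin K) (p : I × I × I) : ℝ :=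
  f.score N T k p - f.condAD N T k p.1 p.2.1

/-- `N⁻¹ ∑_{i,j} E(a_i a_jᵀ)`; the component `a` of cell `(i, t)` depends on `α_i` only. -/
noncomputable def varA (f : DGP H M K) (loc : Design H) (N T : ℕ) : Matrix (Fin K) (Fin K) ℝ :=
  Matrix.of fun k l => (N : ℝ)⁻¹ * ∑ i : Fin N, ∑ j : Fin N, ∫ ω,
    (f.condA N T k (ω.1 (loc N i)) - f.meanS N T k) *
      (f.condA N T l (ω.1 (loc N j)) - f.meanS N T l) ∂f.latentLaw

/-- `T⁻¹ ∑_{t,s} E(d_t d_sᵀ)`. -/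
noncomputable def varD (f : DGP H M K) (N T : ℕ) : Matrix (Fin K) (Fin K) ℝ :=
  Matrix.of fun k l => (T : ℝ)⁻¹ * ∑ t : Fin T, ∑ s : Fin T, ∫ ω,
    (f.condD N T k (ω.2.1 t) - f.meanS N T k) *
      (f.condD N T l (ω.2.1 s) - f.meanS N T l) ∂f.latentLaw

/-- `(NT)⁻¹ ∑_{i,j,t,s} E(g_it g_jsᵀ)` for a family `g` of cell functions. -/
noncomputable def varCell (f : DGP H M K) (loc : Design H) (N T : ℕ)
    (g : Fin K → I × I × I → ℝ) : Matrix (Fin K) (Fin K) ℝ :=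
  Matrix.of fun k l => ((N : ℝ) * T)⁻¹ *
    ∑ i : Fin N, ∑ j : Fin N, ∑ t : Fin T, ∑ s : Fin T, ∫ ω,
      g k (cell loc N T i t ω) * g l (cell loc N T j s ω) ∂f.latentLaw

noncomputable def varV (f : DGP H M K) (loc : Design H) (N T : ℕ) : Matrix (Fin K) (Fin K) ℝ :=
  f.varCell loc N T (f.compV N T)

noncomputable def varE (f : DGP H M K) (loc : Design H) (N T : ℕ) : Matrix (Fin K) (Fin K) ℝ :=
  f.varCell loc N T (f.compE N T)

/-- The structure of the latent variables and measurability: the unit effects form a strictly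
stationary field and the time effects a strictly stationary sequence, both with uniform marginals
on `[0, 1]`; the function of the latent variables is Borel for every sample size. -/
structure Representation (f : DGP H M K) : Prop where
  measurable_fn : ∀ N T, Measurable (f.fn N T)
  alpha_uniform : ∀ h : H, (f.alphaLaw : Measure (H → I)).map (fun ω => ω h) = volume
  alpha_stationary : ∀ h : H, (f.alphaLaw : Measure (H → I)).map (fun ω g => ω (g + h)) =
    (f.alphaLaw : Measure (H → I))
  xi_uniform : ∀ t : ℕ, (f.xiLaw : Measure (ℕ → I)).map (fun ω => ω t) = volume
  xi_stationary : (f.xiLaw : Measure (ℕ → I)).map (fun ω t => ω (t + 1)) =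
    (f.xiLaw : Measure (ℕ → I))

/-- A sequence of functions that is orthonormal with respect to the uniform law and whose first
three absolute moments are bounded by `B`. -/
structure BoundedOrthonormal (φ : ℕ → I → ℝ) (B : ℝ) : Prop where
  measurable : ∀ l, Measurable (φ l)
  memLp : ∀ l, MemLp (φ l) 2 volume
  orthonormal : ∀ l l', ∫ x, φ l x * φ l' x = if l = l' then 1 else 0
  moments : ∀ l, ∀ j ∈ Finset.Icc 1 3, ∫⁻ x, ENNReal.ofReal (|φ l x| ^ j) ≤ ENNReal.ofReal B

/-- Every coordinate of the component `v` has an expansion, convergent in mean square, in a tensor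
product orthonormal system, whose coefficients are dominated by one square-summable array, uniformly
in the sample size. -/
def SpectralRepresentation (f : DGP H M K) : Prop :=
  ∃ (φ ψ : Fin K → ℕ → I → ℝ) (c : ℕ → ℕ → Fin K → ℕ × ℕ → ℝ) (cbar : ℕ × ℕ → ℝ) (B : ℝ),
    0 < B ∧ (∀ k, BoundedOrthonormal (φ k) B) ∧ (∀ k, BoundedOrthonormal (ψ k) B) ∧
    (∀ N T k q, |c N T k q| ≤ cbar q) ∧ Summable (fun q => cbar q ^ 2) ∧
    ∀ N T k, Tendsto (fun F : Finset (ℕ × ℕ) => eLpNorm (fun p : I × I × I =>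
      f.compV N T k p - ∑ q ∈ F, c N T k q * φ k q.1 p.1 * ψ k q.2 p.2.1) 2 volume) atTop (𝓝 0)

/-- Whenever the variance `s` is positive, the standardized variable `g / √s` has absolute moment of
order `r` at most `C`. -/
def StdMoment (r : ℝ) (C : ℝ≥0) (s : ℝ) (g : I × I × I → ℝ) : Prop :=
  0 < s → ∫⁻ p, ENNReal.ofReal (|g p / √s| ^ r) ≤ C

/-- Moments and variances. -/
structure MomentsVariances (f : DGP H M K) (loc : Design H) (ζ δ : ℝ) : Prop where
  mean_zero : ∀ N T k, f.meanS N T k = 0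
  gram_pos : ∃ q : ℝ, 0 < q ∧ ∀ N T, ((Matrix.of fun k l : Fin K =>
    ∫ p : I × I × I, ∑ m, (f.fn N T p).1 m k * (f.fn N T p).1 m l) -
      q • (1 : Matrix (Fin K) (Fin K) ℝ)).PosSemidef
  moment_X : ∃ C : ℝ≥0, ∀ N T,
    ∫⁻ p, ENNReal.ofReal (matNorm (f.fn N T p).1 ^ (8 * (ζ + δ))) ≤ C
  moment_u : ∃ C : ℝ≥0, ∀ N T,
    ∫⁻ p, ENNReal.ofReal (vecNorm (f.fn N T p).2 ^ (8 * (ζ + δ))) ≤ C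
  moment_std : ∃ C : ℝ≥0, ∀ N T k,
    StdMoment (8 * (ζ + δ)) C (f.varA loc N T k k) (f.compA N T k) ∧
    StdMoment (8 * (ζ + δ)) C (f.varD N T k k) (f.compD N T k) ∧
    StdMoment (8 * (ζ + δ)) C (f.varE loc N T k k) (f.compE N T k) ∧
    StdMoment (8 * (ζ + δ)) C (f.varV loc N T k k) (f.compV N T k)
  /-- The smallest eigenvalue of `T σ_a² + N σ_d² + σ_v² + σ_e²` stays bounded away from `0` as
  `N, T → ∞` (entries of this matrix may diverge). -/
  variance_pos : ∃ q : ℝ, 0 < q ∧ ∀ᶠ n : ℕ × ℕ in atTop ×ˢ atTop,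
    (((n.2 : ℝ) • f.varA loc n.1 n.2 + (n.1 : ℝ) • f.varD n.1 n.2 + f.varV loc n.1 n.2 +
      f.varE loc n.1 n.2) - q • (1 : Matrix (Fin K) (Fin K) ℝ)).PosSemidef

/-- Strong mixing coefficients of the time effects. -/
noncomputable def mixXi (f : DGP H M K) (s : ℕ) : ℝ :=
  ⨆ n : ℕ, mixing (f.xiLaw : Measure (ℕ → I)) (Set.Iic n) (Set.Ici (n + s))

/-- The time effects are strongly mixing with coefficients `O(s^{-λ})` for some
`λ > 2 ζ / (ζ - 1)`. -/
def TimeMixing (f : DGP H M K) (ζ : ℝ) : Prop :=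
  ∃ lam : ℝ, 2 * ζ / (ζ - 1) < lam ∧ f.mixXi =O[atTop] fun s : ℕ => (s : ℝ) ^ (-lam)

/-- Strong mixing coefficients of the unit effects over sets of sampled units, of arbitrary sizes,
at distance at least `r`. -/
noncomputable def mixAlpha (f : DGP H M K) (loc : Design H) (r : ℝ) : ℝ :=
  sSup {c : ℝ | ∃ (N : ℕ) (A B : Set (Fin N)),
    (∀ i ∈ A, ∀ j ∈ B, r ≤ dist (loc N i : Plane) (loc N j : Plane)) ∧
    c = mixing (f.alphaLaw : Measure (H → I)) (loc N '' A) (loc N '' B)}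

def SpatialMixing (f : DGP H M K) (loc : Design H) (ζ δ : ℝ) : Prop :=
  (fun r : ℝ => f.mixAlpha loc r ^ (1 - 1 / (2 * (ζ + δ) - 1))) =o[atTop] fun r : ℝ => r ^ (-4 : ℝ)

/-- Coordinate `k` follows, along the sample sizes `n 0, n 1, …`, the intermediate regime with
non-Gaussian interaction: `max {T σ_ak², N σ_dk²}` tends to a number in `(0, ∞)` and `σ_vk²` stays
bounded away from `0`. -/
def IntermediateNonGaussian (f : DGP H M K) (loc : Design H) (k : Fin K) (n : ℕ → ℕ × ℕ) : Prop :=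
  (∃ r : ℝ, 0 < r ∧ Tendsto (fun j => max (((n j).2 : ℝ) * f.varA loc (n j).1 (n j).2 k k)
    (((n j).1 : ℝ) * f.varD (n j).1 (n j).2 k k)) atTop (𝓝 r)) ∧
  ∃ q : ℝ, 0 < q ∧ ∀ᶠ j in atTop, q ≤ f.varV loc (n j).1 (n j).2 k k

/-- `a (β̂_k - β_k)` converges in distribution, as `N, T → ∞`, to a nondegenerate law `L`. -/
def HasLimitLaw (f : DGP H M K) (loc : Design H) (β : Fin K → ℝ) (k : Fin K) (a : ℕ → ℕ → ℝ)
    (L : ProbabilityMeasure ℝ) : Prop :=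
  (∀ N T, 0 < a N T) ∧
  TendstoInDistribution
    (fun (n : ℕ × ℕ) (ω : Latent H) => a n.1 n.2 * (ols (f.obs loc β n.1 n.2 ω) k - β k))
    (atTop ×ˢ atTop) (id : ℝ → ℝ) (fun _ => f.latentLaw) (L : Measure ℝ) ∧
  ∀ x : ℝ, (L : Measure ℝ) ≠ Measure.dirac x

end DGP

/-- The class of data generating processes: all the regularity conditions hold (but no condition
that the scores of different coordinates have variances of the same order), no coordinate follows
the intermediate regime with non-Gaussian interaction along any sample sizes `N, T → ∞`, and every
coordinate of the least squares estimator has a nondegenerate limit law under some normalization. -/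
def dgpClass {H : Submodule ℤ Plane} (M K : ℕ) (loc : Design H) (β : Fin K → ℝ) (ζ δ : ℝ) :
    Set (DGP H M K) :=
  {f | f.Representation ∧ f.SpectralRepresentation ∧ f.MomentsVariances loc ζ δ ∧
    f.TimeMixing ζ ∧ f.SpatialMixing loc ζ δ ∧
    (∀ (k : Fin K) (n : ℕ → ℕ × ℕ), Tendsto n atTop (atTop ×ˢ atTop) →
      ¬ f.IntermediateNonGaussian loc k n) ∧
    ∀ k : Fin K, ∃ (a : ℕ → ℕ → ℝ) (L : ProbabilityMeasure ℝ), f.HasLimitLaw loc β k a L}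

/-- The measurable maps of the data into distribution functions (a distribution function being that
of a probability measure on the line). -/
abbrev Estimator (N T M K : ℕ) : Type :=
  {D : Data N T M K → ProbabilityMeasure ℝ // Measurable D}

/-- Kolmogorov distance between the distribution functions of two laws on the line. -/
noncomputable def kolmogorov (P Q : ProbabilityMeasure ℝ) : ℝ :=
  ⨆ x : ℝ, |cdf (P : Measure ℝ) x - cdf (Q : Measure ℝ) x|

/-- Probability under `f` that the estimator `D` misses the law `L` by more than `ε`. -/
noncomputable def missProb {H : Submodule ℤ Plane} {M K N T : ℕ} (f : DGP H M K) (loc : Design H)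
    (β : Fin K → ℝ) (D : Estimator N T M K) (L : ProbabilityMeasure ℝ) (ε : ℝ) : ℝ≥0∞ :=
  f.dataLaw loc β N T {x | ε < kolmogorov (D.1 x) L}

end TwoWay

namespace TwoWay

/-! The bound is a two-point argument: two processes in the class produce identical data with
probability bounded below, yet the limit laws of their first coefficient differ. Write m = min N T
(at least 2), K = n + 1, r = 8(ζ + δ).

The idiosyncratic draw assigns each cell one of K equally likely types. The regressors are an
intercept and dummies for the types other than 0, so the first coefficient is estimated by the type
0 average and every other one by a difference of two type averages (`ols_of_types`). Errors depend
on the type and on the effect with only m draws. Cells of type 0 carry τ times a rare variable,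
equal to 1 with probability 1/m and to -h with probability 1/(mh), where h = m^(1/r); all other
cells carry a symmetric sign. The two processes have τ = 1 and τ = -1.

Among m draws the number of ones is asymptotically Poisson, while a value -h occurs with probability
at most 1/h, which tends to 0. Hence m times the first estimation error converges to τ times a
Poisson variable (`hasLimitLaw_zero`); the other coordinates are asymptotically normal at rate √m
(`hasLimitLaw_succ`). Eventually with probability at least exp(-2)/2 no rare value occurs
(`eventually_le_measure_quiet`), and then the data do not depend on τ (`obs_eq_of_mem_quiet`). Under
any normalization the limit law lives on the half-line τx ≥ 0 (`limitLaw_apply_eq_zero`), so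
nondegeneracy separates the two limits (`limitLaw_ne`), and no estimator can be close to both
(`half_le_max_missProb`).

Membership in the class rests on the absence of a conditioning requirement. Because of the
intercept, every coordinate of the score contains sign errors, so its variance stays bounded below
(`meanCov_diag_ge`, `devCov_diag_ge`) and coordinatewise standardization does not magnify the rare
variable, whose variance vanishes. In the direction of the rare variable, the factor max N T
restores the eigenvalue bound (`one_le_mul_rareVar`, `quadratic_form_ge`). The conditional mean of
the score involves one effect only, so the interaction v is zero, which settles the spectral
condition and the excluded regime; i.i.d. effects settle mixing. -/

/-- Product of uniform laws. -/
noncomputable abbrev unif (ι : Type) : Measure (ι → I) :=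
  Measure.infinitePi fun _ : ι => (volume : Measure I)

/-! ### Mixing, convergence in measure, and sums of i.i.d. uniform draws. -/

lemma mixing_unif_of_disjoint {ι : Type} {A B : Set ι} (h : Disjoint A B) :
    mixing (unif ι) A B = 0 := by
  have hind : iIndepFun (fun (i : ι) (ω : ι → I) => ω i) (unif ι) :=
    iIndepFun_infinitePi (X := fun _ x => x) (fun _ => measurable_id)
  have hI := indep_iSup_of_disjoint (fun i => (measurable_pi_apply i).comap_le) hind.iIndep h
  have h0 : ∀ r ∈ {r : ℝ | ∃ G L : Set (ι → I),
      MeasurableSet[⨆ i ∈ A, MeasurableSpace.comap (fun ω : ι → I => ω i) inferInstance] G ∧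
      MeasurableSet[⨆ i ∈ B, MeasurableSpace.comap (fun ω : ι → I => ω i) inferInstance] L ∧
      r = |(unif ι).real (G ∩ L) - (unif ι).real G * (unif ι).real L|}, r = 0 := by
    rintro r ⟨G, L, hG, hL, rfl⟩
    have := (Indep_iff _ _ _).1 hI G L hG hL
    simp [measureReal_def, this, ENNReal.toReal_mul]
  unfold mixing
  apply le_antisymm
  · exact Real.sSup_nonpos fun r hr => (h0 r hr).le
  · exact Real.sSup_nonneg fun r hr => (h0 r hr).ge

lemma tendstoInMeasure_zero_of_integral_sq {Ω ι : Type*} [MeasurableSpace Ω] {μ : Measure Ω}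
    [IsProbabilityMeasure μ] {l : Filter ι} {X : ι → Ω → ℝ} {c : ι → ℝ}
    (hi : ∀ n, Integrable (fun ω => X n ω ^ 2) μ) (hc : Tendsto c l (𝓝 0))
    (hX : ∀ᶠ n in l, ∫ ω, X n ω ^ 2 ∂μ ≤ c n) : TendstoInMeasure μ X l 0 := by
  rw [tendstoInMeasure_iff_measureReal_norm]
  intro ε hε
  have h1 : Tendsto (fun n => (ε ^ 2)⁻¹ * c n) l (𝓝 0) := by simpa using hc.const_mul (ε ^ 2)⁻¹
  refine tendsto_of_tendsto_of_tendsto_of_le_of_le' tendsto_const_nhds h1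
    (.of_forall fun n => measureReal_nonneg) ?_
  filter_upwards [hX] with n hn
  have h2 := mul_meas_ge_le_integral_of_nonneg (μ := μ) (f := fun ω => X n ω ^ 2)
    (.of_forall fun ω => sq_nonneg _) (hi n) (ε ^ 2)
  have h3 : {x | ε ≤ ‖X n x - (0 : Ω → ℝ) x‖} = {x | ε ^ 2 ≤ X n x ^ 2} := by
    ext x
    simp only [Pi.zero_apply, sub_zero, Real.norm_eq_abs, Set.mem_ofPred_eq]
    rw [← sq_abs (X n x), pow_le_pow_iff_left₀ hε.le (abs_nonneg _) two_ne_zero]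
  rw [h3, inv_mul_eq_div, le_div_iff₀ (by positivity)]
  linarith

lemma tendstoInMeasure_zero_of_abs_le {Ω ι : Type*} [MeasurableSpace Ω] {μ : Measure Ω}
    {l : Filter ι} {X Y : ι → Ω → ℝ} {B : ι → Set Ω} {C : ℝ}
    (hX : TendstoInMeasure μ X l 0) (hB : Tendsto (fun n => μ (B n)) l (𝓝 0)) (hC : 0 < C)
    (h : ∀ᶠ n in l, ∀ ω, ω ∉ B n → |Y n ω| ≤ C * |X n ω|) : TendstoInMeasure μ Y l 0 := by
  rw [tendstoInMeasure_iff_norm] at hX ⊢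
  intro ε hε
  have h1 := (hX (ε / C) (by positivity)).add hB
  rw [add_zero] at h1
  refine tendsto_of_tendsto_of_tendsto_of_le_of_le' tendsto_const_nhds h1
    (.of_forall fun n => zero_le) ?_
  filter_upwards [h] with n hn
  refine (measure_mono ?_).trans (measure_union_le _ _)
  intro ω hω
  by_cases hb : ω ∈ B n
  · exact Or.inr hb
  · left
    have := hn ω hb
    simp only [Pi.zero_apply, sub_zero, Real.norm_eq_abs, Set.mem_ofPred_eq] at hω ⊢
    rw [div_le_iff₀ hC]
    linarith

lemma measurePreserving_eval_unif {ι : Type} (i : ι) :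
    MeasurePreserving (fun x : ι → I => x i) (unif ι) volume :=
  measurePreserving_eval_infinitePi (fun _ : ι => (volume : Measure I)) i

lemma integral_eval_unif {ι : Type} (i : ι) {w : I → ℝ} (hw : Measurable w) :
    ∫ x, w (x i) ∂(unif ι) = ∫ z, w z := by
  rw [← (measurePreserving_eval_unif i).map_eq,
    integral_map (measurable_pi_apply i).aemeasurable hw.aestronglyMeasurable]

lemma integral_eval_mul_eval_unif {ι : Type} [DecidableEq ι] (i j : ι) {w w' : I → ℝ}
    (hw : Measurable w) (hw' : Measurable w') :
    ∫ x, w (x i) * w' (x j) ∂(unif ι) =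
      if i = j then ∫ z, w z * w' z else (∫ z, w z) * ∫ z, w' z := by
  split_ifs with h
  · subst h
    exact integral_eval_unif i (hw.mul hw')
  · have h1 := Measure.infinitePi_map_eval_prod (P := fun _ : ι => (volume : Measure I)) h
    rw [← integral_prod_mul (μ := (volume : Measure I)) (ν := (volume : Measure I)), ← h1,
      integral_map (f := fun q : I × I => w q.1 * w' q.2) (by fun_prop)
        (by fun_prop)]

lemma charFun_map_sum_unif {ι : Type} (s : Finset ι) {w : I → ℝ} (hw : Measurable w) (t : ℝ) :
    charFun ((unif ι).map fun x => ∑ i ∈ s, w (x i)) t =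
      charFun ((volume : Measure I).map w) t ^ s.card := by
  have hind : iIndepFun (fun (i : ι) (x : ι → I) => w (x i)) (unif ι) :=
    iIndepFun_infinitePi (X := fun _ x => w x) (fun _ => hw)
  rw [iIndepFun.charFun_map_fun_finsetSum_eq_prod (X := fun (i : ι) (x : ι → I) => w (x i))
    (fun i _ => (hw.comp (measurable_pi_apply i)).aemeasurable) (hind.restrict _),
    Finset.prod_apply]
  rw [← Finset.prod_const]
  refine Finset.prod_congr rfl fun i _ => ?_
  have : (unif ι).map (fun x => w (x i)) = (volume : Measure I).map w := by
    rw [← (measurePreserving_eval_unif i).map_eq, Measure.map_map hw (measurable_pi_apply i)]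
    rfl
  rw [this]

/-- Sums of a function of i.i.d. uniform variables have a law that depends on their number only. -/
lemma map_sum_unif_eq {ι κ : Type} (s : Finset ι) (s' : Finset κ) (h : s.card = s'.card)
    {w : I → ℝ} (hw : Measurable w) :
    (unif ι).map (fun x => ∑ i ∈ s, w (x i)) = (unif κ).map (fun x => ∑ i ∈ s', w (x i)) := by
  have h1 : Measurable fun x : ι → I => ∑ i ∈ s, w (x i) := by fun_prop
  have h2 : Measurable fun x : κ → I => ∑ i ∈ s', w (x i) := by fun_prop
  have := Measure.isProbabilityMeasure_map (μ := unif ι) h1.aemeasurable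
  have := Measure.isProbabilityMeasure_map (μ := unif κ) h2.aemeasurable
  refine Measure.ext_of_charFun ?_
  ext t
  rw [charFun_map_sum_unif s hw, charFun_map_sum_unif s' hw, h]

lemma charFun_map_indicator {P : Set I} (hP : MeasurableSet P) (t : ℝ) :
    charFun ((volume : Measure I).map (P.indicator fun _ => (1 : ℝ))) t =
      1 + (volume.real P : ℂ) * (Complex.exp (t * Complex.I) - 1) := by
  rw [charFun_apply_real, integral_map (measurable_const.indicator hP).aemeasurable (by fun_prop)]
  have : ∀ z : I, Complex.exp (t * (P.indicator (fun _ => (1 : ℝ)) z : ℝ) * Complex.I) =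
      1 + P.indicator (fun _ => Complex.exp (t * Complex.I) - 1) z := by
    intro z
    by_cases hz : z ∈ P <;> simp [hz]
  simp_rw [this]
  rw [integral_add (integrable_const _) ((integrable_const _).indicator hP),
    integral_indicator_const _ hP]
  simp

/-- Poisson limit theorem: the characteristic function of the count is (1 + p(e^{it} - 1))^n with np
tending to 1. -/
lemma tendstoInDistribution_sum_indicator {P : ℕ → Set I} (hP : ∀ n, MeasurableSet (P n))
    (h : Tendsto (fun n : ℕ => (n : ℝ) * volume.real (P n)) atTop (𝓝 1)) :
    TendstoInDistribution (fun (n : ℕ) (x : ℕ → I) =>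
      ∑ i ∈ Finset.range n, (P n).indicator (fun _ => (1 : ℝ)) (x i)) atTop (id : ℝ → ℝ)
      (fun _ => unif ℕ) ((poissonMeasure 1).map ((↑) : ℕ → ℝ)) where
  forall_aemeasurable n := by
    have : Measurable ((P n).indicator fun _ => (1 : ℝ)) := measurable_const.indicator (hP n)
    have h2 : Measurable fun x : ℕ → I =>
      ∑ i ∈ Finset.range n, (P n).indicator (fun _ => (1 : ℝ)) (x i) := by fun_prop
    exact h2.aemeasurable
  tendsto := by
    refine ProbabilityMeasure.tendsto_iff_tendsto_charFun.2 fun t => ?_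
    simp only [ProbabilityMeasure.coe_mk, Measure.map_id]
    rw [charFun_map_cast_poissonMeasure]
    have h1 : ∀ n, charFun ((unif ℕ).map fun x : ℕ → I =>
        ∑ i ∈ Finset.range n, (P n).indicator (fun _ => (1 : ℝ)) (x i)) t =
        (1 + (volume.real (P n) : ℂ) * (Complex.exp (t * Complex.I) - 1)) ^ n := by
      intro n
      rw [charFun_map_sum_unif _ (measurable_const.indicator (hP n)), charFun_map_indicator (hP n),
        Finset.card_range]
    simp_rw [h1]
    apply Complex.tendsto_one_add_pow_exp_of_tendsto
    have h2 := ((Complex.continuous_ofReal.tendsto _).comp h).mul_const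
      (Complex.exp (t * Complex.I) - 1)
    simpa [Function.comp_def, mul_assoc] using h2

lemma tendstoInDistribution_sum_of_sq_eq_one {g : I → ℝ} (hg : Measurable g) (h0 : ∫ z, g z = 0)
    (h1 : ∀ z, g z ^ 2 = 1) :
    TendstoInDistribution (fun (n : ℕ) (x : ℕ → I) =>
      (√n)⁻¹ * ∑ i ∈ Finset.range n, g (x i)) atTop (id : ℝ → ℝ)
      (fun _ => unif ℕ) (gaussianReal 0 1) := by
  refine tendstoInDistribution_inv_sqrt_mul_sum (X := fun (i : ℕ) (x : ℕ → I) => g (x i)) HasLaw.id ?_ ?_ ?_ ?_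
  · rw [integral_eval_unif 0 hg, h0]
  · simp [h1]
  · exact iIndepFun_infinitePi (X := fun _ x => g x) (fun _ => hg)
  · intro i
    have : ∀ j : ℕ, (unif ℕ).map (fun x => g (x j)) = (volume : Measure I).map g := by
      intro j
      rw [← (measurePreserving_eval_unif j).map_eq, Measure.map_map hg (measurable_pi_apply j)]
      rfl
    exact ⟨(hg.comp (measurable_pi_apply i)).aemeasurable,
      (hg.comp (measurable_pi_apply 0)).aemeasurable, by rw [this, this]⟩

/-- Convergence in distribution sees laws only. This transfers limits along ℕ to two-index families
on another probability space whose laws depend on a single growing index. -/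
lemma tendstoInDistribution_of_map_eq {ι Ω Ω' Ω'' : Type*} [MeasurableSpace Ω]
    [MeasurableSpace Ω'] [MeasurableSpace Ω''] {μ : Measure Ω} [IsProbabilityMeasure μ]
    {ν : Measure Ω'} [IsProbabilityMeasure ν] {ρ : Measure Ω''} [IsProbabilityMeasure ρ]
    {l : Filter ι} {X : ι → Ω → ℝ} {Y : ℕ → Ω' → ℝ} {Z : Ω'' → ℝ} {m : ι → ℕ}
    (hY : TendstoInDistribution Y atTop Z (fun _ => ν) ρ) (hm : Tendsto m l atTop)
    (hX : ∀ i, AEMeasurable (X i) μ) (h : ∀ i, μ.map (X i) = ν.map (Y (m i))) :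
    TendstoInDistribution X l Z (fun _ => μ) ρ where
  forall_aemeasurable := hX
  aemeasurable_limit := hY.aemeasurable_limit
  tendsto := by
    refine (hY.tendsto.comp hm).congr fun i => ?_
    apply Subtype.ext
    exact (h i).symm

lemma measure_forall_notMem_unif {S : Set I} (hS : MeasurableSet S) (n : ℕ) :
    (unif ℕ) {x | ∀ i ∈ Finset.range n, x i ∉ S} = volume (Sᶜ) ^ n := by
  have : {x : ℕ → I | ∀ i ∈ Finset.range n, x i ∉ S} =
      Set.pi (Finset.range n : Set ℕ) fun _ => Sᶜ := by
    ext x; simp [Set.mem_pi]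
  rw [this, Measure.infinitePi_pi _ (fun _ _ => hS.compl)]
  simp

lemma integrable_of_abs_le {Ω : Type*} [MeasurableSpace Ω] {μ : Measure Ω} [IsFiniteMeasure μ]
    {f : Ω → ℝ} (hf : Measurable f) {C : ℝ} (h : ∀ x, |f x| ≤ C) : Integrable f μ :=
  Integrable.of_bound hf.aestronglyMeasurable C (.of_forall h)

lemma integral_unitInterval (f : ℝ → ℝ) : ∫ z : I, f z = ∫ x in (0 : ℝ)..1, f x := by
  rw [intervalIntegral.integral_of_le zero_le_one, ← integral_Icc_eq_integral_Ioc]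
  exact integral_subtype measurableSet_Icc f

lemma volume_real_coe_preimage {s : Set ℝ} (hs : MeasurableSet s) :
    volume.real {z : I | (z : ℝ) ∈ s} = (volume.restrict (Set.Icc (0 : ℝ) 1)).real s := by
  have := measurePreserving_coe.measure_preimage (s := s) hs.nullMeasurableSet
  simp only [measureReal_def]
  exact congrArg _ this

/-! ### Equally likely cell types. -/

/-- The interval of the partition of `[0, 1]` into `n + 1` intervals of equal length that contains a
point. -/
noncomputable def cellType (n : ℕ) (z : I) : Fin (n + 1) :=
  if h : ⌊(n + 1 : ℝ) * z⌋₊ < n + 1 then ⟨_, h⟩ else 0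

lemma measurable_cellType (n : ℕ) : Measurable (cellType n) := by
  have : cellType n = (fun j : ℕ => if h : j < n + 1 then (⟨j, h⟩ : Fin (n + 1)) else 0) ∘
      fun z : I => ⌊(n + 1 : ℝ) * z⌋₊ := rfl
  rw [this]
  exact (measurable_from_nat).comp (by fun_prop)

lemma volume_real_cellType (n : ℕ) (κ : Fin (n + 1)) :
    volume.real (cellType n ⁻¹' {κ}) = 1 / (n + 1 : ℝ) := by
  have hn : (0 : ℝ) < n + 1 := by positivity
  have hκ : (κ : ℝ) + 1 ≤ n + 1 := by
    have := κ.2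
    exact_mod_cast this
  have h1 : (cellType n ⁻¹' {κ} : Set I) =ᵐ[volume]
      {z : I | (z : ℝ) ∈ Set.Ico ((κ : ℝ) / (n + 1)) ((κ + 1) / (n + 1))} := by
    -- Only at the endpoint 1 does the floor reach n + 1, so the default type in `cellType` affects
    -- a null set.
    have h0 : ∀ᵐ z : I, z ≠ 1 := by simp [ae_iff]
    filter_upwards [h0] with z hz
    have hz1 : (z : ℝ) < 1 := lt_of_le_of_ne z.2.2 fun h => hz (Subtype.ext h)
    have hlt : ⌊(n + 1 : ℝ) * z⌋₊ < n + 1 := by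
      rw [Nat.floor_lt (mul_nonneg hn.le z.2.1)]
      push_cast
      nlinarith
    apply propext
    change cellType n z = κ ↔ _
    rw [show ({z : I | (z : ℝ) ∈ Set.Ico ((κ : ℝ) / (n + 1)) ((κ + 1) / (n + 1))} z) =
      ((κ : ℝ) / (n + 1) ≤ z ∧ (z : ℝ) < (κ + 1) / (n + 1)) from rfl]
    simp only [cellType, hlt, dif_pos, Fin.ext_iff]
    rw [Nat.floor_eq_iff (mul_nonneg hn.le z.2.1), div_le_iff₀ hn, lt_div_iff₀ hn, mul_comm]
  rw [measureReal_congr h1, volume_real_coe_preimage measurableSet_Ico, measureReal_restrict_apply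
    measurableSet_Ico, Set.inter_eq_self_of_subset_left, Real.volume_real_Ico_of_le]
  · field_simp; ring
  · gcongr; linarith
  · intro x hx
    refine ⟨le_trans (by positivity) hx.1, hx.2.le.trans ?_⟩
    rw [div_le_one hn]; exact hκ

/-- The centred indicator of a cell type. -/
noncomputable def typeDev (n : ℕ) (κ : Fin (n + 1)) (z : I) : ℝ :=
  (if cellType n z = κ then 1 else 0) - 1 / (n + 1 : ℝ)

@[fun_prop]
lemma measurable_typeInd (n : ℕ) (κ : Fin (n + 1)) :
    Measurable fun z => if cellType n z = κ then (1 : ℝ) else 0 :=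
  Measurable.ite (measurable_cellType n (measurableSet_singleton κ)) measurable_const
    measurable_const

@[fun_prop]
lemma measurable_typeDev (n : ℕ) (κ : Fin (n + 1)) : Measurable (typeDev n κ) :=
  (measurable_typeInd n κ).sub_const _

lemma abs_typeDev_le (n : ℕ) (κ : Fin (n + 1)) (z : I) : |typeDev n κ z| ≤ 1 := by
  have h1 : 1 / (n + 1 : ℝ) ≤ 1 := by
    rw [div_le_one (by positivity)]; linarith [(Nat.cast_nonneg n : (0 : ℝ) ≤ n)]
  have h0 : 0 ≤ 1 / (n + 1 : ℝ) := by positivity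
  unfold typeDev
  split_ifs <;> rw [abs_le] <;> constructor <;> linarith

lemma integral_typeInd (n : ℕ) (κ : Fin (n + 1)) :
    ∫ z, (if cellType n z = κ then (1 : ℝ) else 0) = 1 / (n + 1 : ℝ) := by
  have : (fun z => if cellType n z = κ then (1 : ℝ) else 0) =
      (cellType n ⁻¹' {κ}).indicator fun _ => 1 := by
    ext z
    by_cases h : cellType n z = κ <;> simp [h]
  rw [this, integral_indicator_const _ (measurable_cellType n (measurableSet_singleton κ)),
    volume_real_cellType]
  simp

lemma integrable_typeInd (n : ℕ) (κ : Fin (n + 1)) :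
    Integrable fun z => if cellType n z = κ then (1 : ℝ) else 0 :=
  integrable_of_abs_le (C := 1) (by fun_prop) fun z => by split_ifs <;> simp

lemma integral_typeDev (n : ℕ) (κ : Fin (n + 1)) : ∫ z, typeDev n κ z = 0 := by
  unfold typeDev
  rw [integral_sub (integrable_typeInd n κ) (integrable_const _), integral_typeInd]
  simp

/-- The covariance of two indicators of one multinomial draw: distinct types exclude each other. -/
lemma integral_typeDev_mul (n : ℕ) (κ κ' : Fin (n + 1)) :
    ∫ z, typeDev n κ z * typeDev n κ' z =
      (if κ = κ' then 1 / (n + 1 : ℝ) else 0) - (1 / (n + 1 : ℝ)) ^ 2 := by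
  have h : ∀ z, typeDev n κ z * typeDev n κ' z =
      (if cellType n z = κ then (1 : ℝ) else 0) * (if κ = κ' then 1 else 0)
      - 1 / (n + 1 : ℝ) * typeDev n κ z - 1 / (n + 1 : ℝ) *
        (if cellType n z = κ' then (1 : ℝ) else 0) := by
    intro z
    unfold typeDev
    by_cases h1 : cellType n z = κ
    · subst h1
      simp only [if_true]
      ring
    · simp only [h1, if_false]
      ring
  simp_rw [h]
  have hd := integrable_of_abs_le (μ := volume) (measurable_typeDev n κ) (abs_typeDev_le n κ)
  have e1 := (integrable_typeInd n κ).mul_const (if κ = κ' then (1 : ℝ) else 0)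
  have e2 := hd.const_mul (1 / (n + 1 : ℝ))
  have e3 : Integrable fun z => (if cellType n z = κ then (1 : ℝ) else 0) *
      (if κ = κ' then 1 else 0) - 1 / (n + 1 : ℝ) * typeDev n κ z := e1.sub e2
  rw [integral_sub e3 ((integrable_typeInd n κ').const_mul _), integral_sub e1 e2,
    integral_mul_const, integral_const_mul, integral_const_mul, integral_typeInd, integral_typeInd,
    integral_typeDev]
  split_ifs <;> ring

/-! ### The symmetric sign and the rare variable. -/

/-- The function equal to `1` on the left half of the unit interval and to `-1` on the right half. -/
noncomputable def halfSign (z : I) : ℝ := if (z : ℝ) < 1 / 2 then 1 else -1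

@[fun_prop]
lemma measurable_halfSign : Measurable halfSign :=
  Measurable.ite (measurableSet_lt measurable_subtype_coe measurable_const) measurable_const
    measurable_const

lemma halfSign_sq (z : I) : halfSign z ^ 2 = 1 := by unfold halfSign; split_ifs <;> norm_num

lemma abs_halfSign (z : I) : |halfSign z| = 1 := by unfold halfSign; split_ifs <;> norm_num

/-- The antisymmetry fails only at 1/2, which the reflection fixes. -/
lemma halfSign_symm_ae : ∀ᵐ z : I, halfSign (symm z) = -halfSign z := by
  have h0 : ∀ᵐ z : I, z ≠ ⟨1 / 2, by norm_num, by norm_num⟩ := by simp [ae_iff]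
  filter_upwards [h0] with z hz
  have hz : (z : ℝ) ≠ 1 / 2 := fun h => hz (Subtype.ext h)
  unfold halfSign
  rw [coe_symm_eq]
  rcases lt_or_gt_of_ne hz with h | h
  · rw [if_neg (by linarith), if_pos h]
  · rw [if_pos (by linarith), if_neg (by linarith)]; simp

lemma integral_mul_halfSign_of_symm {w : I → ℝ} (hw : ∀ z, w (symm z) = w z) :
    ∫ z, w z * halfSign z = 0 := by
  have h1 : ∫ z, w (symm z) * halfSign (symm z) = ∫ z, w z * halfSign z :=
    measurePreserving_symm.integral_comp symmMeasurableEquiv.measurableEmbedding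
      fun z => w z * halfSign z
  have h2 : ∫ z, w (symm z) * halfSign (symm z) = -∫ z, w z * halfSign z := by
    rw [← integral_neg]
    refine integral_congr_ae ?_
    filter_upwards [halfSign_symm_ae] with z hz
    rw [hz, hw]; ring
  linarith

lemma integral_halfSign : ∫ z, halfSign z = 0 := by
  simpa using integral_mul_halfSign_of_symm (w := fun _ => 1) fun _ => rfl

/-- The points at distance less than `c / 2` from the centre of the unit interval. -/
def central (c : ℝ) : Set I := {z | |2 * (z : ℝ) - 1| < c}

lemma measurableSet_central (c : ℝ) : MeasurableSet (central c) :=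
  measurableSet_lt (by fun_prop) measurable_const

lemma central_mono {c d : ℝ} (h : c ≤ d) : central c ⊆ central d :=
  fun _ hz => lt_of_lt_of_le hz h

lemma symm_mem_central (c : ℝ) (z : I) : symm z ∈ central c ↔ z ∈ central c := by
  unfold central
  simp only [Set.mem_ofPred_eq, coe_symm_eq]
  rw [← abs_neg]
  ring_nf

lemma volume_real_central {c : ℝ} (h0 : 0 ≤ c) (h1 : c ≤ 1) : volume.real (central c) = c := by
  have : central c = {z : I | (z : ℝ) ∈ Set.Ioo ((1 - c) / 2) ((1 + c) / 2)} := by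
    ext z
    simp only [central, Set.mem_ofPred_eq, Set.mem_Ioo, abs_lt]
    constructor <;> rintro ⟨h2, h3⟩ <;> constructor <;> linarith
  rw [this, volume_real_coe_preimage measurableSet_Ioo, measureReal_restrict_apply
    measurableSet_Ioo, Set.inter_eq_self_of_subset_left, Real.volume_real_Ioo_of_le (by linarith)]
  · ring
  · intro x hx
    exact ⟨by linarith [hx.1], by linarith [hx.2]⟩

/-- The annulus around `central p` whose measure is `p / h`. -/
def annulus (p h : ℝ) : Set I := central (p + p / h) \ central p

lemma measurableSet_annulus (p h : ℝ) : MeasurableSet (annulus p h) :=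
  (measurableSet_central _).diff (measurableSet_central _)

/-- A mean zero variable that equals `1` with probability `p`, equals `-h` with probability `p / h`,
and vanishes otherwise. -/
noncomputable def rare (p h : ℝ) (z : I) : ℝ :=
  (central p).indicator (fun _ => 1) z - h * (annulus p h).indicator (fun _ => 1) z

@[fun_prop]
lemma measurable_indicator_central (p : ℝ) :
    Measurable ((central p).indicator fun _ => (1 : ℝ)) :=
  measurable_const.indicator (measurableSet_central p)

@[fun_prop]
lemma measurable_indicator_annulus (p h : ℝ) :
    Measurable ((annulus p h).indicator fun _ => (1 : ℝ)) :=
  measurable_const.indicator (measurableSet_annulus p h)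

@[fun_prop]
lemma measurable_rare (p h : ℝ) : Measurable (rare p h) := by
  unfold rare; fun_prop

lemma indicator_symm {S : Set I} (hS : ∀ z, symm z ∈ S ↔ z ∈ S) (z : I) :
    S.indicator (fun _ => (1 : ℝ)) (symm z) = S.indicator (fun _ => 1) z := by
  by_cases h : z ∈ S
  · rw [Set.indicator_of_mem h, Set.indicator_of_mem ((hS z).2 h)]
  · rw [Set.indicator_of_notMem h, Set.indicator_of_notMem fun h' => h ((hS z).1 h')]

lemma rare_symm (p h : ℝ) (z : I) : rare p h (symm z) = rare p h z := by
  unfold rare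
  rw [indicator_symm (symm_mem_central p), indicator_symm fun z => ?_]
  simp only [annulus, Set.mem_sdiff, symm_mem_central]

/-- The rare variable is built from sets symmetric about 1/2, the sign is antisymmetric. They are
therefore uncorrelated although they are functions of the same draw. -/
lemma integral_rare_mul_halfSign (p h : ℝ) : ∫ z, rare p h z * halfSign z = 0 :=
  integral_mul_halfSign_of_symm (rare_symm p h)

lemma rare_eq_zero {p h : ℝ} {z : I} (hp : 0 ≤ p / h) (hz : z ∉ central (p + p / h)) :
    rare p h z = 0 := by
  have h1 : z ∉ central p := fun h' => hz (central_mono (by linarith) h')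
  have h2 : z ∉ annulus p h := fun h' => hz h'.1
  simp [rare, h1, h2]

lemma rare_nonneg {p h : ℝ} {z : I} (hz : z ∉ annulus p h) : 0 ≤ rare p h z := by
  simp only [rare, hz, not_false_eq_true, Set.indicator_of_notMem, mul_zero, sub_zero]
  exact Set.indicator_nonneg (fun _ _ => zero_le_one) z

section

variable {p h : ℝ}

lemma volume_real_annulus (hp : 0 ≤ p) (hh : 1 ≤ h) (h2 : 2 * p ≤ 1) :
    volume.real (annulus p h) = p / h := by
  have h3 : p / h ≤ p := div_le_self hp hh
  have h4 : 0 ≤ p / h := by positivity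
  have h5 : central p ⊆ central (p + p / h) := central_mono (by linarith)
  unfold annulus
  rw [measureReal_sdiff h5 (measurableSet_central p),
    volume_real_central (by linarith) (by linarith), volume_real_central hp (by linarith)]
  ring

lemma integrable_ind {S : Set I} (hS : MeasurableSet S) :
    Integrable (S.indicator fun _ => (1 : ℝ)) :=
  (integrable_const _).indicator hS

/-- Height h on measure p/h offsets height 1 on measure p. The bound on 2p keeps both sets inside
the unit interval. -/
lemma integral_rare (hp : 0 ≤ p) (hh : 1 ≤ h) (h2 : 2 * p ≤ 1) : ∫ z, rare p h z = 0 := by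
  unfold rare
  rw [integral_sub (integrable_ind (measurableSet_central p))
    ((integrable_ind (measurableSet_annulus p h)).const_mul _), integral_const_mul,
    integral_indicator_const _ (measurableSet_central p),
    integral_indicator_const _ (measurableSet_annulus p h), volume_real_annulus hp hh h2,
    volume_real_central hp (by linarith)]
  simp; field_simp; ring

lemma rare_sq (p h : ℝ) (z : I) : rare p h z * rare p h z =
    (central p).indicator (fun _ => 1) z + h ^ 2 * (annulus p h).indicator (fun _ => 1) z := by
  by_cases h1 : z ∈ central p
  · have h2 : z ∉ annulus p h := fun h' => h'.2 h1
    simp [rare, h1, h2]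
  · by_cases h2 : z ∈ annulus p h
    · simp [rare, h1, h2]; ring
    · simp [rare, h1, h2]

lemma integral_rare_sq (hp : 0 ≤ p) (hh : 1 ≤ h) (h2 : 2 * p ≤ 1) :
    ∫ z, rare p h z * rare p h z = p + p * h := by
  simp_rw [rare_sq]
  rw [integral_add (integrable_ind (measurableSet_central p))
    ((integrable_ind (measurableSet_annulus p h)).const_mul _), integral_const_mul,
    integral_indicator_const _ (measurableSet_central p),
    integral_indicator_const _ (measurableSet_annulus p h), volume_real_annulus hp hh h2,
    volume_real_central hp (by linarith)]
  simp; field_simp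

lemma abs_rare_le (hh : 1 ≤ h) (z : I) : |rare p h z| ≤ h := by
  by_cases h1 : z ∈ central p
  · have h2 : z ∉ annulus p h := fun h' => h'.2 h1
    simp [rare, h1, h2, hh]
  · by_cases h2 : z ∈ annulus p h
    · simp [rare, h1, h2]; exact (abs_of_nonneg (by linarith)).le
    · simp [rare, h1, h2]; linarith

/-- The moment equals p + h^r p/h, and both terms are at most 1. -/
lemma lintegral_rare_rpow {r : ℝ} (hr : 0 < r) (hp : 0 ≤ p) (hh : 1 ≤ h) (h2 : 2 * p ≤ 1)
    (hr2 : h ^ r * p ≤ 1) : ∫⁻ z, ENNReal.ofReal (|rare p h z| ^ r) ≤ 2 := by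
  have h1 : ∀ z, |rare p h z| ^ r =
      (central p).indicator (fun _ => 1) z + h ^ r * (annulus p h).indicator (fun _ => 1) z := by
    intro z
    by_cases h1 : z ∈ central p
    · have h2 : z ∉ annulus p h := fun h' => h'.2 h1
      simp [rare, h1, h2]
    · by_cases h2 : z ∈ annulus p h
      · simp [rare, h1, h2, abs_of_nonneg (show 0 ≤ h by linarith)]
      · simp [rare, h1, h2, hr.ne']
  have hi := (integrable_ind (measurableSet_central p)).add
    ((integrable_ind (measurableSet_annulus p h)).const_mul (h ^ r))
  have h3 : ∫ z, |rare p h z| ^ r ≤ 2 := by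
    simp_rw [h1]
    rw [integral_add (integrable_ind (measurableSet_central p))
      ((integrable_ind (measurableSet_annulus p h)).const_mul _), integral_const_mul,
      integral_indicator_const _ (measurableSet_central p),
      integral_indicator_const _ (measurableSet_annulus p h), volume_real_annulus hp hh h2,
      volume_real_central hp (by linarith)]
    have : h ^ r * (p / h) ≤ 1 := by
      rw [← mul_div_assoc]
      exact div_le_one_of_le₀ (hr2.trans hh) (by linarith)
    simp only [smul_eq_mul, mul_one]
    linarith
  rw [← ofReal_integral_eq_lintegral_ofReal]
  · exact (ENNReal.ofReal_le_ofReal h3).trans (by simp)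
  · simp_rw [h1]
    exact hi
  · exact .of_forall fun z => by positivity

end

/-! ### A bounded orthonormal system. -/

/-- A cosine system on the unit interval. -/
noncomputable def cosSys (l : ℕ) (z : I) : ℝ := √2 * Real.cos (2 * Real.pi * (l + 1) * z)

lemma integral_cos_two_pi (n : ℤ) :
    ∫ x in (0 : ℝ)..1, Real.cos (2 * Real.pi * n * x) = if n = 0 then 1 else 0 := by
  split_ifs with h
  · subst h; simp
  · have h1 : (2 * Real.pi * n : ℝ) ≠ 0 := by
      have : (n : ℝ) ≠ 0 := by exact_mod_cast h
      positivity
    rw [intervalIntegral.integral_comp_mul_left (fun x => Real.cos x) h1, integral_cos]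
    have h2 : Real.sin (2 * Real.pi * n) = 0 := by
      have := Real.sin_int_mul_pi (2 * n)
      rw [← this]; congr 1; push_cast; ring
    simp [h2]

lemma abs_cosSys_le (l : ℕ) (z : I) : |cosSys l z| ≤ 2 := by
  unfold cosSys
  rw [abs_mul, abs_of_nonneg (Real.sqrt_nonneg 2)]
  have h1 : √2 ≤ 2 := by rw [Real.sqrt_le_left (by norm_num)]; norm_num
  nlinarith [Real.abs_cos_le_one (2 * Real.pi * (l + 1) * z), Real.sqrt_nonneg 2,
    abs_nonneg (Real.cos (2 * Real.pi * (l + 1) * z))]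

lemma measurable_cosSys (l : ℕ) : Measurable (cosSys l) := by unfold cosSys; fun_prop

/-- The interaction component will be zero, but the spectral condition still asks for a concrete
orthonormal system with bounded moments. -/
lemma boundedOrthonormal_cosSys : DGP.BoundedOrthonormal cosSys 8 where
  measurable := measurable_cosSys
  memLp l := MemLp.of_bound (measurable_cosSys l).aestronglyMeasurable 2
    (.of_forall (abs_cosSys_le l))
  orthonormal l l' := by
    have h : ∀ z : I, cosSys l z * cosSys l' z =
        (fun x : ℝ => Real.cos (2 * Real.pi * ((l : ℤ) - (l' : ℤ) : ℤ) * x) +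
          Real.cos (2 * Real.pi * ((l : ℤ) + l' + 2 : ℤ) * x)) z := by
      intro z
      have h2 : √2 * √2 = 2 := Real.mul_self_sqrt (by norm_num)
      simp only [cosSys]
      rw [show (2 * Real.pi * (((l : ℤ) - (l' : ℤ) : ℤ) : ℝ) * z : ℝ) =
          2 * Real.pi * (l + 1) * z - 2 * Real.pi * (l' + 1) * z by push_cast; ring,
        show (2 * Real.pi * (((l : ℤ) + l' + 2 : ℤ) : ℝ) * z : ℝ) =
          2 * Real.pi * (l + 1) * z + 2 * Real.pi * (l' + 1) * z by push_cast; ring,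
        Real.cos_sub, Real.cos_add]
      linear_combination (Real.cos (2 * Real.pi * (l + 1) * z) *
        Real.cos (2 * Real.pi * (l' + 1) * z)) * h2
    rw [integral_congr_ae (.of_forall h), integral_unitInterval (fun x : ℝ =>
      Real.cos (2 * Real.pi * ((l : ℤ) - (l' : ℤ) : ℤ) * x) +
          Real.cos (2 * Real.pi * ((l : ℤ) + l' + 2 : ℤ) * x)), intervalIntegral.integral_add
      (Continuous.intervalIntegrable (by fun_prop) _ _)
      (Continuous.intervalIntegrable (by fun_prop) _ _), integral_cos_two_pi, integral_cos_two_pi]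
    -- Frequencies start at 1, so the sum frequency never vanishes and only the difference frequency
    -- can contribute.
    have h3 : ((l : ℤ) + l' + 2 = 0) = False := by simp; omega
    have h4 : ((l : ℤ) - l' = 0) = (l = l') := by apply propext; omega
    simp [h3, h4]
  moments l j hj := by
    rw [Finset.mem_Icc] at hj
    refine (lintegral_mono (g := fun _ => ENNReal.ofReal 8) fun z => ?_).trans (by simp)
    apply ENNReal.ofReal_le_ofReal
    calc |cosSys l z| ^ j ≤ 2 ^ j := pow_le_pow_left₀ (abs_nonneg _) (abs_cosSys_le l z) j
      _ ≤ 2 ^ 3 := pow_le_pow_right₀ (by norm_num) hj.2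
      _ = 8 := by norm_num

/-! ### The two processes. -/

/-- The smaller of the two sample sizes, but at least `2`. -/
def rateSize (N T : ℕ) : ℕ := max (min N T) 2

lemma two_le_rateSize (N T : ℕ) : (2 : ℝ) ≤ rateSize N T := by
  exact_mod_cast le_max_right _ _

/-- Chosen so that the expected number of ones among min N T draws is 1 once both sample sizes are
at least 2. -/
noncomputable def rareProb (N T : ℕ) : ℝ := 1 / (rateSize N T : ℝ)

/-- It diverges, so that the compensating values disappear from the sample, but slowly enough for
moments of order r to stay bounded. -/
noncomputable def rareHeight (r : ℝ) (N T : ℕ) : ℝ := (rateSize N T : ℝ) ^ (1 / r)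

lemma rareProb_pos (N T : ℕ) : 0 < rareProb N T := by
  have := two_le_rateSize N T
  unfold rareProb; positivity

/-- The moment conditions concern all sample sizes, including 0 and 1; the floor 2 in `rateSize`
keeps the construction well defined there. -/
lemma two_mul_rareProb_le (N T : ℕ) : 2 * rareProb N T ≤ 1 := by
  have := two_le_rateSize N T
  unfold rareProb
  rw [mul_one_div, div_le_one (by linarith)]
  exact this

lemma one_le_rareHeight {r : ℝ} (hr : 0 < r) (N T : ℕ) : 1 ≤ rareHeight r N T :=
  Real.one_le_rpow (by linarith [two_le_rateSize N T]) (by positivity)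

lemma rareHeight_rpow_mul {r : ℝ} (hr : 0 < r) (N T : ℕ) :
    rareHeight r N T ^ r * rareProb N T = 1 := by
  have := two_le_rateSize N T
  unfold rareHeight rareProb
  rw [← Real.rpow_mul (by linarith), one_div_mul_cancel hr.ne', Real.rpow_one]
  field_simp

/-- The error of the cells of type `0` is `τ` times a rare variable, the error of the other cells is
a symmetric sign. -/
noncomputable def err (τ r : ℝ) (N T : ℕ) {n : ℕ} (κ : Fin (n + 1)) (z : I) : ℝ :=
  if κ = 0 then τ * rare (rareProb N T) (rareHeight r N T) z else halfSign z

/-- The variance of the rare variable. -/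
noncomputable def rareVar (r : ℝ) (N T : ℕ) : ℝ := rareProb N T + rareProb N T * rareHeight r N T

/-- Regressors: cells of type `0` identify the first coefficient, cells of type `κ ≠ 0` the sum of the
first coefficient and coefficient `κ`. -/
def regr {n : ℕ} (κ k : Fin (n + 1)) : ℝ := if k = 0 ∨ k = κ then 1 else 0

/-- The cross-sectional or the temporal effect, whichever has fewer draws. -/
def pick (N T : ℕ) (p : I × I × I) : I := if N ≤ T then p.1 else p.2.1

@[fun_prop]
lemma measurable_err (τ r : ℝ) (N T : ℕ) {n : ℕ} (κ : Fin (n + 1)) :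
    Measurable (err τ r N T κ) := by
  unfold err; split_ifs <;> fun_prop

@[fun_prop]
lemma measurable_pick (N T : ℕ) : Measurable (pick N T) := by
  unfold pick; split_ifs <;> fun_prop

lemma abs_regr_le {n : ℕ} (κ k : Fin (n + 1)) : |regr κ k| ≤ 1 := by
  unfold regr; split_ifs <;> simp

/-- The data generating process in which only about one in `min N T` draws of the coarser effect
produces a non-zero error in the cells of type `0`. -/
noncomputable def sparseDGP (H : Submodule ℤ Plane) (M n : ℕ) (r τ : ℝ) : DGP H M (n + 1) where
  alphaLaw := ⟨unif H, inferInstance⟩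
  xiLaw := ⟨unif ℕ, inferInstance⟩
  fn N T p := (fun _ k => regr (cellType n p.2.2) k,
    fun _ => err τ r N T (cellType n p.2.2) (pick N T p))

/-! ### First and second moments of the errors. -/

section Moments

variable {τ r : ℝ} {n : ℕ}

lemma abs_err_le (hτ : |τ| = 1) (hr : 0 < r) (N T : ℕ) (κ : Fin (n + 1)) (z : I) :
    |err τ r N T κ z| ≤ rareHeight r N T := by
  unfold err
  split_ifs
  · rw [abs_mul, hτ, one_mul]
    exact abs_rare_le (one_le_rareHeight hr N T) z
  · rw [abs_halfSign]
    exact one_le_rareHeight hr N T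

lemma integral_err (hr : 0 < r) (N T : ℕ) (κ : Fin (n + 1)) : ∫ z, err τ r N T κ z = 0 := by
  unfold err
  split_ifs
  · rw [integral_const_mul, integral_rare (rareProb_pos N T).le (one_le_rareHeight hr N T)
      (two_mul_rareProb_le N T), mul_zero]
  · exact integral_halfSign

/-- Second moments of the errors. -/
noncomputable def errCov (r : ℝ) (N T : ℕ) {n : ℕ} (κ κ' : Fin (n + 1)) : ℝ :=
  if κ = 0 then (if κ' = 0 then rareVar r N T else 0) else if κ' = 0 then 0 else 1

/-- All types other than 0 share the same sign variable, hence their unit covariances; since |τ| =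
1, the second moments are the same for both processes. -/
lemma integral_err_mul (hτ : |τ| = 1) (hr : 0 < r) (N T : ℕ) (κ κ' : Fin (n + 1)) :
    ∫ z, err τ r N T κ z * err τ r N T κ' z = errCov r N T κ κ' := by
  unfold err errCov
  split_ifs
  · have : ∀ z, τ * rare (rareProb N T) (rareHeight r N T) z *
        (τ * rare (rareProb N T) (rareHeight r N T) z) =
        rare (rareProb N T) (rareHeight r N T) z * rare (rareProb N T) (rareHeight r N T) z := by
      intro z
      have : τ * τ = 1 := by rw [← abs_mul_abs_self, hτ, one_mul]
      linear_combination (rare (rareProb N T) (rareHeight r N T) z) ^ 2 * this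
    simp_rw [this]
    exact integral_rare_sq (rareProb_pos N T).le (one_le_rareHeight hr N T)
      (two_mul_rareProb_le N T)
  · simp_rw [mul_assoc]
    rw [integral_const_mul, integral_rare_mul_halfSign, mul_zero]
  · simp_rw [mul_left_comm _ τ, mul_comm (halfSign _)]
    rw [integral_const_mul, integral_rare_mul_halfSign, mul_zero]
  · simp_rw [← sq, halfSign_sq]
    simp

end Moments

/-! ### Integration over the latent variables. -/

section Latent

variable {H : Submodule ℤ Plane}

/-- The law of i.i.d. uniform latent variables. -/
noncomputable abbrev uniformLatent (H : Submodule ℤ Plane) : Measure (Latent H) :=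
  (unif H).prod ((unif ℕ).prod (unif (ℕ × ℕ)))

lemma sparseDGP_latentLaw (M n : ℕ) (r τ : ℝ) :
    (sparseDGP H M n r τ).latentLaw = uniformLatent H := rfl

lemma integral_uniformLatent_mul (F : (H → I) → ℝ) (G : (ℕ → I) → ℝ) (E : (ℕ × ℕ → I) → ℝ) :
    ∫ ω, F ω.1 * (G ω.2.1 * E ω.2.2) ∂(uniformLatent H) =
      (∫ x, F x ∂(unif H)) * ((∫ x, G x ∂(unif ℕ)) * ∫ x, E x ∂(unif (ℕ × ℕ))) := by
  rw [integral_prod_mul (f := F) (g := fun p : (ℕ → I) × (ℕ × ℕ → I) => G p.1 * E p.2),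
    integral_prod_mul]

/-- The draw of the coarser effect that enters cell `(i, t)`. -/
def drive (loc : Design H) (N T : ℕ) (i : Fin N) (t : Fin T) (ω : Latent H) : I :=
  pick N T (DGP.cell loc N T i t ω)

@[fun_prop]
lemma measurable_cell (loc : Design H) (N T : ℕ) (i : Fin N) (t : Fin T) :
    Measurable (DGP.cell loc N T i t) := by
  unfold DGP.cell; fun_prop

@[fun_prop]
lemma measurable_drive (loc : Design H) (N T : ℕ) (i : Fin N) (t : Fin T) :
    Measurable (drive loc N T i t) := by
  unfold drive; fun_prop

/-- Distinct cells have independent idiosyncratic draws and `c` is centred, so cross terms vanish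
even between cells that share a draw of the coarser effect. -/
lemma integral_drive_mul_cell {loc : Design H} {N T : ℕ} {w w' c c' : I → ℝ} (hw : Measurable w)
    (hw' : Measurable w') (hc : Measurable c) (hc' : Measurable c') (h0 : ∫ z, c z = 0)
    (i j : Fin N) (t s : Fin T) :
    ∫ ω, (w (drive loc N T i t ω) * w' (drive loc N T j s ω)) *
        (c (ω.2.2 (i, t)) * c' (ω.2.2 (j, s))) ∂(uniformLatent H) =
      if i = j ∧ t = s then (∫ z, w z * w' z) * ∫ z, c z * c' z else 0 := by
  have h3 : (((i : ℕ), (t : ℕ)) = ((j : ℕ), (s : ℕ))) = (i = j ∧ t = s) := by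
    simp [Fin.ext_iff]
  by_cases h : N ≤ T
  · have h1 := integral_uniformLatent_mul (H := H) (fun x => w (x (loc N i)) * w' (x (loc N j)))
      (fun _ => 1) fun x => c (x (i, t)) * c' (x (j, s))
    simp only [one_mul] at h1
    simp only [drive, pick, h, if_true, DGP.cell]
    classical
    rw [h1, integral_eval_mul_eval_unif _ _ hw hw', integral_eval_mul_eval_unif _ _ hc hc', h0]
    simp only [h3]
    split_ifs with h4 h5 h6
    · simp
    · simp
    · exact absurd (by rw [h6.1]) h4
    · simp
  · have h1 := integral_uniformLatent_mul (H := H) (fun _ => 1)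
      (fun x => w (x t) * w' (x s)) fun x => c (x (i, t)) * c' (x (j, s))
    simp only [one_mul] at h1
    simp only [drive, pick, h, if_false, DGP.cell]
    rw [h1, integral_eval_mul_eval_unif _ _ hw hw', integral_eval_mul_eval_unif _ _ hc hc', h0]
    simp only [h3]
    split_ifs with h4 h5 h6
    · simp
    · simp
    · exact absurd (by rw [h6.2]) h4
    · simp

end Latent

/-! ### Hoeffding components of the score and their variances. -/

section Components

variable {H : Submodule ℤ Plane} {M n : ℕ} {r τ : ℝ}

/-- The weight of the indicator of type `κ` in the score of coordinate `k`. -/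
noncomputable def scoreWeight (M : ℕ) (τ r : ℝ) (N T : ℕ) {n : ℕ} (k κ : Fin (n + 1)) (z : I) : ℝ :=
  M * regr κ k * err τ r N T κ z

/-- The conditional mean of the score given the coarser effect. -/
noncomputable def scoreMean (M : ℕ) (τ r : ℝ) (N T : ℕ) {n : ℕ} (k : Fin (n + 1)) (z : I) : ℝ :=
  1 / (n + 1 : ℝ) * ∑ κ, scoreWeight M τ r N T k κ z

/-- The deviation of the score from its conditional mean. -/
noncomputable def scoreDev (M : ℕ) (τ r : ℝ) (N T : ℕ) {n : ℕ} (k : Fin (n + 1)) (z z' : I) : ℝ :=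
  ∑ κ, scoreWeight M τ r N T k κ z * typeDev n κ z'

@[fun_prop]
lemma measurable_scoreWeight (N T : ℕ) (k κ : Fin (n + 1)) :
    Measurable (scoreWeight M τ r N T k κ) := by unfold scoreWeight; fun_prop

@[fun_prop]
lemma measurable_scoreMean (N T : ℕ) (k : Fin (n + 1)) :
    Measurable (scoreMean M τ r N T k) := by unfold scoreMean; fun_prop

/-- Each type indicator is split into its mean 1/(n + 1) and its centred part; these yield the part
driven by the effect alone and the idiosyncratic part. -/
lemma score_sparseDGP (N T : ℕ) (k : Fin (n + 1)) (p : I × I × I) :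
    (sparseDGP H M n r τ).score N T k p =
      scoreMean M τ r N T k (pick N T p) + scoreDev M τ r N T k (pick N T p) p.2.2 := by
  unfold DGP.score scoreMean scoreDev
  have h : ∀ κ, scoreWeight M τ r N T k κ (pick N T p) * typeDev n κ p.2.2 =
      (if cellType n p.2.2 = κ then scoreWeight M τ r N T k κ (pick N T p) else 0) -
        1 / (n + 1 : ℝ) * scoreWeight M τ r N T k κ (pick N T p) := by
    intro κ; unfold typeDev; split_ifs <;> ring
  simp_rw [h]
  rw [Finset.sum_sub_distrib, ← Finset.mul_sum, Finset.sum_ite_eq]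
  simp [sparseDGP, scoreWeight]
  ring

lemma abs_scoreWeight_le (hτ : |τ| = 1) (hr : 0 < r) (N T : ℕ) (k κ : Fin (n + 1)) (z : I) :
    |scoreWeight M τ r N T k κ z| ≤ M * rareHeight r N T := by
  unfold scoreWeight
  rw [abs_mul, abs_mul, Nat.abs_cast]
  have h1 := abs_err_le hτ hr N T κ z
  have h2 := abs_regr_le κ k
  have h3 : (M : ℝ) * |regr κ k| ≤ M := mul_le_of_le_one_right (Nat.cast_nonneg M) h2
  exact mul_le_mul h3 h1 (abs_nonneg _) (Nat.cast_nonneg M)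

lemma abs_scoreDev_le (hτ : |τ| = 1) (hr : 0 < r) (N T : ℕ) (k : Fin (n + 1)) (z z' : I) :
    |scoreDev M τ r N T k z z'| ≤ ∑ _κ : Fin (n + 1), M * rareHeight r N T := by
  refine (Finset.abs_sum_le_sum_abs _ _).trans (Finset.sum_le_sum fun κ _ => ?_)
  rw [abs_mul]
  have h1 := abs_scoreWeight_le (M := M) hτ hr N T k κ z
  exact (mul_le_of_le_one_right (abs_nonneg _) (abs_typeDev_le n κ z')).trans h1

lemma abs_scoreMean_le (hτ : |τ| = 1) (hr : 0 < r) (N T : ℕ) (k : Fin (n + 1)) (z : I) :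
    |scoreMean M τ r N T k z| ≤ ∑ _κ : Fin (n + 1), M * rareHeight r N T := by
  unfold scoreMean
  rw [abs_mul]
  have h1 : |1 / (n + 1 : ℝ)| ≤ 1 := by
    rw [abs_of_nonneg (by positivity), div_le_one (by positivity)]
    linarith [(Nat.cast_nonneg n : (0 : ℝ) ≤ n)]
  refine (mul_le_of_le_one_left (abs_nonneg _) h1).trans ?_
  refine (Finset.abs_sum_le_sum_abs _ _).trans (Finset.sum_le_sum fun κ _ => ?_)
  exact abs_scoreWeight_le hτ hr N T k κ z

lemma integral_scoreMean (hτ : |τ| = 1) (hr : 0 < r) (N T : ℕ) (k : Fin (n + 1)) :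
    ∫ z, scoreMean M τ r N T k z = 0 := by
  unfold scoreMean
  rw [integral_const_mul, integral_finsetSum _ fun κ _ => integrable_of_abs_le (by fun_prop)
    (abs_scoreWeight_le hτ hr N T k κ)]
  simp [scoreWeight, integral_const_mul, integral_err hr]

lemma measurable_score (N T : ℕ) (k : Fin (n + 1)) :
    Measurable ((sparseDGP H M n r τ).score N T k) := by
  have : (sparseDGP H M n r τ).score N T k = fun p =>
      scoreMean M τ r N T k (pick N T p) + scoreDev M τ r N T k (pick N T p) p.2.2 :=
    funext (score_sparseDGP N T k)
  rw [this]
  unfold scoreDev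
  fun_prop

lemma exists_abs_score_le (hτ : |τ| = 1) (hr : 0 < r) (N T : ℕ) (k : Fin (n + 1)) :
    ∃ C, ∀ p, |(sparseDGP H M n r τ).score N T k p| ≤ C := by
  refine ⟨(∑ _κ : Fin (n + 1), M * rareHeight r N T) + ∑ _κ : Fin (n + 1), M * rareHeight r N T,
    fun p => ?_⟩
  rw [score_sparseDGP]
  exact (abs_add_le _ _).trans (add_le_add (abs_scoreMean_le hτ hr N T k _)
    (abs_scoreDev_le hτ hr N T k _ _))

/-- Integrating out the idiosyncratic draw removes the centred type indicators. The 0 in the third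
slot is a placeholder which `pick` ignores. -/
lemma condAD_sparseDGP (N T : ℕ) (k : Fin (n + 1)) (x y : I) :
    (sparseDGP H M n r τ).condAD N T k x y = scoreMean M τ r N T k (pick N T (x, y, 0)) := by
  unfold DGP.condAD
  have h : ∀ z, (sparseDGP H M n r τ).score N T k (x, y, z) =
      scoreMean M τ r N T k (pick N T (x, y, 0)) +
        ∑ κ, scoreWeight M τ r N T k κ (pick N T (x, y, 0)) * typeDev n κ z := by
    intro z; rw [score_sparseDGP]; rfl
  simp_rw [h]
  have hi : ∀ κ, Integrable fun z => scoreWeight M τ r N T k κ (pick N T (x, y, 0)) *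
      typeDev n κ z := fun κ => (integrable_of_abs_le (by fun_prop) (abs_typeDev_le n κ)).const_mul _
  rw [integral_add (integrable_const _) (integrable_finsetSum _ fun κ _ => hi κ),
    integral_finsetSum _ fun κ _ => hi κ]
  simp [integral_const_mul, integral_typeDev]

lemma condA_sparseDGP (hτ : |τ| = 1) (hr : 0 < r) (N T : ℕ) (k : Fin (n + 1)) (x : I) :
    (sparseDGP H M n r τ).condA N T k x = if N ≤ T then scoreMean M τ r N T k x else 0 := by
  obtain ⟨C, hC⟩ := exists_abs_score_le (H := H) (M := M) hτ hr N T k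
  have hm := measurable_score (H := H) (M := M) (τ := τ) (r := r) N T k
  have h1 : (sparseDGP H M n r τ).condA N T k x =
      ∫ y, (sparseDGP H M n r τ).condAD N T k x y := by
    unfold DGP.condA DGP.condAD
    exact integral_prod (fun p : I × I => (sparseDGP H M n r τ).score N T k (x, p.1, p.2))
      (integrable_of_abs_le (by fun_prop) fun p => hC _)
  rw [h1]
  simp_rw [condAD_sparseDGP]
  split_ifs with h
  · simp [pick, h]
  · simp [pick, h, integral_scoreMean hτ hr]

lemma condD_sparseDGP (hτ : |τ| = 1) (hr : 0 < r) (N T : ℕ) (k : Fin (n + 1)) (y : I) :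
    (sparseDGP H M n r τ).condD N T k y = if N ≤ T then 0 else scoreMean M τ r N T k y := by
  obtain ⟨C, hC⟩ := exists_abs_score_le (H := H) (M := M) hτ hr N T k
  have hm := measurable_score (H := H) (M := M) (τ := τ) (r := r) N T k
  have h1 : (sparseDGP H M n r τ).condD N T k y =
      ∫ x, (sparseDGP H M n r τ).condAD N T k x y := by
    unfold DGP.condD DGP.condAD
    exact integral_prod (fun p : I × I => (sparseDGP H M n r τ).score N T k (p.1, y, p.2))
      (integrable_of_abs_le (by fun_prop) fun p => hC _)
  rw [h1]
  simp_rw [condAD_sparseDGP]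
  split_ifs with h
  · simp [pick, h, integral_scoreMean hτ hr]
  · simp [pick, h]

lemma meanS_sparseDGP (hτ : |τ| = 1) (hr : 0 < r) (N T : ℕ) (k : Fin (n + 1)) :
    (sparseDGP H M n r τ).meanS N T k = 0 := by
  obtain ⟨C, hC⟩ := exists_abs_score_le (H := H) (M := M) hτ hr N T k
  have hm := measurable_score (H := H) (M := M) (τ := τ) (r := r) N T k
  have h1 : (sparseDGP H M n r τ).meanS N T k =
      ∫ x, (sparseDGP H M n r τ).condA N T k x := by
    unfold DGP.meanS DGP.condA
    exact integral_prod (fun p : I × I × I => (sparseDGP H M n r τ).score N T k p)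
      (integrable_of_abs_le (by fun_prop) fun p => hC _)
  rw [h1]
  simp_rw [condA_sparseDGP hτ hr]
  split_ifs
  · exact integral_scoreMean hτ hr N T k
  · simp

lemma compA_sparseDGP (hτ : |τ| = 1) (hr : 0 < r) (N T : ℕ) (k : Fin (n + 1)) (p : I × I × I) :
    (sparseDGP H M n r τ).compA N T k p = if N ≤ T then scoreMean M τ r N T k (pick N T p) else 0 := by
  unfold DGP.compA
  rw [condA_sparseDGP hτ hr, meanS_sparseDGP hτ hr, sub_zero]
  split_ifs with h <;> simp [pick, h]

lemma compD_sparseDGP (hτ : |τ| = 1) (hr : 0 < r) (N T : ℕ) (k : Fin (n + 1)) (p : I × I × I) :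
    (sparseDGP H M n r τ).compD N T k p = if N ≤ T then 0 else scoreMean M τ r N T k (pick N T p) := by
  unfold DGP.compD
  rw [condD_sparseDGP hτ hr, meanS_sparseDGP hτ hr, sub_zero]
  split_ifs with h <;> simp [pick, h]

/-- The conditional mean given both effects is a function of one of them, which the main effect of
that one already exhausts. -/
lemma compV_sparseDGP (hτ : |τ| = 1) (hr : 0 < r) (N T : ℕ) (k : Fin (n + 1)) (p : I × I × I) :
    (sparseDGP H M n r τ).compV N T k p = 0 := by
  unfold DGP.compV
  rw [condA_sparseDGP hτ hr, condD_sparseDGP hτ hr, condAD_sparseDGP, meanS_sparseDGP hτ hr]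
  split_ifs with h <;> simp [pick, h]

lemma compE_sparseDGP (N T : ℕ) (k : Fin (n + 1)) (p : I × I × I) :
    (sparseDGP H M n r τ).compE N T k p = scoreDev M τ r N T k (pick N T p) p.2.2 := by
  unfold DGP.compE
  rw [condAD_sparseDGP, score_sparseDGP]
  have : pick N T (p.1, p.2.1, 0) = pick N T p := rfl
  rw [this]; ring

/-- Second moments of the conditional means of the scores. -/
noncomputable def meanCov (M : ℕ) (r : ℝ) (N T : ℕ) {n : ℕ} (k l : Fin (n + 1)) : ℝ :=
  (1 / (n + 1 : ℝ)) ^ 2 * ∑ κ, ∑ κ', (M * regr κ k) * (M * regr κ' l) * errCov r N T κ κ'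

/-- Second moments of the deviations of the scores from their conditional means. -/
noncomputable def devCov (M : ℕ) (r : ℝ) (N T : ℕ) {n : ℕ} (k l : Fin (n + 1)) : ℝ :=
  ∑ κ, ∑ κ', (M * regr κ k) * (M * regr κ' l) * errCov r N T κ κ' *
    ((if κ = κ' then 1 / (n + 1 : ℝ) else 0) - (1 / (n + 1 : ℝ)) ^ 2)

lemma integral_scoreWeight_mul (hτ : |τ| = 1) (hr : 0 < r) (N T : ℕ) (k l κ κ' : Fin (n + 1)) :
    ∫ z, scoreWeight M τ r N T k κ z * scoreWeight M τ r N T l κ' z =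
      (M * regr κ k) * (M * regr κ' l) * errCov r N T κ κ' := by
  have : ∀ z, scoreWeight M τ r N T k κ z * scoreWeight M τ r N T l κ' z =
      ((M * regr κ k) * (M * regr κ' l)) * (err τ r N T κ z * err τ r N T κ' z) := by
    intro z; unfold scoreWeight; ring
  simp_rw [this]
  rw [integral_const_mul, integral_err_mul hτ hr]

lemma integral_scoreMean_mul (hτ : |τ| = 1) (hr : 0 < r) (N T : ℕ) (k l : Fin (n + 1)) :
    ∫ z, scoreMean M τ r N T k z * scoreMean M τ r N T l z = meanCov M r N T k l := by
  have h : ∀ z, scoreMean M τ r N T k z * scoreMean M τ r N T l z =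
      (1 / (n + 1 : ℝ)) ^ 2 * ∑ κ, ∑ κ', scoreWeight M τ r N T k κ z *
        scoreWeight M τ r N T l κ' z := by
    intro z
    unfold scoreMean
    rw [← Finset.sum_mul_sum]; ring
  have hi : ∀ κ κ' : Fin (n + 1), Integrable fun z => scoreWeight M τ r N T k κ z *
      scoreWeight M τ r N T l κ' z := fun κ κ' => by
    refine integrable_of_abs_le (by fun_prop)
      (C := (M * rareHeight r N T) * (M * rareHeight r N T)) fun z => ?_
    rw [abs_mul]
    exact mul_le_mul (abs_scoreWeight_le hτ hr N T k κ z) (abs_scoreWeight_le hτ hr N T l κ' z)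
      (abs_nonneg _) ((abs_nonneg _).trans (abs_scoreWeight_le hτ hr N T k κ z))
  simp_rw [h]
  rw [integral_const_mul, integral_finsetSum _ fun κ _ => integrable_finsetSum _ fun κ' _ =>
    hi κ κ']
  unfold meanCov
  congr 1
  refine Finset.sum_congr rfl fun κ _ => ?_
  rw [integral_finsetSum _ fun κ' _ => hi κ κ']
  exact Finset.sum_congr rfl fun κ' _ => integral_scoreWeight_mul hτ hr N T k l κ κ'

lemma integral_scoreDev_mul_cell (hτ : |τ| = 1) (hr : 0 < r) {loc : Design H} (N T : ℕ)
    (k l : Fin (n + 1)) (i j : Fin N) (t s : Fin T) :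
    ∫ ω, scoreDev M τ r N T k (drive loc N T i t ω) (ω.2.2 (i, t)) *
      scoreDev M τ r N T l (drive loc N T j s ω) (ω.2.2 (j, s)) ∂(uniformLatent H) =
      if i = j ∧ t = s then devCov M r N T k l else 0 := by
  have h : ∀ ω : Latent H, scoreDev M τ r N T k (drive loc N T i t ω) (ω.2.2 (i, t)) *
      scoreDev M τ r N T l (drive loc N T j s ω) (ω.2.2 (j, s)) =
      ∑ κ, ∑ κ', (scoreWeight M τ r N T k κ (drive loc N T i t ω) *
        scoreWeight M τ r N T l κ' (drive loc N T j s ω)) *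
        (typeDev n κ (ω.2.2 (i, t)) * typeDev n κ' (ω.2.2 (j, s))) := by
    intro ω
    unfold scoreDev
    rw [Finset.sum_mul_sum]
    exact Finset.sum_congr rfl fun κ _ => Finset.sum_congr rfl fun κ' _ => by ring
  have hi : ∀ κ κ' : Fin (n + 1), Integrable (fun ω : Latent H =>
      (scoreWeight M τ r N T k κ (drive loc N T i t ω) *
        scoreWeight M τ r N T l κ' (drive loc N T j s ω)) *
        (typeDev n κ (ω.2.2 (i, t)) * typeDev n κ' (ω.2.2 (j, s)))) (uniformLatent H) :=
      fun κ κ' => by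
    refine integrable_of_abs_le (by fun_prop)
      (C := ((M * rareHeight r N T) * (M * rareHeight r N T)) * (1 * 1)) fun ω => ?_
    rw [abs_mul, abs_mul, abs_mul]
    have h0 : 0 ≤ M * rareHeight r N T :=
      (abs_nonneg _).trans (abs_scoreWeight_le (M := M) hτ hr N T k κ 0)
    gcongr
    · exact abs_scoreWeight_le hτ hr N T k κ _
    · exact abs_scoreWeight_le hτ hr N T l κ' _
    · exact abs_typeDev_le n κ _
    · exact abs_typeDev_le n κ' _
  simp_rw [h]
  rw [integral_finsetSum _ fun κ _ => integrable_finsetSum _ fun κ' _ => hi κ κ']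
  have h2 : ∀ κ κ' : Fin (n + 1), ∫ ω,
      (scoreWeight M τ r N T k κ (drive loc N T i t ω) *
        scoreWeight M τ r N T l κ' (drive loc N T j s ω)) *
        (typeDev n κ (ω.2.2 (i, t)) * typeDev n κ' (ω.2.2 (j, s))) ∂(uniformLatent H) =
      if i = j ∧ t = s then (M * regr κ k) * (M * regr κ' l) * errCov r N T κ κ' *
        ((if κ = κ' then 1 / (n + 1 : ℝ) else 0) - (1 / (n + 1 : ℝ)) ^ 2) else 0 := by
    intro κ κ'
    rw [integral_drive_mul_cell (by fun_prop) (by fun_prop) (by fun_prop) (by fun_prop)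
      (integral_typeDev n κ), integral_scoreWeight_mul hτ hr, integral_typeDev_mul]
  simp_rw [integral_finsetSum _ fun κ' _ => hi _ κ', h2]
  split_ifs with h4
  · rfl
  · simp

/-- The effects are independent across sites, and injectivity of the locations gives distinct units
distinct sites; only the diagonal terms survive. -/
lemma varA_sparseDGP (hτ : |τ| = 1) (hr : 0 < r) {loc : Design H}
    (hloc : ∀ N, Function.Injective (loc N)) (N T : ℕ) (k l : Fin (n + 1)) :
    (sparseDGP H M n r τ).varA loc N T k l =
      if N ≤ T ∧ 0 < N then meanCov M r N T k l else 0 := by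
  unfold DGP.varA
  simp only [Matrix.of_apply, meanS_sparseDGP hτ hr, condA_sparseDGP hτ hr, sub_zero,
    sparseDGP_latentLaw]
  by_cases h : N ≤ T
  · simp only [h, if_true, true_and]
    have h1 : ∀ i j : Fin N, ∫ ω, scoreMean M τ r N T k (ω.1 (loc N i)) *
        scoreMean M τ r N T l (ω.1 (loc N j)) ∂(uniformLatent H) =
        if i = j then meanCov M r N T k l else 0 := by
      intro i j
      have h2 := integral_uniformLatent_mul (H := H) (fun x => scoreMean M τ r N T k (x (loc N i)) *
        scoreMean M τ r N T l (x (loc N j))) (fun _ => 1) fun _ => 1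
      simp only [mul_one] at h2
      classical
      rw [h2, integral_eval_mul_eval_unif _ _ (by fun_prop) (by fun_prop),
        integral_scoreMean_mul hτ hr, integral_scoreMean hτ hr]
      simp [(hloc N).eq_iff]
    simp_rw [h1]
    split_ifs with h3
    · have : (N : ℝ) ≠ 0 := by positivity
      simp; field_simp
    · have : N = 0 := by omega
      subst this; simp
  · simp [h]

lemma varD_sparseDGP (hτ : |τ| = 1) (hr : 0 < r) (N T : ℕ) (k l : Fin (n + 1)) :
    (sparseDGP H M n r τ).varD N T k l =
      if T < N ∧ 0 < T then meanCov M r N T k l else 0 := by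
  unfold DGP.varD
  simp only [Matrix.of_apply, meanS_sparseDGP hτ hr, condD_sparseDGP hτ hr, sub_zero,
    sparseDGP_latentLaw]
  by_cases h : N ≤ T
  · simp [h, not_lt.2 h]
  · have h' : T < N := not_le.1 h
    simp only [h, if_false, h', true_and]
    have h1 : ∀ i j : Fin T, ∫ ω, scoreMean M τ r N T k (ω.2.1 i) *
        scoreMean M τ r N T l (ω.2.1 j) ∂(uniformLatent H) =
        if i = j then meanCov M r N T k l else 0 := by
      intro i j
      have h2 := integral_uniformLatent_mul (H := H) (fun _ => 1)
        (fun x => scoreMean M τ r N T k (x i) * scoreMean M τ r N T l (x j)) fun _ => 1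
      simp only [mul_one, one_mul] at h2
      rw [h2, integral_eval_mul_eval_unif _ _ (by fun_prop) (by fun_prop),
        integral_scoreMean_mul hτ hr, integral_scoreMean hτ hr]
      simp [Fin.ext_iff]
    simp_rw [h1]
    split_ifs with h3
    · have : (T : ℝ) ≠ 0 := by positivity
      simp; field_simp
    · have : T = 0 := by omega
      subst this; simp

lemma varV_sparseDGP (hτ : |τ| = 1) (hr : 0 < r) {loc : Design H} (N T : ℕ)
    (k l : Fin (n + 1)) : (sparseDGP H M n r τ).varV loc N T k l = 0 := by
  simp [DGP.varV, DGP.varCell, compV_sparseDGP hτ hr]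

lemma varE_sparseDGP (hτ : |τ| = 1) (hr : 0 < r) {loc : Design H} (N T : ℕ)
    (k l : Fin (n + 1)) :
    (sparseDGP H M n r τ).varE loc N T k l = if 0 < N ∧ 0 < T then devCov M r N T k l else 0 := by
  unfold DGP.varE DGP.varCell
  simp only [Matrix.of_apply, compE_sparseDGP, sparseDGP_latentLaw]
  have h1 : ∀ (i j : Fin N) (t s : Fin T), ∫ ω,
      scoreDev M τ r N T k (pick N T (DGP.cell loc N T i t ω)) (DGP.cell loc N T i t ω).2.2 *
      scoreDev M τ r N T l (pick N T (DGP.cell loc N T j s ω)) (DGP.cell loc N T j s ω).2.2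
        ∂(uniformLatent H) = if i = j then (if t = s then devCov M r N T k l else 0) else 0 :=
    fun i j t s => by
      rw [← ite_and]; exact integral_scoreDev_mul_cell hτ hr N T k l i j t s
  simp_rw [h1]
  have h2 : ∑ i : Fin N, ∑ j : Fin N, ∑ t : Fin T, ∑ s : Fin T,
      (if i = j then (if t = s then devCov M r N T k l else 0) else 0) =
      (N : ℝ) * T * devCov M r N T k l := by
    have : ∀ i j : Fin N, ∑ t : Fin T, ∑ s : Fin T,
        (if i = j then (if t = s then devCov M r N T k l else 0) else 0) =
        if i = j then (T : ℝ) * devCov M r N T k l else 0 := by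
      intro i j
      split_ifs <;> simp
    simp_rw [this]
    simp [mul_assoc]
  rw [h2]
  split_ifs with h3
  · have h4 : (N : ℝ) ≠ 0 := by have := h3.1; positivity
    have h5 : (T : ℝ) ≠ 0 := by have := h3.2; positivity
    field_simp
  · have : (N : ℝ) * T = 0 := by
      rcases not_and_or.1 h3 with h | h
      · simp [show N = 0 by omega]
      · simp [show T = 0 by omega]
    simp [this]

end Components

/-! ### Stationarity, spectral representation, mixing and the excluded regime. -/

section Structure

variable {H : Submodule ℤ Plane} {M n : ℕ} {r τ : ℝ}

@[fun_prop]
lemma measurable_regr_cellType (k : Fin (n + 1)) :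
    Measurable fun z : I => regr (cellType n z) k :=
  (Measurable.of_discrete (f := fun κ : Fin (n + 1) => regr κ k)).comp (measurable_cellType n)

lemma measurable_fn_sparseDGP (N T : ℕ) : Measurable ((sparseDGP H M n r τ).fn N T) := by
  have h1 : Measurable fun p : I × I × I => err τ r N T (cellType n p.2.2) (pick N T p) := by
    unfold err
    refine Measurable.ite ?_ (by fun_prop) (by fun_prop)
    exact ((measurable_cellType n).comp (by fun_prop : Measurable fun p : I × I × I => p.2.2))
      (measurableSet_singleton 0)
  unfold sparseDGP
  refine Measurable.prodMk ?_ ?_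
  · refine measurable_pi_lambda _ fun _ => measurable_pi_lambda _ fun k => ?_
    exact (measurable_regr_cellType k).comp (by fun_prop : Measurable fun p : I × I × I => p.2.2)
  · exact measurable_pi_lambda _ fun _ => h1

/-- A product of identical factors is invariant under injective relabelling of its coordinates, in
particular under shifts. -/
lemma representation_sparseDGP : (sparseDGP H M n r τ).Representation where
  measurable_fn := measurable_fn_sparseDGP
  alpha_uniform h := (measurePreserving_eval_unif h).map_eq
  alpha_stationary h :=
    Measure.map_infinitePi_infinitePi_of_inj (P := fun _ : H => (volume : Measure I))
      (add_left_injective h)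
  xi_uniform t := (measurePreserving_eval_unif t).map_eq
  xi_stationary :=
    Measure.map_infinitePi_infinitePi_of_inj (P := fun _ : ℕ => (volume : Measure I))
      (add_left_injective 1)

lemma spectralRepresentation_sparseDGP (hτ : |τ| = 1) (hr : 0 < r) :
    (sparseDGP H M n r τ).SpectralRepresentation := by
  refine ⟨fun _ => cosSys, fun _ => cosSys, fun _ _ _ _ => 0, fun _ => 0, 8, by norm_num,
    fun _ => boundedOrthonormal_cosSys, fun _ => boundedOrthonormal_cosSys, by simp, ?_, ?_⟩
  · simp
  · intro N T k
    simp [compV_sparseDGP hτ hr]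

lemma timeMixing_sparseDGP (ζ : ℝ) : (sparseDGP H M n r τ).TimeMixing ζ := by
  refine ⟨2 * ζ / (ζ - 1) + 1, by linarith, ?_⟩
  have h : ∀ᶠ s in atTop, (sparseDGP H M n r τ).mixXi s = 0 := by
    filter_upwards [eventually_ge_atTop 1] with s hs
    have : ∀ m : ℕ, mixing ((sparseDGP H M n r τ).xiLaw : Measure (ℕ → I)) (Set.Iic m)
        (Set.Ici (m + s)) = 0 := fun m => by
      refine mixing_unif_of_disjoint (Set.disjoint_left.2 fun x hx hx' => ?_)
      simp only [Set.mem_Iic, Set.mem_Ici] at hx hx'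
      omega
    simp [DGP.mixXi, this]
  exact (EventuallyEq.trans_isBigO (f₂ := fun _ => (0 : ℝ)) h (Asymptotics.isBigO_zero _ _))

lemma spatialMixing_sparseDGP {ζ δ : ℝ} (hζ : 1 < ζ) (hδ : 0 < δ) (loc : Design H) :
    (sparseDGP H M n r τ).SpatialMixing loc ζ δ := by
  have h : ∀ᶠ x : ℝ in atTop,
      (sparseDGP H M n r τ).mixAlpha loc x ^ (1 - 1 / (2 * (ζ + δ) - 1)) = 0 := by
    -- At positive distance the two sets of sites are disjoint, so the corresponding effects are
    -- independent.
    filter_upwards [eventually_gt_atTop 0] with x hx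
    have h0 : ∀ c ∈ {c : ℝ | ∃ (N : ℕ) (A B : Set (Fin N)),
        (∀ i ∈ A, ∀ j ∈ B, x ≤ dist (loc N i : Plane) (loc N j : Plane)) ∧
        c = mixing ((sparseDGP H M n r τ).alphaLaw : Measure (H → I)) (loc N '' A) (loc N '' B)},
        c = 0 := by
      rintro c ⟨N, A, B, hAB, rfl⟩
      refine mixing_unif_of_disjoint (Set.disjoint_left.2 ?_)
      rintro y ⟨i, hi, rfl⟩ ⟨j, hj, hij⟩
      have := hAB i hi j hj
      rw [hij, dist_self] at this
      linarith
    have h1 : (sparseDGP H M n r τ).mixAlpha loc x = 0 := by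
      unfold DGP.mixAlpha
      exact le_antisymm (Real.sSup_nonpos fun c hc => (h0 c hc).le)
        (Real.sSup_nonneg fun c hc => (h0 c hc).ge)
    -- The exponent has to be non-zero, since 0 to the power 0 is 1.
    have h2 : 1 / (2 * (ζ + δ) - 1) < 1 := by
      rw [div_lt_one (by linarith)]; linarith
    rw [h1, Real.zero_rpow (by linarith)]
  exact (EventuallyEq.trans_isLittleO (f₂ := fun _ => (0 : ℝ)) h (Asymptotics.isLittleO_zero _ _))

lemma not_intermediateNonGaussian_sparseDGP (hτ : |τ| = 1) (hr : 0 < r) (loc : Design H)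
    (k : Fin (n + 1)) (m : ℕ → ℕ × ℕ) :
    ¬ (sparseDGP H M n r τ).IntermediateNonGaussian loc k m := by
  rintro ⟨-, q, hq, h⟩
  obtain ⟨j, hj⟩ := h.exists
  rw [varV_sparseDGP hτ hr] at hj
  linarith

end Structure

/-! ### Eigenvalue bounds for the score variances. -/

section Quadratic

variable {n : ℕ}

lemma posSemidef_sub_smul_one {A : Matrix (Fin n) (Fin n) ℝ} {q : ℝ} (hA : ∀ k l, A k l = A l k)
    (h : ∀ x : Fin n → ℝ, q * ∑ k, x k ^ 2 ≤ ∑ k, ∑ l, x k * A k l * x l) :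
    (A - q • (1 : Matrix (Fin n) (Fin n) ℝ)).PosSemidef := by
  refine .of_dotProduct_mulVec_nonneg ?_ fun x => ?_
  · ext k l
    simp [Matrix.one_apply, hA l k, eq_comm]
  · rw [Matrix.sub_mulVec, dotProduct_sub, Matrix.smul_mulVec, Matrix.one_mulVec]
    have h1 : star x ⬝ᵥ (A.mulVec x) = ∑ k, ∑ l, x k * A k l * x l := by
      simp [dotProduct, Matrix.mulVec, Finset.mul_sum, mul_assoc]
    have h2 : star x ⬝ᵥ (q • x) = q * ∑ k, x k ^ 2 := by
      simp [dotProduct, Finset.mul_sum]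
      exact Finset.sum_congr rfl fun k _ => by ring
    rw [h1, h2]
    linarith [h x]

/-- The coefficient identified by the cells of a given type. -/
lemma sum_mul_regr_zero (x : Fin (n + 1) → ℝ) : ∑ k, x k * regr 0 k = x 0 := by
  rw [Fin.sum_univ_succ]
  simp [regr, Fin.succ_ne_zero]

lemma sum_mul_regr_succ (x : Fin (n + 1) → ℝ) (j : Fin n) :
    ∑ k, x k * regr j.succ k = x 0 + x j.succ := by
  rw [Fin.sum_univ_succ]
  simp [regr, Fin.succ_ne_zero]

/-- The values identified by the types are x 0 and x 0 + x j. Subtracting the first recovers x j, at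
the cost of x 0 once for each j. -/
lemma sum_sq_le_of_regr (x : Fin (n + 1) → ℝ) :
    ∑ k, x k ^ 2 ≤ 2 * ∑ j : Fin n, (∑ k, x k * regr j.succ k) ^ 2 +
      2 * (n + 1) * (∑ k, x k * regr 0 k) ^ 2 := by
  simp_rw [sum_mul_regr_succ, sum_mul_regr_zero]
  rw [Fin.sum_univ_succ]
  have h : ∑ j : Fin n, x j.succ ^ 2 ≤ ∑ j : Fin n, (2 * (x 0 + x j.succ) ^ 2 + 2 * x 0 ^ 2) :=
    Finset.sum_le_sum fun j _ => by nlinarith [sq_nonneg (2 * x 0 + x j.succ)]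
  rw [Finset.sum_add_distrib, ← Finset.mul_sum] at h
  simp at h
  nlinarith [sq_nonneg (x 0)]

lemma sum_errCov (r : ℝ) (N T : ℕ) (y y' : Fin (n + 1) → ℝ) :
    ∑ κ, ∑ κ', y κ * y' κ' * errCov r N T κ κ' =
      rareVar r N T * (y 0 * y' 0) + (∑ j : Fin n, y j.succ) * ∑ j : Fin n, y' j.succ := by
  simp only [Fin.sum_univ_succ, errCov, Fin.succ_ne_zero, if_true, if_false]
  simp [← Finset.sum_mul_sum]
  ring

lemma sum_errCov_diag (r : ℝ) (N T : ℕ) (y y' : Fin (n + 1) → ℝ) :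
    ∑ κ, y κ * y' κ * errCov r N T κ κ =
      rareVar r N T * (y 0 * y' 0) + ∑ j : Fin n, y j.succ * y' j.succ := by
  simp only [Fin.sum_univ_succ, errCov, Fin.succ_ne_zero, if_true, if_false]
  simp
  ring

lemma meanCov_eq (M : ℕ) (r : ℝ) (N T : ℕ) (k l : Fin (n + 1)) :
    meanCov M r N T k l = (1 / (n + 1 : ℝ)) ^ 2 * M ^ 2 *
      (rareVar r N T * (regr 0 k * regr 0 l) +
        (∑ j : Fin n, regr j.succ k) * ∑ j : Fin n, regr j.succ l) := by
  unfold meanCov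
  rw [sum_errCov, ← Finset.mul_sum, ← Finset.mul_sum]
  ring

lemma devCov_eq (M : ℕ) (r : ℝ) (N T : ℕ) (k l : Fin (n + 1)) :
    devCov M r N T k l = 1 / (n + 1 : ℝ) * M ^ 2 * (rareVar r N T * (regr 0 k * regr 0 l) +
      ∑ j : Fin n, regr j.succ k * regr j.succ l) - meanCov M r N T k l := by
  unfold devCov meanCov
  have h : ∀ κ κ' : Fin (n + 1), (M * regr κ k) * (M * regr κ' l) * errCov r N T κ κ' *
      ((if κ = κ' then 1 / (n + 1 : ℝ) else 0) - (1 / (n + 1 : ℝ)) ^ 2) =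
      (if κ = κ' then 1 / (n + 1 : ℝ) * ((M * regr κ k) * (M * regr κ' l) * errCov r N T κ κ')
        else 0) - (1 / (n + 1 : ℝ)) ^ 2 * ((M * regr κ k) * (M * regr κ' l) * errCov r N T κ κ') := by
    intro κ κ'; split_ifs <;> ring
  simp_rw [h, Finset.sum_sub_distrib, Finset.sum_ite_eq, Finset.mem_univ, if_true,
    ← Finset.mul_sum]
  rw [sum_errCov_diag]
  congr 1
  rw [mul_assoc _ ((M : ℝ) ^ 2), mul_add ((M : ℝ) ^ 2), Finset.mul_sum _ _ ((M : ℝ) ^ 2)]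
  congr 1
  congr 1
  · ring
  · exact Finset.sum_congr rfl fun j _ => by ring

lemma meanCov_symm (M : ℕ) (r : ℝ) (N T : ℕ) (k l : Fin (n + 1)) :
    meanCov M r N T k l = meanCov M r N T l k := by
  simp_rw [meanCov_eq]; ring

lemma devCov_symm (M : ℕ) (r : ℝ) (N T : ℕ) (k l : Fin (n + 1)) :
    devCov M r N T k l = devCov M r N T l k := by
  rw [devCov_eq, devCov_eq, meanCov_symm, mul_comm (regr 0 k)]
  simp_rw [mul_comm (regr _ k)]

lemma rareVar_pos {r : ℝ} (hr : 0 < r) (N T : ℕ) : 0 < rareVar r N T := by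
  have h1 := rareProb_pos N T
  have h2 := one_le_rareHeight hr N T
  unfold rareVar; positivity

/-- Every coordinate of the score receives sign errors: the intercept from all types other than 0, a
dummy from its own type. The bound does not use the vanishing `rareVar`, which is what makes the
standardized moments uniformly bounded. -/
lemma meanCov_diag_ge {M : ℕ} (hM : 1 ≤ M) (hn : 1 ≤ n) {r : ℝ} (hr : 0 < r) (N T : ℕ)
    (k : Fin (n + 1)) : (1 / (n + 1 : ℝ)) ^ 2 ≤ meanCov M r N T k k := by
  have hM' : (1 : ℝ) ≤ (M : ℝ) ^ 2 := one_le_pow₀ (by exact_mod_cast hM)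
  have hn' : (1 : ℝ) ≤ n := by exact_mod_cast hn
  have hV := rareVar_pos hr N T
  rw [meanCov_eq, mul_assoc]
  refine le_mul_of_one_le_right (by positivity) ?_
  refine one_le_mul_of_one_le_of_one_le hM' ?_
  have : 1 ≤ ∑ j : Fin n, regr j.succ k := by
    refine Fin.cases ?_ (fun i => ?_) k
    · simpa [regr] using hn
    · simp [regr, Fin.succ_ne_zero]
  nlinarith [mul_self_nonneg (regr (0 : Fin (n + 1)) k)]

/-- After cancellation the diagonal entry is (M/(n + 1))² times n(V + 1) for the intercept and times
n for a dummy, V being `rareVar`. -/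
lemma devCov_diag_ge {M : ℕ} (hM : 1 ≤ M) (hn : 1 ≤ n) {r : ℝ} (hr : 0 < r) (N T : ℕ)
    (k : Fin (n + 1)) : (1 / (n + 1 : ℝ)) ^ 2 ≤ devCov M r N T k k := by
  have hM' : (1 : ℝ) ≤ (M : ℝ) ^ 2 := one_le_pow₀ (by exact_mod_cast hM)
  have hn' : (1 : ℝ) ≤ n := by exact_mod_cast hn
  have hV := rareVar_pos hr N T
  rw [devCov_eq, meanCov_eq]
  have key : ∀ a : ℝ, 1 ≤ a → (1 / (n + 1 : ℝ)) ^ 2 ≤ (1 / (n + 1 : ℝ)) ^ 2 * M ^ 2 * a :=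
    fun a ha => by
      rw [mul_assoc]
      exact le_mul_of_one_le_right (by positivity) (one_le_mul_of_one_le_of_one_le hM' ha)
  refine Fin.cases ?_ (fun i => ?_) k
  · have h1 : ∀ κ : Fin (n + 1), regr κ 0 = 1 := fun κ => by simp [regr]
    simp only [h1]
    refine (key (rareVar r N T * n + n) (by nlinarith)).trans (le_of_eq ?_)
    simp
    field_simp
    ring
  · have h1 : regr (0 : Fin (n + 1)) i.succ = 0 := by simp [regr, Fin.succ_ne_zero]
    have h2 : ∀ j : Fin n, regr j.succ i.succ = if i = j then 1 else 0 := fun j => by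
      simp [regr, Fin.succ_ne_zero]
    simp only [h1, h2]
    refine (key n hn').trans (le_of_eq ?_)
    simp
    field_simp
    ring

/-- In the coordinates y given by the type-wise fitted values, the matrix of means contributes (c -
1)V(y 0)² in the rare direction and only a rank one form in the others; the multinomial fluctuation
of the types supplies the full sum of squares of the remaining y j. -/
lemma quadratic_form_ge {M : ℕ} (hM : 1 ≤ M) {r : ℝ} (hr : 0 < r) (N T : ℕ) {c : ℝ} (hc : 2 ≤ c)
    (hcV : 1 ≤ c * rareVar r N T) (x : Fin (n + 1) → ℝ) :
    1 / (4 * (n + 1 : ℝ) ^ 3) * ∑ k, x k ^ 2 ≤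
      ∑ k, ∑ l, x k * (c * meanCov M r N T k l + devCov M r N T k l) * x l := by
  set V := rareVar r N T with hVdef
  set y : Fin (n + 1) → ℝ := fun κ => ∑ k, x k * regr κ k with hy
  set K : ℝ := n + 1 with hK
  have hM' : (1 : ℝ) ≤ (M : ℝ) ^ 2 := one_le_pow₀ (by exact_mod_cast hM)
  have hV : 0 < V := rareVar_pos hr N T
  have hK1 : 1 ≤ K := by linarith [(Nat.cast_nonneg n : (0 : ℝ) ≤ n)]
  have hb : ∀ κ κ' : Fin (n + 1), ∑ k, ∑ l, x k * (regr κ k * regr κ' l) * x l = y κ * y κ' := by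
    intro κ κ'
    rw [hy, Finset.sum_mul_sum]
    exact Finset.sum_congr rfl fun k _ => Finset.sum_congr rfl fun l _ => by ring
  have e1 : ∀ k l, x k * (c * meanCov M r N T k l + devCov M r N T k l) * x l =
      M ^ 2 * ((c - 1) / K ^ 2 * (V * (x k * (regr 0 k * regr 0 l) * x l) +
        ∑ j : Fin n, ∑ j' : Fin n, x k * (regr j.succ k * regr j'.succ l) * x l) +
      1 / K * (V * (x k * (regr 0 k * regr 0 l) * x l) +
        ∑ j : Fin n, x k * (regr j.succ k * regr j.succ l) * x l)) := by
    intro k l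
    rw [devCov_eq, meanCov_eq]
    simp_rw [← Finset.sum_mul, ← Finset.mul_sum, ← Finset.sum_mul]
    simp only [← hVdef, ← hK]
    field_simp
    ring
  have e2 : ∑ k, ∑ l, x k * (c * meanCov M r N T k l + devCov M r N T k l) * x l =
      M ^ 2 * ((c - 1) / K ^ 2 * (V * (y 0 * y 0) + (∑ j : Fin n, y j.succ) * ∑ j : Fin n, y j.succ)
        + 1 / K * (V * (y 0 * y 0) + ∑ j : Fin n, y j.succ * y j.succ)) := by
    have s0 : ∀ (A B D : Fin (n + 1) → Fin (n + 1) → ℝ) (a b : ℝ),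
        ∑ k, ∑ l, (M : ℝ) ^ 2 * (a * (V * A k l + B k l) + b * (V * A k l + D k l)) =
        M ^ 2 * (a * (V * (∑ k, ∑ l, A k l) + ∑ k, ∑ l, B k l) +
          b * (V * (∑ k, ∑ l, A k l) + ∑ k, ∑ l, D k l)) := by
      intro A B D a b
      simp only [← Finset.mul_sum, Finset.sum_add_distrib]
    have s1 : ∑ k, ∑ l, ∑ j : Fin n, ∑ j' : Fin n, x k * (regr j.succ k * regr j'.succ l) * x l =
        ∑ j : Fin n, ∑ j' : Fin n, y j.succ * y j'.succ := by
      simp_rw [← hb]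
      calc _ = ∑ k, ∑ j : Fin n, ∑ j' : Fin n, ∑ l,
            x k * (regr j.succ k * regr j'.succ l) * x l := by
            refine Finset.sum_congr rfl fun k _ => ?_
            rw [Finset.sum_comm]
            exact Finset.sum_congr rfl fun j _ => Finset.sum_comm
        _ = _ := by
            rw [Finset.sum_comm]
            exact Finset.sum_congr rfl fun j _ => Finset.sum_comm
    have s2 : ∑ k, ∑ l, ∑ j : Fin n, x k * (regr j.succ k * regr j.succ l) * x l =
        ∑ j : Fin n, y j.succ * y j.succ := by
      simp_rw [← hb]
      calc _ = ∑ k, ∑ j : Fin n, ∑ l, x k * (regr j.succ k * regr j.succ l) * x l :=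
            Finset.sum_congr rfl fun k _ => Finset.sum_comm
        _ = _ := Finset.sum_comm
    simp_rw [e1]
    rw [s0, s1, s2, hb, ← Finset.sum_mul_sum]
  rw [e2]
  set Q := ∑ j : Fin n, y j.succ * y j.succ with hQ
  have hQ0 : 0 ≤ Q := Finset.sum_nonneg fun j _ => mul_self_nonneg _
  have h1 := sum_sq_le_of_regr x
  have hQ' : ∑ j : Fin n, (∑ k, x k * regr j.succ k) ^ 2 = Q :=
    Finset.sum_congr rfl fun j _ => sq _
  rw [hQ', ← hK] at h1
  change _ ≤ 2 * Q + 2 * K * y 0 ^ 2 at h1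
  -- As c ≥ 2, c - 1 is at least c/2, and cV ≥ 1.
  have h2 : 1 / 2 ≤ (c - 1) * V := by nlinarith
  have hcV' : (c - 1) / K ^ 2 * V = ((c - 1) * V) * (1 / K ^ 2) := by ring
  have h3 : 1 / (2 * K ^ 2) * (y 0 * y 0) + 1 / K * Q ≤
      (c - 1) / K ^ 2 * (V * (y 0 * y 0) + (∑ j : Fin n, y j.succ) * ∑ j : Fin n, y j.succ)
        + 1 / K * (V * (y 0 * y 0) + Q) := by
    have a1 : 1 / (2 * K ^ 2) * (y 0 * y 0) ≤ (c - 1) / K ^ 2 * (V * (y 0 * y 0)) := by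
      rw [← mul_assoc ((c - 1) / K ^ 2), hcV']
      refine mul_le_mul_of_nonneg_right ?_ (mul_self_nonneg _)
      calc 1 / (2 * K ^ 2) = 1 / 2 * (1 / K ^ 2) := by ring_nf
        _ ≤ _ := mul_le_mul_of_nonneg_right h2 (by positivity)
    have a2 : 0 ≤ (c - 1) / K ^ 2 * ((∑ j : Fin n, y j.succ) * ∑ j : Fin n, y j.succ) :=
      mul_nonneg (div_nonneg (by linarith) (by positivity)) (mul_self_nonneg _)
    have a3 : 0 ≤ 1 / K * (V * (y 0 * y 0)) :=
      mul_nonneg (by positivity) (mul_nonneg hV.le (mul_self_nonneg _))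
    rw [mul_add, mul_add]
    linarith
  have h4 : 1 / (4 * K ^ 3) * (2 * Q + 2 * K * y 0 ^ 2) ≤
      1 / (2 * K ^ 2) * (y 0 * y 0) + 1 / K * Q := by
    have b1 : 1 / (4 * K ^ 3) * (2 * K * y 0 ^ 2) = 1 / (2 * K ^ 2) * (y 0 * y 0) := by
      field_simp; ring
    have b2 : 1 / (4 * K ^ 3) * 2 ≤ 1 / K := by
      rw [div_mul_eq_mul_div, div_le_div_iff₀ (by positivity) (by positivity)]
      nlinarith [one_le_pow₀ hK1 (n := 2), mul_nonneg (by linarith : 0 ≤ K) (sq_nonneg K)]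
    nlinarith [mul_le_mul_of_nonneg_right b2 hQ0]
  have h5 : 0 ≤ (c - 1) / K ^ 2 * (V * (y 0 * y 0) + (∑ j : Fin n, y j.succ) *
      ∑ j : Fin n, y j.succ) + 1 / K * (V * (y 0 * y 0) + Q) :=
    le_trans (add_nonneg (mul_nonneg (by positivity) (mul_self_nonneg _))
      (mul_nonneg (by positivity) hQ0)) h3
  calc _ ≤ 1 / (4 * K ^ 3) * (2 * Q + 2 * K * y 0 ^ 2) :=
        mul_le_mul_of_nonneg_left h1 (by positivity)
    _ ≤ _ := h4
    _ ≤ _ := h3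
    _ ≤ _ := le_mul_of_one_le_left h5 hM'

end Quadratic

/-! ### Moment, design and variance conditions. -/

section

variable {H : Submodule ℤ Plane} {M n : ℕ} {r τ : ℝ}

/-- An upper bound for the errors of all cell types. -/
noncomputable def envelope (r : ℝ) (N T : ℕ) (z : I) : ℝ :=
  1 + |rare (rareProb N T) (rareHeight r N T) z|

lemma one_le_envelope (r : ℝ) (N T : ℕ) (z : I) : 1 ≤ envelope r N T z := by
  unfold envelope; linarith [abs_nonneg (rare (rareProb N T) (rareHeight r N T) z)]

@[fun_prop]
lemma measurable_envelope (r : ℝ) (N T : ℕ) : Measurable (envelope r N T) := by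
  unfold envelope
  exact measurable_const.add (measurable_rare _ _).abs

lemma abs_err_le_envelope (hτ : |τ| = 1) (N T : ℕ) (κ : Fin (n + 1)) (z : I) :
    |err τ r N T κ z| ≤ envelope r N T z := by
  unfold err envelope
  split_ifs
  · rw [abs_mul, hτ]; linarith
  · rw [abs_halfSign]; linarith [abs_nonneg (rare (rareProb N T) (rareHeight r N T) z)]

lemma measurePreserving_pick (N T : ℕ) : MeasurePreserving (pick N T) volume volume := by
  by_cases h : N ≤ T
  · have : pick N T = Prod.fst := by funext p; simp [pick, h]
    rw [this]
    exact measurePreserving_fst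
  · have : pick N T = Prod.fst ∘ Prod.snd := by funext p; simp [pick, h]
    rw [this]
    exact measurePreserving_fst.comp measurePreserving_snd

/-- Uses (1 + a)^r ≤ 2^r(1 + a^r); the 3 is 1 plus the moment bound 2 of the rare variable. The
effect selected by `pick` is uniform. -/
lemma lintegral_envelope (hr : 0 < r) (N T : ℕ) :
    ∫⁻ p, ENNReal.ofReal (envelope r N T (pick N T p) ^ r) ≤ ENNReal.ofReal (2 ^ r) * 3 := by
  have hm : Measurable fun z => ENNReal.ofReal (envelope r N T z ^ r) :=
    ((measurable_envelope r N T).pow_const r).ennreal_ofReal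
  rw [(measurePreserving_pick N T).lintegral_comp hm]
  have h1 : ∀ z, ENNReal.ofReal (envelope r N T z ^ r) ≤ ENNReal.ofReal (2 ^ r) *
      (1 + ENNReal.ofReal (|rare (rareProb N T) (rareHeight r N T) z| ^ r)) := by
    intro z
    set a := |rare (rareProb N T) (rareHeight r N T) z| with ha
    have ha0 : 0 ≤ a := abs_nonneg _
    rw [← ENNReal.ofReal_one, ← ENNReal.ofReal_add zero_le_one (by positivity),
      ← ENNReal.ofReal_mul (by positivity)]
    apply ENNReal.ofReal_le_ofReal
    have h2 : envelope r N T z ≤ 2 * max 1 a := by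
      unfold envelope
      linarith [le_max_left 1 a, le_max_right 1 a]
    refine (Real.rpow_le_rpow (by linarith [one_le_envelope r N T z]) h2 hr.le).trans ?_
    rw [Real.mul_rpow (by norm_num) (by positivity)]
    refine mul_le_mul_of_nonneg_left ?_ (by positivity)
    have h3 : 0 ≤ a ^ r := by positivity
    rcases max_cases 1 a with ⟨h, -⟩ | ⟨h, -⟩ <;> rw [h]
    · rw [Real.one_rpow]; linarith
    · linarith
  refine (lintegral_mono h1).trans ?_
  rw [lintegral_const_mul' _ _ ENNReal.ofReal_ne_top]
  refine mul_le_mul_right ?_ _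
  rw [lintegral_add_left measurable_const]
  have := lintegral_rare_rpow hr (rareProb_pos N T).le (one_le_rareHeight hr N T)
    (two_mul_rareProb_le N T) (rareHeight_rpow_mul hr N T).le
  simp only [lintegral_const, measure_univ, mul_one]
  calc 1 + ∫⁻ z, ENNReal.ofReal (|rare (rareProb N T) (rareHeight r N T) z| ^ r) ≤ 1 + 2 := by
        gcongr
    _ = 3 := by norm_num

lemma lintegral_le_of_abs_le_envelope (hr : 0 < r) (N T : ℕ) {B : ℝ} (hB : 0 ≤ B)
    {g : I × I × I → ℝ} (hg0 : ∀ p, 0 ≤ g p) (hg : ∀ p, g p ≤ B * envelope r N T (pick N T p)) :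
    ∫⁻ p, ENNReal.ofReal (g p ^ r) ≤
      (((B ^ r).toNNReal * ((2 ^ r : ℝ).toNNReal * 3) : ℝ≥0) : ℝ≥0∞) := by
  have h1 : ∀ p, ENNReal.ofReal (g p ^ r) ≤
      ENNReal.ofReal (B ^ r) * ENNReal.ofReal (envelope r N T (pick N T p) ^ r) := by
    intro p
    have := one_le_envelope r N T (pick N T p)
    rw [← ENNReal.ofReal_mul (by positivity), ← Real.mul_rpow hB (by linarith)]
    exact ENNReal.ofReal_le_ofReal (Real.rpow_le_rpow (hg0 p) (hg p) hr.le)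
  refine (lintegral_mono h1).trans ?_
  rw [lintegral_const_mul' _ _ ENNReal.ofReal_ne_top]
  refine (mul_le_mul_right (lintegral_envelope hr N T) _).trans (le_of_eq ?_)
  push_cast
  rfl

lemma abs_scoreWeight_le_envelope (hτ : |τ| = 1) (N T : ℕ) (k κ : Fin (n + 1)) (z : I) :
    |scoreWeight M τ r N T k κ z| ≤ M * envelope r N T z := by
  unfold scoreWeight
  rw [abs_mul, abs_mul, Nat.abs_cast]
  have h1 := abs_err_le_envelope (r := r) hτ N T κ z
  have h3 : (M : ℝ) * |regr κ k| ≤ M :=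
    mul_le_of_le_one_right (Nat.cast_nonneg M) (abs_regr_le κ k)
  exact mul_le_mul h3 h1 (abs_nonneg _) (Nat.cast_nonneg M)

lemma abs_scoreDev_le_envelope (hτ : |τ| = 1) (N T : ℕ) (k : Fin (n + 1)) (z z' : I) :
    |scoreDev M τ r N T k z z'| ≤ (n + 1) * M * envelope r N T z := by
  have : (n + 1) * M * envelope r N T z = ∑ _κ : Fin (n + 1), M * envelope r N T z := by
    simp; ring
  rw [this]
  refine (Finset.abs_sum_le_sum_abs _ _).trans (Finset.sum_le_sum fun κ _ => ?_)
  rw [abs_mul]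
  exact (mul_le_of_le_one_right (abs_nonneg _) (abs_typeDev_le n κ z')).trans
    (abs_scoreWeight_le_envelope hτ N T k κ z)

lemma abs_scoreMean_le_envelope (hτ : |τ| = 1) (N T : ℕ) (k : Fin (n + 1)) (z : I) :
    |scoreMean M τ r N T k z| ≤ (n + 1) * M * envelope r N T z := by
  have : (n + 1) * M * envelope r N T z = ∑ _κ : Fin (n + 1), M * envelope r N T z := by
    simp; ring
  rw [this]
  unfold scoreMean
  rw [abs_mul]
  have h1 : |1 / (n + 1 : ℝ)| ≤ 1 := by
    rw [abs_of_nonneg (by positivity), div_le_one (by positivity)]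
    linarith [(Nat.cast_nonneg n : (0 : ℝ) ≤ n)]
  refine (mul_le_of_le_one_left (abs_nonneg _) h1).trans ?_
  exact (Finset.abs_sum_le_sum_abs _ _).trans
    (Finset.sum_le_sum fun κ _ => abs_scoreWeight_le_envelope hτ N T k κ z)

/-- A positive variance is here at least (n + 1)^(-2), so standardization costs no more than a
factor n + 1. -/
lemma stdMoment_of_abs_le (hr : 0 < r) (N T : ℕ) {s : ℝ} {g : I × I × I → ℝ}
    (hs : 0 < s → (1 / (n + 1 : ℝ)) ^ 2 ≤ s)
    (hg : ∀ p, |g p| ≤ (n + 1) * M * envelope r N T (pick N T p)) :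
    DGP.StdMoment r (((((n + 1) * ((n + 1) * M) : ℝ) ^ r).toNNReal *
      ((2 ^ r : ℝ).toNNReal * 3) : ℝ≥0)) s g := by
  intro h
  have h1 : 1 / (n + 1 : ℝ) ≤ √s := Real.le_sqrt_of_sq_le (hs h)
  have h0 : (0 : ℝ) < n + 1 := by positivity
  refine lintegral_le_of_abs_le_envelope hr N T (by positivity) (fun p => abs_nonneg _) fun p => ?_
  rw [abs_div, abs_of_nonneg (Real.sqrt_nonneg s), div_le_iff₀ (Real.sqrt_pos.2 h)]
  refine (hg p).trans ?_
  have he := one_le_envelope r N T (pick N T p)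
  have h2 : 1 ≤ (n + 1) * √s := by
    rw [div_le_iff₀ h0] at h1; linarith
  have h3 : 0 ≤ (n + 1) * M * envelope r N T (pick N T p) := by positivity
  nlinarith [mul_le_mul_of_nonneg_left h2 h3]

/-- The quadratic form is M/(n + 1) times the sum over types of the squared fitted values, which
control the coefficients by `sum_sq_le_of_regr`. -/
lemma gram_sparseDGP (hM : 1 ≤ M) (N T : ℕ) :
    ((Matrix.of fun k l : Fin (n + 1) => ∫ p : I × I × I, ∑ m,
      ((sparseDGP H M n r τ).fn N T p).1 m k * ((sparseDGP H M n r τ).fn N T p).1 m l) -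
      (1 / (2 * (n + 1 : ℝ) ^ 2)) • (1 : Matrix (Fin (n + 1)) (Fin (n + 1)) ℝ)).PosSemidef := by
  have hI : ∀ k l : Fin (n + 1), ∫ p : I × I × I, ∑ m : Fin M,
      ((sparseDGP H M n r τ).fn N T p).1 m k * ((sparseDGP H M n r τ).fn N T p).1 m l =
      M * (1 / (n + 1 : ℝ)) * ∑ κ, regr κ k * regr κ l := by
    intro k l
    have h1 : ∀ p : I × I × I, ∑ m : Fin M,
        ((sparseDGP H M n r τ).fn N T p).1 m k * ((sparseDGP H M n r τ).fn N T p).1 m l =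
        (fun z : I => M * ∑ κ, (regr κ k * regr κ l) * (if cellType n z = κ then 1 else 0)) p.2.2 := by
      intro p
      simp [sparseDGP]
    simp_rw [h1]
    have h2 : MeasurePreserving (fun p : I × I × I => p.2.2) volume volume :=
      measurePreserving_snd.comp measurePreserving_snd
    have h3 : Measurable fun z : I => (M : ℝ) * ∑ κ : Fin (n + 1), (regr κ k * regr κ l) *
        (if cellType n z = κ then 1 else 0) := by fun_prop
    rw [← integral_map (μ := (volume : Measure (I × I × I))) (φ := fun p : I × I × I => p.2.2)
      (f := fun z : I => (M : ℝ) * ∑ κ : Fin (n + 1), (regr κ k * regr κ l) *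
        (if cellType n z = κ then 1 else 0)) (by fun_prop) h3.aestronglyMeasurable, h2.map_eq,
      integral_const_mul, integral_finsetSum _ fun κ _ => (integrable_typeInd n κ).const_mul _]
    simp_rw [integral_const_mul, integral_typeInd]
    rw [← Finset.sum_mul]; ring
  have hM' : (1 : ℝ) ≤ M := by exact_mod_cast hM
  refine posSemidef_sub_smul_one ?_ ?_
  · intro k l
    simp only [Matrix.of_apply]
    rw [hI, hI]
    simp_rw [mul_comm (regr _ k)]
  · intro x
    simp only [Matrix.of_apply, hI]
    have e : ∑ k, ∑ l, x k * (M * (1 / (n + 1 : ℝ)) * ∑ κ, regr κ k * regr κ l) * x l =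
        M * (1 / (n + 1 : ℝ)) * ∑ κ, (∑ k, x k * regr κ k) ^ 2 := by
      have : ∀ κ : Fin (n + 1), (∑ k, x k * regr κ k) ^ 2 =
          ∑ k, ∑ l, x k * (regr κ k * regr κ l) * x l := by
        intro κ
        rw [sq, Finset.sum_mul_sum]
        exact Finset.sum_congr rfl fun k _ => Finset.sum_congr rfl fun l _ => by ring
      have h2 : ∑ κ : Fin (n + 1), ∑ k, ∑ l, x k * (regr κ k * regr κ l) * x l =
          ∑ k, ∑ l, ∑ κ : Fin (n + 1), x k * (regr κ k * regr κ l) * x l := by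
        rw [Finset.sum_comm]
        exact Finset.sum_congr rfl fun k _ => Finset.sum_comm
      rw [Finset.sum_congr rfl fun κ _ => this κ, h2, Finset.mul_sum]
      refine Finset.sum_congr rfl fun k _ => ?_
      rw [Finset.mul_sum]
      refine Finset.sum_congr rfl fun l _ => ?_
      rw [← Finset.sum_mul, ← Finset.mul_sum]
      ring
    rw [e, Fin.sum_univ_succ fun κ : Fin (n + 1) => (∑ k, x k * regr κ k) ^ 2]
    have h1 := sum_sq_le_of_regr x
    set Q := ∑ j : Fin n, (∑ k, x k * regr j.succ k) ^ 2 with hQ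
    set y := (∑ k, x k * regr 0 k) ^ 2 with hy
    have hQ0 : 0 ≤ Q := Finset.sum_nonneg fun j _ => sq_nonneg _
    have hy0 : 0 ≤ y := sq_nonneg _
    have hK : (1 : ℝ) ≤ n + 1 := by linarith [(Nat.cast_nonneg n : (0 : ℝ) ≤ n)]
    clear_value Q y
    calc _ ≤ 1 / (2 * (n + 1 : ℝ) ^ 2) * (2 * Q + 2 * (n + 1) * y) :=
          mul_le_mul_of_nonneg_left h1 (by positivity)
      _ ≤ 1 / (2 * (n + 1 : ℝ) ^ 2) * (2 * (n + 1) * (y + Q)) :=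
          mul_le_mul_of_nonneg_left (by nlinarith) (by positivity)
      _ = 1 / (n + 1 : ℝ) * (y + Q) := by field_simp
      _ ≤ M * (1 / (n + 1 : ℝ)) * (y + Q) := by
          have h0 : 0 ≤ 1 / (n + 1 : ℝ) * (y + Q) :=
            mul_nonneg (by positivity) (add_nonneg hy0 hQ0)
          rw [mul_assoc (M : ℝ)]
          exact le_mul_of_one_le_left h0 hM'

lemma matNorm_sparseDGP_le (N T : ℕ) (p : I × I × I) :
    matNorm ((sparseDGP H M n r τ).fn N T p).1 ≤
      √(M * (n + 1)) * envelope r N T (pick N T p) := by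
  have he := one_le_envelope r N T (pick N T p)
  refine le_trans ?_ (le_mul_of_one_le_right (Real.sqrt_nonneg _) he)
  unfold matNorm
  apply Real.sqrt_le_sqrt
  calc _ ≤ ∑ _j : Fin M, ∑ _l : Fin (n + 1), (1 : ℝ) := by
        refine Finset.sum_le_sum fun j _ => Finset.sum_le_sum fun l _ => ?_
        rw [← sq_abs]
        exact pow_le_one₀ (abs_nonneg _) (abs_regr_le _ _)
    _ = _ := by simp; ring

lemma vecNorm_sparseDGP_le (hτ : |τ| = 1) (N T : ℕ) (p : I × I × I) :
    vecNorm ((sparseDGP H M n r τ).fn N T p).2 ≤ √M * envelope r N T (pick N T p) := by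
  have he := one_le_envelope r N T (pick N T p)
  have : √M * envelope r N T (pick N T p) = √(M * envelope r N T (pick N T p) ^ 2) := by
    rw [Real.sqrt_mul (Nat.cast_nonneg M), Real.sqrt_sq (by linarith)]
  rw [this]
  unfold vecNorm
  apply Real.sqrt_le_sqrt
  calc _ ≤ ∑ _j : Fin M, envelope r N T (pick N T p) ^ 2 := by
        refine Finset.sum_le_sum fun j _ => ?_
        rw [← sq_abs]
        exact pow_le_pow_left₀ (abs_nonneg _) (abs_err_le_envelope hτ N T _ _) 2
    _ = _ := by simp

/-- The rare variance is at least 1/min N T, and max N T is no smaller than min N T. This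
compensates for the collapse of the variance in the rare direction. -/
lemma one_le_mul_rareVar (hr : 0 < r) {N T : ℕ} (hN : 2 ≤ N) (hT : 2 ≤ T) :
    1 ≤ (max N T : ℕ) * rareVar r N T := by
  have h1 : (rateSize N T : ℝ) ≤ (max N T : ℕ) := by
    have : rateSize N T ≤ max N T := by unfold rateSize; omega
    exact_mod_cast this
  have h2 := two_le_rateSize N T
  have h3 : 1 / (rateSize N T : ℝ) ≤ rareVar r N T := by
    have a1 := rareProb_pos N T
    have a2 := one_le_rareHeight hr N T
    unfold rareVar
    have : 0 ≤ rareProb N T * rareHeight r N T := by positivity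
    change rareProb N T ≤ _
    linarith
  calc (1 : ℝ) = rateSize N T * (1 / (rateSize N T : ℝ)) := by
        rw [mul_one_div_cancel (by linarith)]
    _ ≤ _ := mul_le_mul h1 h3 (by positivity) (Nat.cast_nonneg _)

lemma variance_sparseDGP (hM : 1 ≤ M) (hτ : |τ| = 1) (hr : 0 < r) {loc : Design H}
    (hloc : ∀ N, Function.Injective (loc N)) {N T : ℕ} (hN : 2 ≤ N) (hT : 2 ≤ T) :
    (((T : ℝ) • (sparseDGP H M n r τ).varA loc N T + (N : ℝ) • (sparseDGP H M n r τ).varD N T +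
      (sparseDGP H M n r τ).varV loc N T + (sparseDGP H M n r τ).varE loc N T) -
      (1 / (4 * (n + 1 : ℝ) ^ 3)) • (1 : Matrix (Fin (n + 1)) (Fin (n + 1)) ℝ)).PosSemidef := by
  have e : ∀ k l, ((T : ℝ) • (sparseDGP H M n r τ).varA loc N T +
      (N : ℝ) • (sparseDGP H M n r τ).varD N T +
      (sparseDGP H M n r τ).varV loc N T + (sparseDGP H M n r τ).varE loc N T) k l =
      ((max N T : ℕ) : ℝ) * meanCov M r N T k l + devCov M r N T k l := by
    intro k l
    simp only [Matrix.add_apply, Matrix.smul_apply, smul_eq_mul, varA_sparseDGP hτ hr hloc,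
      varD_sparseDGP hτ hr, varV_sparseDGP hτ hr, varE_sparseDGP hτ hr]
    have h1 : 0 < N := by omega
    have h2 : 0 < T := by omega
    by_cases h : N ≤ T
    · simp [h, h1, h2, not_lt.2 h]
    · simp [h, h1, h2, not_le.1 h, (not_le.1 h).le]
  refine posSemidef_sub_smul_one ?_ ?_
  · intro k l
    rw [e, e, meanCov_symm, devCov_symm]
  · intro x
    simp_rw [e]
    refine quadratic_form_ge hM hr N T ?_ (one_le_mul_rareVar hr hN hT) x
    exact_mod_cast le_max_of_le_left hN

lemma momentsVariances_sparseDGP (hM : 1 ≤ M) (hn : 1 ≤ n) (hτ : |τ| = 1) {ζ δ : ℝ}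
    (hr : 0 < 8 * (ζ + δ)) {loc : Design H} (hloc : ∀ N, Function.Injective (loc N)) :
    (sparseDGP H M n (8 * (ζ + δ)) τ).MomentsVariances loc ζ δ where
  mean_zero := meanS_sparseDGP hτ hr
  gram_pos := ⟨1 / (2 * (n + 1 : ℝ) ^ 2), by positivity, fun N T => gram_sparseDGP hM N T⟩
  moment_X := ⟨_, fun N T => lintegral_le_of_abs_le_envelope hr N T (Real.sqrt_nonneg _)
    (fun p => Real.sqrt_nonneg _) (matNorm_sparseDGP_le N T)⟩
  moment_u := ⟨_, fun N T => lintegral_le_of_abs_le_envelope hr N T (Real.sqrt_nonneg _)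
    (fun p => Real.sqrt_nonneg _) (vecNorm_sparseDGP_le hτ N T)⟩
  moment_std := by
    refine ⟨_, fun N T k => ⟨stdMoment_of_abs_le (n := n) (M := M) hr N T ?_ ?_,
      stdMoment_of_abs_le (n := n) (M := M) hr N T ?_ ?_,
      stdMoment_of_abs_le (n := n) (M := M) hr N T ?_ ?_,
      stdMoment_of_abs_le (n := n) (M := M) hr N T ?_ ?_⟩⟩
    · rw [varA_sparseDGP hτ hr hloc]
      split_ifs
      · exact fun _ => meanCov_diag_ge hM hn hr N T k
      · exact fun h => absurd h (lt_irrefl 0)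
    · intro p
      rw [compA_sparseDGP hτ hr]
      have h1 := abs_scoreMean_le_envelope (M := M) (r := 8 * (ζ + δ)) hτ N T k (pick N T p)
      split_ifs
      · exact h1
      · rw [abs_zero]; exact (abs_nonneg _).trans h1
    · rw [varD_sparseDGP hτ hr]
      split_ifs
      · exact fun _ => meanCov_diag_ge hM hn hr N T k
      · exact fun h => absurd h (lt_irrefl 0)
    · intro p
      rw [compD_sparseDGP hτ hr]
      have h1 := abs_scoreMean_le_envelope (M := M) (r := 8 * (ζ + δ)) hτ N T k (pick N T p)
      split_ifs
      · rw [abs_zero]; exact (abs_nonneg _).trans h1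
      · exact h1
    · rw [varE_sparseDGP hτ hr]
      split_ifs
      · exact fun _ => devCov_diag_ge hM hn hr N T k
      · exact fun h => absurd h (lt_irrefl 0)
    · intro p
      rw [compE_sparseDGP]
      exact abs_scoreDev_le_envelope hτ N T k _ _
    · rw [varV_sparseDGP hτ hr]
      exact fun h => absurd h (lt_irrefl 0)
    · intro p
      rw [compV_sparseDGP hτ hr, abs_zero]
      exact (abs_nonneg _).trans
        (abs_scoreMean_le_envelope (M := M) (r := 8 * (ζ + δ)) hτ N T k (pick N T p))
  variance_pos := by
    refine ⟨1 / (4 * (n + 1 : ℝ) ^ 3), by positivity, ?_⟩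
    have h := (eventually_ge_atTop 2).prod_mk (eventually_ge_atTop 2)
    filter_upwards [h] with m hm
    exact variance_sparseDGP hM hτ hr hloc hm.1 hm.2

end

/-! ### Least squares with an intercept and type dummies. -/

section LeastSquares

variable {N T M n : ℕ}

/-- The inverse is discontinuous at singular matrices, but it is the adjugate, continuous in the
data, times the measurable inverse of the determinant. -/
lemma measurable_ols {K : ℕ} (k : Fin K) : Measurable fun x : Data N T M K => ols x k := by
  have hB : BorelSpace ((Fin M → ℝ) × (Fin M → Fin K → ℝ)) := Prod.borelSpace
  have hB' : BorelSpace (Fin T → (Fin M → ℝ) × (Fin M → Fin K → ℝ)) := Pi.borelSpace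
  have hB'' : BorelSpace (Data N T M K) := Pi.borelSpace
  have hG : Continuous fun x : Data N T M K =>
      ∑ i, ∑ t, (Matrix.of (x i t).2).transpose * Matrix.of (x i t).2 := by
    refine continuous_finsetSum _ fun i _ => continuous_finsetSum _ fun t _ => ?_
    have : Continuous fun x : Data N T M K => Matrix.of (x i t).2 := by
      change Continuous fun x : Data N T M K => (x i t).2
      fun_prop
    exact this.matrix_transpose.matrix_mul this
  have hb : Continuous fun x : Data N T M K =>
      ∑ i, ∑ t, (Matrix.of (x i t).2).transpose.mulVec (x i t).1 := by
    refine continuous_finsetSum _ fun i _ => continuous_finsetSum _ fun t _ => ?_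
    have : Continuous fun x : Data N T M K => Matrix.of (x i t).2 := by
      change Continuous fun x : Data N T M K => (x i t).2
      fun_prop
    exact this.matrix_transpose.matrix_mulVec (by fun_prop)
  unfold ols
  simp only [Matrix.inv_def, Matrix.smul_mulVec, Pi.smul_apply, smul_eq_mul, Ring.inverse_eq_inv']
  exact (hG.matrix_det.measurable.inv).mul
    ((continuous_apply k).comp (hG.matrix_adjugate.matrix_mulVec hb)).measurable

/-- The number of cells of type `c`. -/
def typeCount (κ : Fin N → Fin T → Fin (n + 1)) (c : Fin (n + 1)) : ℝ :=
  ∑ i, ∑ t, if κ i t = c then 1 else 0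

/-- The sum of the errors of the cells of type `c`. -/
def typeSum (κ : Fin N → Fin T → Fin (n + 1)) (e : Fin N → Fin T → ℝ) (c : Fin (n + 1)) : ℝ :=
  ∑ i, ∑ t, if κ i t = c then e i t else 0

/-- With regressors that are dummies for the cell types, least squares amounts to averaging the
errors over the cells of each type. -/
lemma ols_of_types (hM : 1 ≤ M) (κ : Fin N → Fin T → Fin (n + 1)) (e : Fin N → Fin T → ℝ)
    (β : Fin (n + 1) → ℝ) (x : Data N T M (n + 1))
    (hx1 : ∀ i t m, (x i t).1 m = ∑ l, regr (κ i t) l * β l + e i t)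
    (hx2 : ∀ i t m k, (x i t).2 m k = regr (κ i t) k) (hpos : ∀ c, 0 < typeCount κ c) :
    ols x 0 = β 0 + typeSum κ e 0 / typeCount κ 0 ∧
    ∀ j : Fin n, ols x j.succ = β j.succ + (typeSum κ e j.succ / typeCount κ j.succ -
      typeSum κ e 0 / typeCount κ 0) := by
  set G := ∑ i, ∑ t, (Matrix.of (x i t).2).transpose * Matrix.of (x i t).2 with hGdef
  set b := ∑ i, ∑ t, (Matrix.of (x i t).2).transpose.mulVec (x i t).1 with hbdef
  set mean : Fin (n + 1) → ℝ := fun c => typeSum κ e c / typeCount κ c with hmean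
  have hM' : (0 : ℝ) < M := by exact_mod_cast hM
  have hGe : ∀ k l, G k l = M * ∑ i, ∑ t, regr (κ i t) k * regr (κ i t) l := by
    intro k l
    simp [hGdef, Matrix.sum_apply, Matrix.mul_apply, hx2, Finset.mul_sum]
  have hG : ∀ v k, G.mulVec v k =
      M * ∑ i, ∑ t, regr (κ i t) k * ∑ l, regr (κ i t) l * v l := by
    intro v k
    simp only [Matrix.mulVec, dotProduct, hGe]
    simp_rw [mul_assoc, ← Finset.mul_sum, Finset.sum_mul]
    congr 1
    rw [Finset.sum_comm]
    refine Finset.sum_congr rfl fun i _ => ?_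
    rw [Finset.sum_comm]
    refine Finset.sum_congr rfl fun t _ => ?_
    rw [Finset.mul_sum]
    exact Finset.sum_congr rfl fun l _ => by ring
  have hb : ∀ k, b k = M * ∑ i, ∑ t, regr (κ i t) k * (∑ l, regr (κ i t) l * β l + e i t) := by
    intro k
    simp [hbdef, Finset.sum_apply, Matrix.mulVec, dotProduct, hx2, hx1, Finset.mul_sum]
  -- The candidate solution fits the average error of every type exactly.
  set v : Fin (n + 1) → ℝ := fun k => β k + Fin.cases (mean 0) (fun j => mean j.succ - mean 0) k
    with hv
  have hvr : ∀ c, ∑ l, regr c l * v l = ∑ l, regr c l * β l + mean c := by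
    intro c
    simp_rw [mul_comm (regr c _)]
    refine Fin.cases ?_ (fun j => ?_) c
    · rw [sum_mul_regr_zero, sum_mul_regr_zero]
      simp [hv]
    · rw [sum_mul_regr_succ, sum_mul_regr_succ]
      simp [hv]
      ring
  -- Normal equations: grouped by type, the residuals sum to zero.
  have hGv : G.mulVec v = b := by
    funext k
    rw [hG, hb, ← sub_eq_zero, ← mul_sub, ← Finset.sum_sub_distrib]
    have h1 : ∀ i t, regr (κ i t) k * ∑ l, regr (κ i t) l * v l -
        regr (κ i t) k * (∑ l, regr (κ i t) l * β l + e i t) =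
        ∑ c, (regr c k * mean c * (if κ i t = c then 1 else 0) -
          regr c k * (if κ i t = c then e i t else 0)) := by
      intro i t
      rw [hvr]
      simp only [mul_ite, mul_one, mul_zero, Finset.sum_sub_distrib, Finset.sum_ite_eq,
        Finset.mem_univ, if_true]
      ring
    simp_rw [← Finset.sum_sub_distrib, h1]
    have h2 : ∑ i, ∑ t, ∑ c, (regr c k * mean c * (if κ i t = c then 1 else 0) -
          regr c k * (if κ i t = c then e i t else 0)) =
        ∑ c, regr c k * (mean c * typeCount κ c - typeSum κ e c) := by
      calc _ = ∑ i, ∑ c, ∑ t, (regr c k * mean c * (if κ i t = c then 1 else 0) -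
          regr c k * (if κ i t = c then e i t else 0)) :=
            Finset.sum_congr rfl fun i _ => Finset.sum_comm
        _ = _ := by
          rw [Finset.sum_comm]
          refine Finset.sum_congr rfl fun c _ => ?_
          unfold typeCount typeSum
          simp_rw [Finset.sum_sub_distrib, ← Finset.mul_sum]
          ring
    rw [h2, Finset.sum_eq_zero, mul_zero]
    intro c _
    have := (hpos c).ne'
    rw [hmean]
    field_simp
    ring
  -- A vector in the kernel has zero fitted value in every cell, hence for every type since each
  -- type occurs; the type 0 value gives the intercept, the others the dummies.
  have hinj : Function.Injective G.mulVec := by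
    rw [← Matrix.coe_mulVecLin, injective_iff_map_eq_zero]
    intro w hw
    have h0 : ∑ k, w k * G.mulVec w k = 0 := by
      have : G.mulVec w = 0 := hw
      simp [this]
    simp_rw [hG] at h0
    have h1 : ∑ k, w k * (M * ∑ i, ∑ t, regr (κ i t) k * ∑ l, regr (κ i t) l * w l) =
        M * ∑ i, ∑ t, (∑ l, regr (κ i t) l * w l) ^ 2 := by
      rw [Finset.sum_congr rfl fun k _ => mul_left_comm (w k) _ _, ← Finset.mul_sum]
      congr 1
      rw [Finset.sum_congr rfl fun k _ => Finset.mul_sum _ _ _, Finset.sum_comm]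
      refine Finset.sum_congr rfl fun i _ => ?_
      rw [Finset.sum_congr rfl fun k _ => Finset.mul_sum _ _ _, Finset.sum_comm]
      refine Finset.sum_congr rfl fun t _ => ?_
      rw [sq, Finset.sum_mul]
      exact Finset.sum_congr rfl fun l _ => by ring
    rw [h1] at h0
    have h2 := (mul_eq_zero.1 h0).resolve_left hM'.ne'
    have h3 : ∀ i t, ∑ l, regr (κ i t) l * w l = 0 := by
      intro i t
      have a1 := (Finset.sum_eq_zero_iff_of_nonneg fun i _ =>
        Finset.sum_nonneg fun t _ => sq_nonneg _).1 h2 i (Finset.mem_univ i)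
      have a2 := (Finset.sum_eq_zero_iff_of_nonneg fun t _ => sq_nonneg _).1 a1 t
        (Finset.mem_univ t)
      exact pow_eq_zero_iff two_ne_zero |>.1 a2
    have h4 : ∀ c, ∑ l, w l * regr c l = 0 := by
      intro c
      have hc := hpos c
      by_contra hne
      refine hc.ne' ?_
      unfold typeCount
      refine Finset.sum_eq_zero fun i _ => Finset.sum_eq_zero fun t _ => ?_
      rw [if_neg]
      rintro rfl
      simp_rw [mul_comm (w _)] at hne
      exact hne (h3 i t)
    have h5 := h4 0
    rw [sum_mul_regr_zero] at h5
    funext k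
    refine Fin.cases h5 (fun j => ?_) k
    have h6 := h4 j.succ
    rw [sum_mul_regr_succ, h5, zero_add] at h6
    exact h6
  have hU : IsUnit G := Matrix.mulVec_injective_iff_isUnit.1 hinj
  have hols : ols x = v := by
    change G⁻¹.mulVec b = v
    rw [← hGv, Matrix.mulVec_mulVec, Matrix.nonsing_inv_mul _ ((Matrix.isUnit_iff_isUnit_det _).1 hU),
      Matrix.one_mulVec]
  rw [hols]
  exact ⟨rfl, fun j => rfl⟩

end LeastSquares

/-! ### Sums over draws of the coarser effect and over cells. -/

section Sums

variable {H : Submodule ℤ Plane} {n : ℕ} {loc : Design H}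

/-- The sum of a function of the draws of the coarser effect. -/
noncomputable def driveSum (loc : Design H) (N T : ℕ) (w : I → ℝ) (ω : Latent H) : ℝ :=
  if N ≤ T then ∑ i : Fin N, w (ω.1 (loc N i)) else ∑ t : Fin T, w (ω.2.1 t)

lemma measurable_driveSum (loc : Design H) (N T : ℕ) {w : I → ℝ} (hw : Measurable w) :
    Measurable (driveSum loc N T w) := by
  unfold driveSum
  split_ifs <;> fun_prop

/-- Whether the sum runs over units or over periods, it has min N T i.i.d. summands; this reduces
both cases to one sequence. -/
lemma map_driveSum (hloc : ∀ N, Function.Injective (loc N)) (N T : ℕ) {w : I → ℝ}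
    (hw : Measurable w) :
    (uniformLatent H).map (driveSum loc N T w) =
      (unif ℕ).map fun x => ∑ i ∈ Finset.range (min N T), w (x i) := by
  by_cases h : N ≤ T
  · classical
    have h1 : driveSum loc N T w =
        (fun x : H → I => ∑ g ∈ Finset.univ.image (loc N), w (x g)) ∘ Prod.fst := by
      funext ω
      simp only [driveSum, h, if_true, Function.comp]
      rw [Finset.sum_image fun i _ j _ hij => hloc N hij]
    have h2 : Measurable fun x : H → I => ∑ g ∈ Finset.univ.image (loc N), w (x g) := by
      fun_prop
    rw [h1, ← Measure.map_map h2 measurable_fst]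
    rw [show (uniformLatent H).map Prod.fst = unif H from Measure.fst_prod]
    refine map_sum_unif_eq _ _ ?_ hw
    rw [Finset.card_image_of_injective _ (hloc N)]
    simp [h]
  · have h1 : driveSum loc N T w =
        (fun x : ℕ → I => ∑ i ∈ Finset.range T, w (x i)) ∘ (fun ω : Latent H => ω.2.1) := by
      funext ω
      simp only [driveSum, h, if_false, Function.comp]
      rw [Finset.sum_range]
    have h2 : Measurable fun x : ℕ → I => ∑ i ∈ Finset.range T, w (x i) := by fun_prop
    rw [h1, ← Measure.map_map h2 (by fun_prop)]
    have h3 : MeasurePreserving (fun ω : Latent H => ω.2.1) (uniformLatent H) (unif ℕ) :=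
      measurePreserving_fst.comp measurePreserving_snd
    rw [h3.map_eq, min_eq_right (not_le.1 h).le]

lemma sum_drive (loc : Design H) (N T : ℕ) (w : I → ℝ) (ω : Latent H) :
    ∑ i : Fin N, ∑ t : Fin T, w (drive loc N T i t ω) =
      (max N T : ℕ) * driveSum loc N T w ω := by
  by_cases h : N ≤ T
  · simp [drive, pick, driveSum, h, DGP.cell, Finset.mul_sum]
  · simp [drive, pick, driveSum, h, DGP.cell, (not_le.1 h).le]

lemma drive_notMem_of_driveSum_eq_zero {N T : ℕ} {S : Set I} {ω : Latent H}
    (h : driveSum loc N T (S.indicator fun _ => 1) ω = 0) (i : Fin N) (t : Fin T) :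
    drive loc N T i t ω ∉ S := by
  intro hmem
  have h0 : ∀ z : I, 0 ≤ S.indicator (fun _ => (1 : ℝ)) z := fun z =>
    Set.indicator_nonneg (fun _ _ => zero_le_one) z
  by_cases hNT : N ≤ T
  · simp only [drive, pick, hNT, if_true, DGP.cell] at hmem
    simp only [driveSum, hNT, if_true] at h
    have := (Finset.sum_eq_zero_iff_of_nonneg fun i _ => h0 _).1 h i (Finset.mem_univ i)
    rw [Set.indicator_of_mem hmem] at this
    exact one_ne_zero this
  · simp only [drive, pick, hNT, if_false, DGP.cell] at hmem
    simp only [driveSum, hNT, if_false] at h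
    have := (Finset.sum_eq_zero_iff_of_nonneg fun t _ => h0 _).1 h t (Finset.mem_univ t)
    rw [Set.indicator_of_mem hmem] at this
    exact one_ne_zero this

lemma measure_driveSum_eq_zero (hloc : ∀ N, Function.Injective (loc N)) (N T : ℕ) {S : Set I}
    (hS : MeasurableSet S) :
    uniformLatent H {ω | driveSum loc N T (S.indicator fun _ => 1) ω = 0} =
      volume Sᶜ ^ min N T := by
  have hw : Measurable (S.indicator fun _ => (1 : ℝ)) := measurable_const.indicator hS
  have h1 : {ω | driveSum loc N T (S.indicator fun _ => 1) ω = 0} =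
      driveSum loc N T (S.indicator fun _ => 1) ⁻¹' {0} := rfl
  have hm : Measurable fun x : ℕ → I =>
      ∑ i ∈ Finset.range (min N T), S.indicator (fun _ => (1 : ℝ)) (x i) := by fun_prop
  rw [h1, ← Measure.map_apply (measurable_driveSum loc N T hw) (measurableSet_singleton 0),
    map_driveSum hloc N T hw, Measure.map_apply hm (measurableSet_singleton 0),
    ← measure_forall_notMem_unif hS]
  congr 1
  ext x
  simp only [Set.mem_preimage, Set.mem_singleton_iff, Set.mem_ofPred_eq]
  rw [Finset.sum_eq_zero_iff_of_nonneg fun i _ =>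
    Set.indicator_nonneg (fun _ _ => zero_le_one) (x i)]
  simp [Set.indicator_apply_eq_zero]

lemma integral_driveSum_sq (hloc : ∀ N, Function.Injective (loc N)) (N T : ℕ) {w : I → ℝ}
    (hw : Measurable w) {C : ℝ} (hC : ∀ z, |w z| ≤ C) (h0 : ∫ z, w z = 0) :
    ∫ ω, driveSum loc N T w ω ^ 2 ∂(uniformLatent H) = (min N T : ℕ) * ∫ z, w z * w z := by
  have hm : Measurable fun x : ℕ → I => ∑ i ∈ Finset.range (min N T), w (x i) := by fun_prop
  have h1 : ∫ ω, driveSum loc N T w ω ^ 2 ∂(uniformLatent H) =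
      ∫ y, y ^ 2 ∂((uniformLatent H).map (driveSum loc N T w)) :=
    (integral_map (f := fun y : ℝ => y ^ 2) (measurable_driveSum loc N T hw).aemeasurable
      (by fun_prop)).symm
  rw [h1, map_driveSum hloc N T hw,
    integral_map (f := fun y : ℝ => y ^ 2) hm.aemeasurable (by fun_prop)]
  have hi : ∀ i j : ℕ, Integrable (fun x : ℕ → I => w (x i) * w (x j)) (unif ℕ) := fun i j => by
    refine integrable_of_abs_le (by fun_prop) (C := C * C) fun x => ?_
    rw [abs_mul]
    exact mul_le_mul (hC _) (hC _) (abs_nonneg _) ((abs_nonneg _).trans (hC 0))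
  simp_rw [sq, Finset.sum_mul_sum]
  rw [integral_finsetSum _ fun i _ => integrable_finsetSum _ fun j _ => hi i j]
  simp_rw [integral_finsetSum _ fun j _ => hi _ j, integral_eval_mul_eval_unif _ _ hw hw, h0]
  rw [Finset.sum_congr rfl fun i hi => by rw [mul_zero, Finset.sum_ite_eq, if_pos hi]]
  simp

lemma integrable_driveSum_sq (N T : ℕ) {w : I → ℝ} (hw : Measurable w) {C : ℝ}
    (hC : ∀ z, |w z| ≤ C) :
    Integrable (fun ω => driveSum loc N T w ω ^ 2) (uniformLatent H) := by
  have h1 : ∀ ω, |driveSum loc N T w ω| ≤ max (N * C) (T * C) := by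
    intro ω
    unfold driveSum
    split_ifs
    · refine ((Finset.abs_sum_le_sum_abs _ _).trans
        (Finset.sum_le_sum fun i _ => hC _)).trans ?_
      simp
    · refine ((Finset.abs_sum_le_sum_abs _ _).trans
        (Finset.sum_le_sum fun i _ => hC _)).trans ?_
      simp
  have hm := measurable_driveSum loc N T hw
  refine integrable_of_abs_le (by fun_prop) (C := max (N * C) (T * C) ^ 2) fun ω => ?_
  rw [abs_pow]
  exact pow_le_pow_left₀ (abs_nonneg _) (h1 ω) 2

/-- Sums over all cells of a function of the coarser effect times the centred indicator of a type. -/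
noncomputable def devSum (loc : Design H) (N T : ℕ) (w : I → ℝ) (κ : Fin (n + 1)) (ω : Latent H) :
    ℝ :=
  ∑ i : Fin N, ∑ t : Fin T, w (drive loc N T i t ω) * typeDev n κ (ω.2.2 (i, t))

lemma measurable_devSum (loc : Design H) (N T : ℕ) {w : I → ℝ} (hw : Measurable w)
    (κ : Fin (n + 1)) : Measurable (devSum loc N T w κ) := by
  unfold devSum
  fun_prop

lemma integrable_devSum_sq (N T : ℕ) {w : I → ℝ} (hw : Measurable w) {C : ℝ}
    (hC : ∀ z, |w z| ≤ C) (κ : Fin (n + 1)) :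
    Integrable (fun ω => devSum loc N T w κ ω ^ 2) (uniformLatent H) := by
  have h1 : ∀ ω, |devSum loc N T w κ ω| ≤ ∑ _i : Fin N, ∑ _t : Fin T, C * 1 := by
    intro ω
    refine (Finset.abs_sum_le_sum_abs _ _).trans (Finset.sum_le_sum fun i _ => ?_)
    refine (Finset.abs_sum_le_sum_abs _ _).trans (Finset.sum_le_sum fun t _ => ?_)
    rw [abs_mul]
    exact mul_le_mul (hC _) (abs_typeDev_le n κ _) (abs_nonneg _) ((abs_nonneg _).trans (hC 0))
  have hm := measurable_devSum (n := n) loc N T hw κ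
  refine integrable_of_abs_le (by fun_prop) (C := (∑ _i : Fin N, ∑ _t : Fin T, C * 1) ^ 2)
    fun ω => ?_
  rw [abs_pow]
  exact pow_le_pow_left₀ (abs_nonneg _) (h1 ω) 2

/-- Distinct cells are uncorrelated by `integral_drive_mul_cell`, so only NT diagonal terms remain,
each with a type variance of at most 1. -/
lemma integral_devSum_sq_le (N T : ℕ) {w : I → ℝ} (hw : Measurable w) {C : ℝ}
    (hC : ∀ z, |w z| ≤ C) (κ : Fin (n + 1)) :
    ∫ ω, devSum loc N T w κ ω ^ 2 ∂(uniformLatent H) ≤ N * T * ∫ z, w z * w z := by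
  have h : ∀ ω : Latent H, devSum loc N T w κ ω ^ 2 =
      ∑ i : Fin N, ∑ j : Fin N, ∑ t : Fin T, ∑ s : Fin T,
        (w (drive loc N T i t ω) * w (drive loc N T j s ω)) *
        (typeDev n κ (ω.2.2 (i, t)) * typeDev n κ (ω.2.2 (j, s))) := by
    intro ω
    unfold devSum
    rw [sq, Finset.sum_mul_sum]
    refine Finset.sum_congr rfl fun i _ => Finset.sum_congr rfl fun j _ => ?_
    rw [Finset.sum_mul_sum]
    exact Finset.sum_congr rfl fun t _ => Finset.sum_congr rfl fun s _ => by ring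
  have hi : ∀ (i j : Fin N) (t s : Fin T), Integrable (fun ω : Latent H =>
      (w (drive loc N T i t ω) * w (drive loc N T j s ω)) *
        (typeDev n κ (ω.2.2 (i, t)) * typeDev n κ (ω.2.2 (j, s)))) (uniformLatent H) :=
      fun i j t s => by
    refine integrable_of_abs_le (by fun_prop) (C := (C * C) * (1 * 1)) fun ω => ?_
    rw [abs_mul, abs_mul, abs_mul]
    have h0 : 0 ≤ C := (abs_nonneg _).trans (hC 0)
    gcongr
    · exact hC _
    · exact hC _
    · exact abs_typeDev_le n κ _
    · exact abs_typeDev_le n κ _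
  simp_rw [h]
  rw [integral_finsetSum _ fun i _ => integrable_finsetSum _ fun j _ =>
    integrable_finsetSum _ fun t _ => integrable_finsetSum _ fun s _ => hi i j t s]
  simp_rw [integral_finsetSum _ fun j _ => integrable_finsetSum _ fun t _ =>
      integrable_finsetSum _ fun s _ => hi _ j t s,
    integral_finsetSum _ fun t _ => integrable_finsetSum _ fun s _ => hi _ _ t s,
    integral_finsetSum _ fun s _ => hi _ _ _ s,
    integral_drive_mul_cell hw hw (measurable_typeDev n κ) (measurable_typeDev n κ)
      (integral_typeDev n κ)]
  have hv : ∫ z, typeDev n κ z * typeDev n κ z ≤ 1 := by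
    rw [integral_typeDev_mul, if_pos rfl]
    have h1 : 1 / (n + 1 : ℝ) ≤ 1 := by
      rw [div_le_one (by positivity)]; linarith [(Nat.cast_nonneg n : (0 : ℝ) ≤ n)]
    nlinarith [sq_nonneg (1 / (n + 1 : ℝ))]
  have hw0 : 0 ≤ ∫ z, w z * w z := integral_nonneg fun z => mul_self_nonneg _
  have e : ∀ i j : Fin N, ∑ t : Fin T, ∑ s : Fin T, (if i = j ∧ t = s then
      (∫ z, w z * w z) * ∫ z, typeDev n κ z * typeDev n κ z else 0) =
      if i = j then T * ((∫ z, w z * w z) * ∫ z, typeDev n κ z * typeDev n κ z) else 0 := by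
    intro i j
    by_cases hij : i = j <;> simp [hij]
  simp_rw [e]
  simp only [Finset.sum_ite_eq, Finset.mem_univ, if_true, Finset.sum_const, Finset.card_univ,
    Fintype.card_fin, nsmul_eq_mul]
  rw [mul_assoc]
  gcongr
  exact mul_le_of_le_one_right hw0 hv

/-- Sums over the cells of one type. -/
lemma typeSum_eq (N T : ℕ) (w : I → ℝ) (c : Fin (n + 1)) (ω : Latent H) :
    ∑ i : Fin N, ∑ t : Fin T,
      (if cellType n (ω.2.2 (i, t)) = c then w (drive loc N T i t ω) else 0) =
      devSum loc N T w c ω + 1 / (n + 1 : ℝ) * ((max N T : ℕ) * driveSum loc N T w ω) := by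
  rw [← sum_drive, devSum, Finset.mul_sum, ← Finset.sum_add_distrib]
  refine Finset.sum_congr rfl fun i _ => ?_
  rw [Finset.mul_sum, ← Finset.sum_add_distrib]
  refine Finset.sum_congr rfl fun t _ => ?_
  unfold typeDev
  split_ifs <;> ring

end Sums

/-! ### Rates as both sample sizes diverge. -/

section Rates

lemma tendsto_min_prod_atTop :
    Tendsto (fun n : ℕ × ℕ => min n.1 n.2) (atTop ×ˢ atTop) atTop := by
  refine tendsto_atTop.2 fun b => ?_
  filter_upwards [tendsto_fst.eventually (eventually_ge_atTop b),
    tendsto_snd.eventually (eventually_ge_atTop b)] with n h1 h2 using le_min h1 h2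

lemma rateSize_eq {N T : ℕ} (h : 2 ≤ min N T) : rateSize N T = min N T := max_eq_left h

lemma tendsto_rateSize :
    Tendsto (fun n : ℕ × ℕ => (rateSize n.1 n.2 : ℝ)) (atTop ×ˢ atTop) atTop :=
  tendsto_natCast_atTop_atTop.comp
    (tendsto_atTop_mono (fun _ => le_max_left _ _) tendsto_min_prod_atTop)

lemma tendsto_inv_rareHeight {r : ℝ} (hr : 0 < r) :
    Tendsto (fun n : ℕ × ℕ => (rareHeight r n.1 n.2)⁻¹) (atTop ×ˢ atTop) (𝓝 0) :=
  ((tendsto_rpow_atTop (one_div_pos.2 hr)).comp tendsto_rateSize).inv_tendsto_atTop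

lemma tendsto_rareProb :
    Tendsto (fun n : ℕ × ℕ => rareProb n.1 n.2) (atTop ×ˢ atTop) (𝓝 0) := by
  simp_rw [rareProb, one_div]
  exact tendsto_rateSize.inv_tendsto_atTop

/-- The variance is 1/m + m^(1/r - 1), and 1/r < 1. -/
lemma tendsto_rareVar {r : ℝ} (hr : 1 < r) :
    Tendsto (fun n : ℕ × ℕ => rareVar r n.1 n.2) (atTop ×ˢ atTop) (𝓝 0) := by
  rw [← add_zero (0 : ℝ)]
  refine tendsto_rareProb.add ?_
  have h1 : 1 / r < 1 := by rw [div_lt_one (by linarith)]; exact hr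
  have h2 := (tendsto_rpow_neg_atTop (sub_pos.2 h1)).comp tendsto_rateSize
  refine h2.congr fun n => ?_
  have h3 := two_le_rateSize n.1 n.2
  simp only [Function.comp, rareProb, rareHeight]
  rw [neg_sub, Real.rpow_sub (by linarith), Real.rpow_one]
  ring

end Rates

/-! ### Expansion of the estimation errors and negligible events. -/

section Drive

variable {H : Submodule ℤ Plane} {n : ℕ} {loc : Design H} {N T : ℕ} {τ r : ℝ}

lemma driveSum_one (loc : Design H) (N T : ℕ) (ω : Latent H) :
    driveSum loc N T (fun _ => 1) ω = (min N T : ℕ) := by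
  unfold driveSum
  split_ifs with h
  · simp [h]
  · simp [(not_le.1 h).le]

lemma max_mul_min_cast (N T : ℕ) : ((max N T : ℕ) : ℝ) * (min N T : ℕ) = N * T := by
  rcases le_total N T with h | h <;> simp [h, mul_comm]

/-- In the absence of compensating values the sum is τ times the number of ones, the quantity with a
Poisson limit. -/
lemma driveSum_err_zero {ω : Latent H}
    (h : driveSum loc N T ((annulus (rareProb N T) (rareHeight r N T)).indicator fun _ => 1) ω = 0) :
    driveSum loc N T (err τ r N T (0 : Fin (n + 1))) ω =
      τ * driveSum loc N T ((central (rareProb N T)).indicator fun _ => 1) ω := by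
  have e : ∀ z, err τ r N T (0 : Fin (n + 1)) z =
      τ * (central (rareProb N T)).indicator (fun _ => (1 : ℝ)) z - τ * rareHeight r N T *
        (annulus (rareProb N T) (rareHeight r N T)).indicator (fun _ => (1 : ℝ)) z := by
    intro z
    simp only [err, if_true, rare]
    ring
  have : driveSum loc N T (err τ r N T (0 : Fin (n + 1))) ω =
      τ * driveSum loc N T ((central (rareProb N T)).indicator fun _ => 1) ω -
      τ * rareHeight r N T * driveSum loc N T
        ((annulus (rareProb N T) (rareHeight r N T)).indicator fun _ => 1) ω := by
    unfold driveSum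
    simp_rw [e]
    split_ifs <;> rw [Finset.sum_sub_distrib, Finset.mul_sum, Finset.mul_sum]
  rw [this, h, mul_zero, sub_zero]

/-- The relative deviation of the number of cells of type `c` from its mean. -/
noncomputable def countDev (loc : Design H) (N T : ℕ) (c : Fin (n + 1)) (ω : Latent H) : ℝ :=
  ((n + 1 : ℝ) / (N * T)) * devSum loc N T (fun _ => 1) c ω

/-- The part of a type average that is due to the random allocation of the types. -/
noncomputable def errDev (loc : Design H) (τ r : ℝ) (N T : ℕ) (c : Fin (n + 1)) (ω : Latent H) :
    ℝ :=
  ((n + 1 : ℝ) / (N * T)) * devSum loc N T (err τ r N T c) c ω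

/-- The average of the errors over the cells of type `c`. -/
noncomputable def typeMean (loc : Design H) (τ r : ℝ) (N T : ℕ) (c : Fin (n + 1)) (ω : Latent H) :
    ℝ :=
  (errDev loc τ r N T c ω + driveSum loc N T (err τ r N T c) ω / (min N T : ℕ)) /
    (1 + countDev loc N T c ω)

lemma typeCount_cellType (hN : 1 ≤ N) (hT : 1 ≤ T) (c : Fin (n + 1)) (ω : Latent H) :
    typeCount (fun (i : Fin N) (t : Fin T) => cellType n (ω.2.2 (i, t))) c =
      (N * T) / (n + 1 : ℝ) * (1 + countDev loc N T c ω) := by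
  have h := typeSum_eq (loc := loc) N T (fun _ => 1) c ω
  have hN' : (0 : ℝ) < N := by exact_mod_cast hN
  have hT' : (0 : ℝ) < T := by exact_mod_cast hT
  rw [driveSum_one, max_mul_min_cast] at h
  unfold typeCount
  rw [h, countDev]
  field_simp
  ring

lemma typeSum_cellType (hN : 1 ≤ N) (hT : 1 ≤ T) (c : Fin (n + 1)) (ω : Latent H) :
    typeSum (fun (i : Fin N) (t : Fin T) => cellType n (ω.2.2 (i, t)))
      (fun i t => err τ r N T (cellType n (ω.2.2 (i, t))) (drive loc N T i t ω)) c =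
      (N * T) / (n + 1 : ℝ) *
        (errDev loc τ r N T c ω + driveSum loc N T (err τ r N T c) ω / (min N T : ℕ)) := by
  have h := typeSum_eq (loc := loc) N T (err τ r N T c) c ω
  have hN' : (0 : ℝ) < N := by exact_mod_cast hN
  have hT' : (0 : ℝ) < T := by exact_mod_cast hT
  have hm : (0 : ℝ) < (min N T : ℕ) := by exact_mod_cast lt_min hN hT
  unfold typeSum
  have e : ∀ (i : Fin N) (t : Fin T), (if cellType n (ω.2.2 (i, t)) = c then
      err τ r N T (cellType n (ω.2.2 (i, t))) (drive loc N T i t ω) else 0) =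
      if cellType n (ω.2.2 (i, t)) = c then err τ r N T c (drive loc N T i t ω) else 0 := by
    intro i t
    split_ifs with h
    · rw [h]
    · rfl
  simp_rw [e]
  rw [h, errDev, mul_add, ← max_mul_min_cast]
  have hM : (0 : ℝ) < (max N T : ℕ) := by exact_mod_cast lt_max_of_lt_left hN
  field_simp

/-- Unless the allocation of the types is exceptional, the estimation errors are differences of
type averages. -/
lemma ols_sparseDGP {M : ℕ} (hM : 1 ≤ M) (hN : 1 ≤ N) (hT : 1 ≤ T) (β : Fin (n + 1) → ℝ)
    {ω : Latent H} (h : ∀ c, |countDev (n := n) loc N T c ω| < 1 / 2) :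
    ols ((sparseDGP H M n r τ).obs loc β N T ω) 0 - β 0 = typeMean (n := n) loc τ r N T 0 ω ∧
    ∀ j : Fin n, ols ((sparseDGP H M n r τ).obs loc β N T ω) j.succ - β j.succ =
      typeMean (n := n) loc τ r N T j.succ ω - typeMean (n := n) loc τ r N T 0 ω := by
  have hN' : (0 : ℝ) < N := by exact_mod_cast hN
  have hT' : (0 : ℝ) < T := by exact_mod_cast hT
  have hc : ∀ c, 0 < 1 + countDev (n := n) loc N T c ω := fun c => by
    have := (abs_lt.1 (h c)).1; linarith
  have hL : (0 : ℝ) < (N * T) / (n + 1 : ℝ) := by positivity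
  have hq : ∀ c : Fin (n + 1),
      typeSum (fun (i : Fin N) (t : Fin T) => cellType n (ω.2.2 (i, t)))
        (fun i t => err τ r N T (cellType n (ω.2.2 (i, t))) (drive loc N T i t ω)) c /
      typeCount (fun (i : Fin N) (t : Fin T) => cellType n (ω.2.2 (i, t))) c =
      typeMean loc τ r N T c ω := by
    intro c
    rw [typeSum_cellType hN hT, typeCount_cellType (loc := loc) hN hT, typeMean,
      mul_div_mul_left _ _ hL.ne']
  -- Count deviations below 1/2 make every type occur, as `ols_of_types` requires.
  have key := ols_of_types hM (fun (i : Fin N) (t : Fin T) => cellType n (ω.2.2 (i, t)))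
    (fun i t => err τ r N T (cellType n (ω.2.2 (i, t))) (drive loc N T i t ω)) β
    ((sparseDGP H M n r τ).obs loc β N T ω) (fun i t m => rfl) (fun i t m k => rfl)
    (fun c => by rw [typeCount_cellType (loc := loc) hN hT]; exact mul_pos hL (hc c))
  simp_rw [hq] at key
  refine ⟨by rw [key.1]; ring, fun j => by rw [key.2 j]; ring⟩

lemma tendstoInMeasure_devSum (c : Fin (n + 1)) {w : ℕ × ℕ → I → ℝ} (hw : ∀ m, Measurable (w m))
    {C : ℕ × ℕ → ℝ} (hC : ∀ m z, |w m z| ≤ C m) {s v : ℕ × ℕ → ℝ}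
    (hv : Tendsto v (atTop ×ˢ atTop) (𝓝 0))
    (hs : ∀ᶠ m in atTop ×ˢ atTop,
      s m ^ 2 * ((m.1 * m.2 : ℝ) * ∫ z, w m z * w m z) ≤ v m) :
    TendstoInMeasure (uniformLatent H) (fun m ω => s m * devSum loc m.1 m.2 (w m) c ω)
      (atTop ×ˢ atTop) 0 := by
  refine tendstoInMeasure_zero_of_integral_sq (fun m => ?_) hv ?_
  · simp_rw [mul_pow]
    exact (integrable_devSum_sq m.1 m.2 (hw m) (hC m) c).const_mul _
  · filter_upwards [hs] with m hm
    simp_rw [mul_pow]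
    rw [integral_const_mul]
    exact (mul_le_mul_of_nonneg_left (integral_devSum_sq_le m.1 m.2 (hw m) (hC m) c)
      (sq_nonneg _)).trans hm

lemma tendsto_inv_prod_atTop :
    Tendsto (fun m : ℕ × ℕ => (m.1 * m.2 : ℝ)⁻¹) (atTop ×ˢ atTop) (𝓝 0) :=
  ((tendsto_natCast_atTop_atTop.comp tendsto_fst).atTop_mul_atTop₀
    (tendsto_natCast_atTop_atTop.comp tendsto_snd)).inv_tendsto_atTop

lemma eventually_two_le_min :
    ∀ᶠ m : ℕ × ℕ in atTop ×ˢ atTop, 2 ≤ min m.1 m.2 :=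
  tendsto_min_prod_atTop.eventually_ge_atTop 2

lemma tendstoInMeasure_countDev (c : Fin (n + 1)) :
    TendstoInMeasure (uniformLatent H) (fun m ω => countDev loc m.1 m.2 c ω)
      (atTop ×ˢ atTop) 0 := by
  refine tendstoInMeasure_devSum c (fun _ => measurable_const) (C := fun _ => 1) (by simp)
    (v := fun m => (n + 1 : ℝ) ^ 2 * (m.1 * m.2 : ℝ)⁻¹)
    (by simpa using tendsto_inv_prod_atTop.const_mul ((n + 1 : ℝ) ^ 2)) ?_
  filter_upwards [eventually_two_le_min] with m hm
  have h1 : (0 : ℝ) < m.1 := by exact_mod_cast (by omega : 0 < m.1)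
  have h2 : (0 : ℝ) < m.2 := by exact_mod_cast (by omega : 0 < m.2)
  refine le_of_eq ?_
  simp
  field_simp

lemma tendsto_measure_countDev :
    Tendsto (fun m : ℕ × ℕ => uniformLatent H
      {ω | ∃ c : Fin (n + 1), 1 / 2 ≤ |countDev loc m.1 m.2 c ω|}) (atTop ×ˢ atTop) (𝓝 0) := by
  have h : ∀ c : Fin (n + 1), Tendsto (fun m : ℕ × ℕ => uniformLatent H
      {ω | 1 / 2 ≤ |countDev loc m.1 m.2 c ω|}) (atTop ×ˢ atTop) (𝓝 0) := fun c => by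
    have := tendstoInMeasure_iff_norm.1 (tendstoInMeasure_countDev (H := H) (loc := loc) c)
      (1 / 2) (by norm_num)
    simpa using this
  have h' : Tendsto (fun m : ℕ × ℕ => ∑ c : Fin (n + 1), uniformLatent H
      {ω | 1 / 2 ≤ |countDev loc m.1 m.2 c ω|}) (atTop ×ˢ atTop) (𝓝 0) := by
    simpa using tendsto_finsetSum Finset.univ fun c _ => h c
  refine tendsto_of_tendsto_of_tendsto_of_le_of_le tendsto_const_nhds h' (fun _ => zero_le)
    fun m => ?_
  have e : {ω | ∃ c : Fin (n + 1), 1 / 2 ≤ |countDev loc m.1 m.2 c ω|} =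
      ⋃ c : Fin (n + 1), {ω | 1 / 2 ≤ |countDev loc m.1 m.2 c ω|} := by
    ext ω; simp
  simp only [e]
  exact measure_iUnion_fintype_le _ _

lemma volume_compl_eq {S : Set I} (hS : MeasurableSet S) {p : ℝ} (h : volume.real S = p) :
    volume Sᶜ = ENNReal.ofReal (1 - p) := by
  rw [← h, ← probReal_compl_eq_one_sub hS, ofReal_measureReal]

/-- Bernoulli's inequality applied to the probability that all draws avoid the set. -/
lemma measure_driveSum_ne_zero_le (hloc : ∀ N, Function.Injective (loc N)) (N T : ℕ) {S : Set I}
    (hS : MeasurableSet S) :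
    uniformLatent H {ω | driveSum loc N T (S.indicator fun _ => 1) ω ≠ 0} ≤
      ENNReal.ofReal ((min N T : ℕ) * volume.real S) := by
  have hm : MeasurableSet {ω | driveSum loc N T (S.indicator fun _ => (1 : ℝ)) ω = 0} :=
    measurable_driveSum loc N T (measurable_const.indicator hS) (measurableSet_singleton 0)
  have e : {ω | driveSum loc N T (S.indicator fun _ => (1 : ℝ)) ω ≠ 0} =
      {ω | driveSum loc N T (S.indicator fun _ => (1 : ℝ)) ω = 0}ᶜ := rfl
  have h1 : volume.real S ≤ 1 := measureReal_le_one
  rw [e, ← ofReal_measureReal, probReal_compl_eq_one_sub hm, measureReal_def,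
    measure_driveSum_eq_zero hloc N T hS, volume_compl_eq hS rfl,
    ← ENNReal.ofReal_pow (by linarith), ENNReal.toReal_ofReal (pow_nonneg (by linarith) _)]
  refine ENNReal.ofReal_le_ofReal ?_
  have := one_add_mul_le_pow (a := -volume.real S) (by linarith) (min N T)
  rw [← sub_eq_add_neg] at this
  linarith

/-- With m draws, each hitting with probability 1/(mh), the chance of any hit is at most 1/h. -/
lemma tendsto_measure_annulus (hloc : ∀ N, Function.Injective (loc N)) (hr : 0 < r) :
    Tendsto (fun m : ℕ × ℕ => uniformLatent H {ω | driveSum loc m.1 m.2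
      ((annulus (rareProb m.1 m.2) (rareHeight r m.1 m.2)).indicator fun _ => 1) ω ≠ 0})
      (atTop ×ˢ atTop) (𝓝 0) := by
  have h : Tendsto (fun m : ℕ × ℕ => ENNReal.ofReal (rareHeight r m.1 m.2)⁻¹) (atTop ×ˢ atTop)
      (𝓝 0) := by
    simpa using ENNReal.tendsto_ofReal (tendsto_inv_rareHeight hr)
  refine tendsto_of_tendsto_of_tendsto_of_le_of_le' tendsto_const_nhds h (.of_forall fun _ => zero_le)
    ?_
  filter_upwards [eventually_two_le_min] with m hm
  refine (measure_driveSum_ne_zero_le hloc m.1 m.2 (measurableSet_annulus _ _)).trans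
    (ENNReal.ofReal_le_ofReal ?_)
  rw [volume_real_annulus (rareProb_pos _ _).le (one_le_rareHeight hr _ _)
    (two_mul_rareProb_le _ _), rareProb, rateSize_eq hm]
  have h0 : (0 : ℝ) < (min m.1 m.2 : ℕ) := by exact_mod_cast (by omega : 0 < min m.1 m.2)
  refine le_of_eq ?_
  field_simp

end Drive

/-! ### Slutsky's theorem with exceptional events. -/

section Slutsky

variable {Ω Ω' ι : Type*} [MeasurableSpace Ω] [MeasurableSpace Ω'] {μ : Measure Ω}
  [IsProbabilityMeasure μ] {ρ : Measure Ω'} [IsProbabilityMeasure ρ] {l : Filter ι}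

/-- Slutsky's theorem for ratios, up to a remainder that is negligible outside small sets. -/
lemma tendstoInDistribution_ratio [l.IsCountablyGenerated] {X Y D A : ι → Ω → ℝ} {Z : Ω' → ℝ}
    {B : ι → Set Ω} {C : ℝ} (hX : TendstoInDistribution X l Z (fun _ => μ) ρ)
    (hD : TendstoInMeasure μ D l 0) (hDm : ∀ i, AEMeasurable (D i) μ)
    (hA : TendstoInMeasure μ A l 0) (hB : Tendsto (fun i => μ (B i)) l (𝓝 0)) (hC : 0 < C)
    (hY : ∀ i, AEMeasurable (Y i) μ)
    (h : ∀ᶠ i in l, ∀ ω, ω ∉ B i → |Y i ω - X i ω / max (1 + D i ω) (1 / 2)| ≤ C * |A i ω|) :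
    TendstoInDistribution Y l Z (fun _ => μ) ρ := by
  -- Truncating the denominator at 1/2 gives a function continuous on the whole plane, as the
  -- mapping theorem needs; the truncation is harmless when |D| < 1/2.
  have hg : Continuous fun p : ℝ × ℝ => p.1 / max (1 + p.2) (1 / 2) := by
    refine continuous_fst.div (by fun_prop) fun p => ?_
    have : (1 / 2 : ℝ) ≤ max (1 + p.2) (1 / 2) := le_max_right _ _
    intro h0
    rw [h0] at this
    norm_num at this
  have h1 := hX.continuous_comp_prodMk_of_tendstoInMeasure_const hg (c := (0 : ℝ)) hD hDm
  have h2 : (fun ω => Z ω / max (1 + (0 : ℝ)) (1 / 2)) = Z := by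
    funext ω
    norm_num
  simp only [h2] at h1
  exact tendstoInDistribution_of_tendstoInMeasure_sub Y Z h1
    (tendstoInMeasure_zero_of_abs_le hA hB hC h) hY

lemma tendstoInDistribution_map_id {X : ι → Ω → ℝ} {Z : Ω' → ℝ}
    (hX : TendstoInDistribution X l Z (fun _ => μ) ρ) (Q : ProbabilityMeasure ℝ)
    (hQ : (Q : Measure ℝ) = ρ.map Z) :
    TendstoInDistribution X l (id : ℝ → ℝ) (fun _ => μ) (Q : Measure ℝ) where
  forall_aemeasurable := hX.forall_aemeasurable
  aemeasurable_limit := aemeasurable_id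
  tendsto := by
    convert! hX.tendsto using 2
    refine congrArg 𝓝 (Subtype.ext ?_)
    change (Q : Measure ℝ).map id = ρ.map Z
    rw [Measure.map_id, hQ]

end Slutsky

/-! ### Negligibility of the remainders. -/

section Remainders

variable {H : Submodule ℤ Plane} {n : ℕ} {loc : Design H} {τ r : ℝ}

lemma measurable_countDev (N T : ℕ) (c : Fin (n + 1)) : Measurable (countDev loc N T c) :=
  (measurable_devSum loc N T measurable_const c).const_mul _

/-- The second moment is at most (n + 1)² times `rareVar` times m²/(NT). The last ratio need not
vanish, so the decay comes from the rare variance. -/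
lemma tendstoInMeasure_rateSize_mul_errDev (hτ : |τ| = 1) (hr : 1 < r) :
    TendstoInMeasure (uniformLatent H)
      (fun m ω => rateSize m.1 m.2 * errDev loc τ r m.1 m.2 (0 : Fin (n + 1)) ω)
      (atTop ×ˢ atTop) 0 := by
  have hr0 : 0 < r := by linarith
  simp_rw [errDev, ← mul_assoc]
  refine tendstoInMeasure_devSum (0 : Fin (n + 1)) (fun m => measurable_err τ r m.1 m.2 0)
    (fun m => abs_err_le hτ hr0 m.1 m.2 0)
    (v := fun m => (n + 1 : ℝ) ^ 2 * rareVar r m.1 m.2)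
    (by simpa using (tendsto_rareVar hr).const_mul ((n + 1 : ℝ) ^ 2)) ?_
  filter_upwards [eventually_two_le_min] with m hm
  have h1 : (0 : ℝ) < m.1 := by exact_mod_cast (by omega : 0 < m.1)
  have h2 : (0 : ℝ) < m.2 := by exact_mod_cast (by omega : 0 < m.2)
  rw [integral_err_mul hτ hr0, errCov, if_pos rfl, if_pos rfl, rateSize_eq hm]
  have h3 : ((min m.1 m.2 : ℕ) : ℝ) ^ 2 ≤ m.1 * m.2 := by
    rw [sq]
    gcongr
    · exact min_le_left _ _
    · exact min_le_right _ _
  have h4 := (rareVar_pos hr0 m.1 m.2).le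
  have e : ((min m.1 m.2 : ℕ) * ((n + 1 : ℝ) / (m.1 * m.2))) ^ 2 *
      (m.1 * m.2 * rareVar r m.1 m.2) =
      (n + 1 : ℝ) ^ 2 * rareVar r m.1 m.2 * (((min m.1 m.2 : ℕ) : ℝ) ^ 2 / (m.1 * m.2)) := by
    field_simp
  rw [e]
  exact mul_le_of_le_one_right (by positivity) ((div_le_one (by positivity)).2 h3)

/-- The remainder terms in the expansion of the estimators of the coefficients other than the
first. -/
noncomputable def remainder (loc : Design H) (τ r : ℝ) (N T : ℕ) (c : Fin (n + 1))
    (ω : Latent H) : ℝ :=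
  √(rateSize N T * errDev loc τ r N T c ω ^ 2 +
    rateSize N T * errDev loc τ r N T (0 : Fin (n + 1)) ω ^ 2 +
    rateSize N T * (driveSum loc N T (err τ r N T (0 : Fin (n + 1))) ω / (min N T : ℕ)) ^ 2)

lemma remainder_sq (N T : ℕ) (c : Fin (n + 1)) (ω : Latent H) :
    remainder loc τ r N T c ω ^ 2 = rateSize N T * errDev loc τ r N T c ω ^ 2 +
    rateSize N T * errDev loc τ r N T (0 : Fin (n + 1)) ω ^ 2 +
    rateSize N T * (driveSum loc N T (err τ r N T (0 : Fin (n + 1))) ω / (min N T : ℕ)) ^ 2 :=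
  Real.sq_sqrt (by positivity)

lemma integrable_errDev_sq (hτ : |τ| = 1) (hr : 0 < r) (N T : ℕ) (c : Fin (n + 1)) :
    Integrable (fun ω => errDev loc τ r N T c ω ^ 2) (uniformLatent H) := by
  simp_rw [errDev, mul_pow]
  exact (integrable_devSum_sq N T (measurable_err τ r N T c) (abs_err_le hτ hr N T c) c).const_mul _

lemma integral_errDev_sq_le (hτ : |τ| = 1) (hr : 0 < r) {N T : ℕ} (h : 2 ≤ min N T)
    (c : Fin (n + 1)) :
    rateSize N T * ∫ ω, errDev loc τ r N T c ω ^ 2 ∂(uniformLatent H) ≤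
      (n + 1 : ℝ) ^ 2 * rareProb N T * (1 + rareVar r N T) := by
  have h1 : (0 : ℝ) < N := by exact_mod_cast (by omega : 0 < N)
  have h2 : (0 : ℝ) < T := by exact_mod_cast (by omega : 0 < T)
  have h4 := rareVar_pos hr N T
  have hm : (0 : ℝ) < (min N T : ℕ) := by exact_mod_cast (by omega : 0 < min N T)
  simp_rw [errDev, mul_pow]
  rw [integral_const_mul, ← mul_assoc]
  have h5 := integral_devSum_sq_le (H := H) (loc := loc) N T (measurable_err τ r N T c)
    (abs_err_le hτ hr N T c) c
  rw [integral_err_mul hτ hr] at h5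
  have h6 : errCov r N T c c ≤ 1 + rareVar r N T := by
    unfold errCov; split_ifs <;> linarith
  have h7 : ((min N T : ℕ) : ℝ) * (min N T : ℕ) ≤ N * T := by
    gcongr
    · exact min_le_left _ _
    · exact min_le_right _ _
  calc _ ≤ ↑(rateSize N T) * ((n + 1 : ℝ) / (N * T)) ^ 2 * (N * T * (1 + rareVar r N T)) := by
        gcongr
        exact h5.trans (by gcongr)
    _ = (n + 1 : ℝ) ^ 2 * ((min N T : ℕ) / (N * T)) * (1 + rareVar r N T) := by
        rw [rateSize_eq h]
        field_simp
    _ ≤ _ := by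
        rw [rareProb, rateSize_eq h]
        gcongr (n + 1 : ℝ) ^ 2 * ?_ * _
        rw [div_le_div_iff₀ (by positivity) hm, one_mul]
        exact h7

/-- Bundling three terms into one root of a sum of squares allows a single Chebyshev bound: the
allocation terms are of order 1/m, and the type 0 average, scaled by √m, has second moment
`rareVar`. -/
lemma tendstoInMeasure_remainder (hloc : ∀ N, Function.Injective (loc N)) (hτ : |τ| = 1)
    (hr : 1 < r) (c : Fin (n + 1)) :
    TendstoInMeasure (uniformLatent H) (fun m ω => remainder loc τ r m.1 m.2 c ω)
      (atTop ×ˢ atTop) 0 := by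
  have hr0 : 0 < r := by linarith
  have i1 : ∀ (m : ℕ × ℕ) (c : Fin (n + 1)), Integrable (fun ω =>
      rateSize m.1 m.2 * errDev loc τ r m.1 m.2 c ω ^ 2) (uniformLatent H) := fun m c =>
    (integrable_errDev_sq hτ hr0 m.1 m.2 c).const_mul _
  have i2 : ∀ m : ℕ × ℕ, Integrable (fun ω => rateSize m.1 m.2 *
      (driveSum loc m.1 m.2 (err τ r m.1 m.2 (0 : Fin (n + 1))) ω / (min m.1 m.2 : ℕ)) ^ 2)
      (uniformLatent H) := fun m => by
    simp_rw [div_pow]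
    exact ((integrable_driveSum_sq m.1 m.2 (measurable_err τ r m.1 m.2 0)
      (abs_err_le hτ hr0 m.1 m.2 0)).div_const _).const_mul _
  refine tendstoInMeasure_zero_of_integral_sq (c := fun m =>
    (n + 1 : ℝ) ^ 2 * rareProb m.1 m.2 * (1 + rareVar r m.1 m.2) +
    (n + 1 : ℝ) ^ 2 * rareProb m.1 m.2 * (1 + rareVar r m.1 m.2) + rareVar r m.1 m.2)
    (fun m => ?_) ?_ ?_
  · simp_rw [remainder_sq]
    exact ((i1 m c).add (i1 m 0)).add (i2 m)
  · have h1 := (tendsto_rareProb.const_mul ((n + 1 : ℝ) ^ 2)).mul ((tendsto_rareVar hr).const_add 1)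
    simpa using (h1.add h1).add (tendsto_rareVar hr)
  · filter_upwards [eventually_two_le_min] with m hm
    simp_rw [remainder_sq]
    have i12 : Integrable (fun ω => rateSize m.1 m.2 * errDev loc τ r m.1 m.2 c ω ^ 2 +
        rateSize m.1 m.2 * errDev loc τ r m.1 m.2 (0 : Fin (n + 1)) ω ^ 2) (uniformLatent H) :=
      (i1 m c).add (i1 m 0)
    rw [integral_add i12 (i2 m), integral_add (i1 m c) (i1 m 0),
      integral_const_mul, integral_const_mul, integral_const_mul]
    refine add_le_add (add_le_add (integral_errDev_sq_le hτ hr0 hm c)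
      (integral_errDev_sq_le hτ hr0 hm 0)) (le_of_eq ?_)
    simp_rw [div_pow]
    rw [integral_div, integral_driveSum_sq hloc m.1 m.2 (measurable_err τ r m.1 m.2 0)
      (abs_err_le hτ hr0 m.1 m.2 0) (integral_err hr0 m.1 m.2 0), integral_err_mul hτ hr0,
      errCov, if_pos rfl, if_pos rfl, rateSize_eq hm]
    have h0 : (0 : ℝ) < (min m.1 m.2 : ℕ) := by exact_mod_cast (by omega : 0 < min m.1 m.2)
    field_simp

end Remainders

/-! ### Limit laws of the least squares coordinates. -/

section LimitLaws

variable {H : Submodule ℤ Plane} {n : ℕ} {loc : Design H} {τ r : ℝ}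

lemma measurable_obs {M K : ℕ} (f : DGP H M K) (hf : ∀ N T, Measurable (f.fn N T))
    (β : Fin K → ℝ) (N T : ℕ) : Measurable (f.obs loc β N T) := by
  refine measurable_pi_lambda _ fun i => measurable_pi_lambda _ fun t => ?_
  have h : Measurable fun ω => f.fn N T (DGP.cell loc N T i t ω) :=
    (hf N T).comp (measurable_cell loc N T i t)
  refine Measurable.prodMk ?_ h.fst
  refine measurable_pi_lambda _ fun m => ?_
  simp only [Pi.add_apply, Matrix.mulVec, dotProduct, Matrix.of_apply]
  fun_prop

lemma tendstoInDistribution_driveSum_central (hloc : ∀ N, Function.Injective (loc N)) :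
    TendstoInDistribution (fun (m : ℕ × ℕ) ω => driveSum loc m.1 m.2
      ((central (rareProb m.1 m.2)).indicator fun _ => 1) ω) (atTop ×ˢ atTop) (id : ℝ → ℝ)
      (fun _ => uniformLatent H) ((poissonMeasure 1).map ((↑) : ℕ → ℝ)) := by
  have hlim : Tendsto (fun k : ℕ => (k : ℝ) * volume.real (central (1 / (max k 2 : ℕ) : ℝ)))
      atTop (𝓝 1) := by
    refine tendsto_const_nhds.congr' ?_
    filter_upwards [eventually_ge_atTop 2] with k hk
    have hk' : (2 : ℝ) ≤ k := by exact_mod_cast hk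
    rw [max_eq_left hk, volume_real_central (by positivity)
      (by rw [div_le_one (by linarith)]; linarith)]
    field_simp
  refine tendstoInDistribution_of_map_eq
    (tendstoInDistribution_sum_indicator (fun k => measurableSet_central _) hlim)
    tendsto_min_prod_atTop (fun m => (measurable_driveSum loc m.1 m.2
      (measurable_const.indicator (measurableSet_central _))).aemeasurable) fun m => ?_
  exact map_driveSum hloc m.1 m.2 (measurable_const.indicator (measurableSet_central _))

lemma tendstoInDistribution_driveSum_halfSign (hloc : ∀ N, Function.Injective (loc N)) :
    TendstoInDistribution (fun (m : ℕ × ℕ) ω =>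
      (√(min m.1 m.2 : ℕ))⁻¹ * driveSum loc m.1 m.2 halfSign ω) (atTop ×ˢ atTop) (id : ℝ → ℝ)
      (fun _ => uniformLatent H) (gaussianReal 0 1) := by
  have hd := fun m : ℕ × ℕ => measurable_driveSum loc m.1 m.2 measurable_halfSign
  refine tendstoInDistribution_of_map_eq
    (tendstoInDistribution_sum_of_sq_eq_one measurable_halfSign integral_halfSign halfSign_sq)
    tendsto_min_prod_atTop (fun m => ((hd m).const_mul _).aemeasurable) fun m => ?_
  have hm : Measurable fun x : ℕ → I => ∑ i ∈ Finset.range (min m.1 m.2), halfSign (x i) := by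
    have := measurable_halfSign
    fun_prop
  have hc : Measurable fun y : ℝ => (√(min m.1 m.2 : ℕ))⁻¹ * y := by fun_prop
  have h1 := congrArg (Measure.map fun y : ℝ => (√(min m.1 m.2 : ℕ))⁻¹ * y)
    (map_driveSum hloc m.1 m.2 measurable_halfSign)
  rw [Measure.map_map hc (hd m), Measure.map_map hc hm] at h1
  exact h1

/-- The limit law of the estimator of the first coefficient. -/
noncomputable def rareLaw (τ : ℝ) : ProbabilityMeasure ℝ :=
  ⟨((poissonMeasure 1).map ((↑) : ℕ → ℝ)).map fun x => τ * x,
    Measure.isProbabilityMeasure_map (by fun_prop)⟩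

/-- Every point τk carries mass, and the points for k = 0 and k = 1 differ because |τ| = 1. -/
lemma rareLaw_ne_dirac (hτ : |τ| = 1) (x : ℝ) : (rareLaw τ : Measure ℝ) ≠ Measure.dirac x := by
  intro h
  have hk : ∀ k : ℕ, x = τ * k := by
    intro k
    by_contra hne
    have h1 : (rareLaw τ : Measure ℝ) {τ * (k : ℝ)} = 0 := by
      rw [h, Measure.dirac_apply' _ (measurableSet_singleton _)]
      simp [hne]
    have h2 : ((rareLaw τ : Measure ℝ)) {τ * (k : ℝ)} =
        ((poissonMeasure 1).map ((↑) : ℕ → ℝ)) ((fun x => τ * x) ⁻¹' {τ * (k : ℝ)}) :=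
      Measure.map_apply (by fun_prop) (measurableSet_singleton _)
    rw [h1, Measure.map_apply (by fun_prop)
      ((by fun_prop : Measurable fun x : ℝ => τ * x) (measurableSet_singleton _))] at h2
    have h3 : poissonMeasure 1 {k} = 0 := by
      refine measure_mono_null ?_ h2.symm
      intro y hy
      rw [Set.mem_singleton_iff.1 hy]
      simp
    have h4 := poissonMeasure_real_singleton_pos (r := 1) k one_pos
    rw [measureReal_def, h3] at h4
    simp at h4
  have h0 := hk 0
  have h1 := hk 1
  rw [h0] at h1
  simp only [Nat.cast_zero, mul_zero, Nat.cast_one, mul_one] at h1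
  rw [← h1] at hτ
  simp at hτ

/-- The standard normal law. -/
noncomputable def normalLaw : ProbabilityMeasure ℝ := ⟨gaussianReal 0 1, inferInstance⟩

lemma abs_div_le_two_mul {x d : ℝ} (hd : |d| < 1 / 2) : |x / (1 + d)| ≤ 2 * |x| := by
  have := (abs_lt.1 hd).1
  rw [abs_div, div_le_iff₀ (abs_pos.2 (by linarith)), abs_of_pos (by linarith : 0 < 1 + d)]
  nlinarith [abs_nonneg x]

/-- The event that the type counts deviate substantially from their means, or that one of the rare
compensating errors occurs. -/
def exceptional (loc : Design H) (n : ℕ) (r : ℝ) (N T : ℕ) : Set (Latent H) :=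
  {ω | ∃ c : Fin (n + 1), 1 / 2 ≤ |countDev loc N T c ω|} ∪
    {ω | driveSum loc N T ((annulus (rareProb N T) (rareHeight r N T)).indicator fun _ => 1) ω ≠ 0}

lemma notMem_exceptional {N T : ℕ} {ω : Latent H} : ω ∉ exceptional loc n r N T ↔
    (∀ c : Fin (n + 1), |countDev loc N T c ω| < 1 / 2) ∧ driveSum loc N T
      ((annulus (rareProb N T) (rareHeight r N T)).indicator fun _ => 1) ω = 0 := by
  simp only [exceptional, Set.mem_union, Set.mem_ofPred_eq, not_or, not_exists, not_le, not_not]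

lemma tendsto_measure_exceptional (hloc : ∀ N, Function.Injective (loc N)) (hr : 0 < r) :
    Tendsto (fun m : ℕ × ℕ => uniformLatent H (exceptional loc n r m.1 m.2)) (atTop ×ˢ atTop)
      (𝓝 0) := by
  have hB := (tendsto_measure_countDev (H := H) (n := n) (loc := loc)).add
    (tendsto_measure_annulus (H := H) hloc hr)
  rw [add_zero] at hB
  exact tendsto_of_tendsto_of_tendsto_of_le_of_le tendsto_const_nhds hB (fun _ => zero_le)
    fun m => measure_union_le _ _

/-- Outside `exceptional`, the scaled error is τ times a Poisson-type count plus a negligible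
allocation term, divided by the relative type count. -/
lemma hasLimitLaw_zero {M : ℕ} (hM : 1 ≤ M) (hτ : |τ| = 1) (hr : 1 < r)
    (hloc : ∀ N, Function.Injective (loc N)) (β : Fin (n + 1) → ℝ) :
    (sparseDGP H M n r τ).HasLimitLaw loc β 0 (fun N T => rateSize N T) (rareLaw τ) := by
  have hr0 : 0 < r := by linarith
  refine ⟨fun N T => by linarith [two_le_rateSize N T], ?_, rareLaw_ne_dirac hτ⟩
  have hX := (tendstoInDistribution_driveSum_central (H := H) hloc).continuous_comp
    (g := fun x => τ * x) (by fun_prop)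
  have hX' := tendstoInDistribution_map_id hX (rareLaw τ) rfl
  refine tendstoInDistribution_ratio (C := 2) hX'
    (tendstoInMeasure_countDev (H := H) (loc := loc) (0 : Fin (n + 1)))
    (fun m => (measurable_countDev m.1 m.2 0).aemeasurable)
    (tendstoInMeasure_rateSize_mul_errDev (n := n) (loc := loc) hτ hr)
    (tendsto_measure_exceptional (n := n) hloc hr0) two_pos
    (fun m => (((measurable_ols 0).comp (measurable_obs _ (fun N T => measurable_fn_sparseDGP N T)
      β m.1 m.2)).sub_const _ |>.const_mul _).aemeasurable) ?_
  filter_upwards [eventually_two_le_min] with m hm ω hω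
  rw [notMem_exceptional] at hω
  rw [(ols_sparseDGP hM (by omega) (by omega) β hω.1).1, typeMean, driveSum_err_zero hω.2,
    rateSize_eq hm]
  have h0 : (0 : ℝ) < (min m.1 m.2 : ℕ) := by exact_mod_cast (by omega : 0 < min m.1 m.2)
  have hd := (abs_lt.1 (hω.1 0)).1
  rw [max_eq_left (by linarith)]
  refine le_trans (le_of_eq ?_) (abs_div_le_two_mul (hω.1 0))
  congr 1
  simp only [Function.comp]
  field_simp
  ring

/-- The type average of the signs dominates at rate √m. The type 0 average, which is subtracted, has
the faster rate m and is negligible. -/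
lemma hasLimitLaw_succ {M : ℕ} (hM : 1 ≤ M) (hτ : |τ| = 1) (hr : 1 < r)
    (hloc : ∀ N, Function.Injective (loc N)) (β : Fin (n + 1) → ℝ) (j : Fin n) :
    (sparseDGP H M n r τ).HasLimitLaw loc β j.succ (fun N T => √(rateSize N T)) normalLaw := by
  have hr0 : 0 < r := by linarith
  refine ⟨fun N T => Real.sqrt_pos.2 (by linarith [two_le_rateSize N T]), ?_, fun x h => ?_⟩
  swap
  · have h1 := nullSingletonClass_gaussianReal (μ := 0) (v := 1) one_ne_zero
    have h2 : gaussianReal 0 1 {x} = 0 := measure_singleton x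
    have h3 : gaussianReal 0 1 = Measure.dirac x := h
    rw [h3] at h2
    simp at h2
  have hX := tendstoInDistribution_map_id
    (tendstoInDistribution_driveSum_halfSign (H := H) hloc) normalLaw
    Measure.map_id.symm
  -- Three remainder terms, each at most twice the bundled remainder.
  refine tendstoInDistribution_ratio (C := 6) hX
    (tendstoInMeasure_countDev (H := H) (loc := loc) j.succ)
    (fun m => (measurable_countDev m.1 m.2 j.succ).aemeasurable)
    (tendstoInMeasure_remainder hloc hτ hr j.succ)
    (B := fun m => {ω | ∃ c : Fin (n + 1), 1 / 2 ≤ |countDev loc m.1 m.2 c ω|})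
    tendsto_measure_countDev (by norm_num)
    (fun m => (((measurable_ols j.succ).comp (measurable_obs _
      (fun N T => measurable_fn_sparseDGP N T) β m.1 m.2)).sub_const _ |>.const_mul _).aemeasurable) ?_
  filter_upwards [eventually_two_le_min] with m hm ω hω
  simp only [not_exists, not_le] at hω
  rw [(ols_sparseDGP hM (by omega) (by omega) β hω).2 j, typeMean, typeMean]
  have h0 : (0 : ℝ) < (min m.1 m.2 : ℕ) := by exact_mod_cast (by omega : 0 < min m.1 m.2)
  have hd := (abs_lt.1 (hω j.succ)).1
  have hd0 := (abs_lt.1 (hω 0)).1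
  rw [max_eq_left (by linarith)]
  have he : err τ r m.1 m.2 j.succ = halfSign := by
    funext z
    simp [err, Fin.succ_ne_zero]
  have hsq := remainder_sq (loc := loc) (τ := τ) (r := r) m.1 m.2 j.succ ω
  set R := remainder loc τ r m.1 m.2 j.succ ω with hR
  have hs : √(rateSize m.1 m.2 : ℝ) ^ 2 = rateSize m.1 m.2 := Real.sq_sqrt (by positivity)
  rw [← hs, ← mul_pow, ← mul_pow, ← mul_pow] at hsq
  have b1 : |√(rateSize m.1 m.2 : ℝ) * errDev loc τ r m.1 m.2 j.succ ω| ≤ |R| :=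
    sq_le_sq.1 (by rw [hsq]; nlinarith [sq_nonneg (√(rateSize m.1 m.2 : ℝ) *
      errDev loc τ r m.1 m.2 (0 : Fin (n + 1)) ω), sq_nonneg (√(rateSize m.1 m.2 : ℝ) *
      (driveSum loc m.1 m.2 (err τ r m.1 m.2 (0 : Fin (n + 1))) ω / (min m.1 m.2 : ℕ)))])
  have b2 : |√(rateSize m.1 m.2 : ℝ) * errDev loc τ r m.1 m.2 (0 : Fin (n + 1)) ω| ≤ |R| :=
    sq_le_sq.1 (by rw [hsq]; nlinarith [sq_nonneg (√(rateSize m.1 m.2 : ℝ) *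
      errDev loc τ r m.1 m.2 j.succ ω), sq_nonneg (√(rateSize m.1 m.2 : ℝ) *
      (driveSum loc m.1 m.2 (err τ r m.1 m.2 (0 : Fin (n + 1))) ω / (min m.1 m.2 : ℕ)))])
  have b3 : |√(rateSize m.1 m.2 : ℝ) * (driveSum loc m.1 m.2 (err τ r m.1 m.2 (0 : Fin (n + 1))) ω /
      (min m.1 m.2 : ℕ))| ≤ |R| :=
    sq_le_sq.1 (by rw [hsq]; nlinarith [sq_nonneg (√(rateSize m.1 m.2 : ℝ) *
      errDev loc τ r m.1 m.2 j.succ ω), sq_nonneg (√(rateSize m.1 m.2 : ℝ) *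
      errDev loc τ r m.1 m.2 (0 : Fin (n + 1)) ω)])
  have hroot : (√(min m.1 m.2 : ℕ))⁻¹ = √(rateSize m.1 m.2 : ℝ) / (min m.1 m.2 : ℕ) := by
    rw [rateSize_eq hm, Real.sqrt_div_self', one_div]
  have e : √(rateSize m.1 m.2 : ℝ) *
      ((errDev loc τ r m.1 m.2 j.succ ω + driveSum loc m.1 m.2 (err τ r m.1 m.2 j.succ) ω /
        (min m.1 m.2 : ℕ)) / (1 + countDev loc m.1 m.2 j.succ ω) -
      (errDev loc τ r m.1 m.2 (0 : Fin (n + 1)) ω +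
        driveSum loc m.1 m.2 (err τ r m.1 m.2 (0 : Fin (n + 1))) ω / (min m.1 m.2 : ℕ)) /
        (1 + countDev loc m.1 m.2 (0 : Fin (n + 1)) ω)) -
      (√(min m.1 m.2 : ℕ))⁻¹ * driveSum loc m.1 m.2 halfSign ω /
        (1 + countDev loc m.1 m.2 j.succ ω) =
      √(rateSize m.1 m.2 : ℝ) * errDev loc τ r m.1 m.2 j.succ ω /
        (1 + countDev loc m.1 m.2 j.succ ω) -
      √(rateSize m.1 m.2 : ℝ) * errDev loc τ r m.1 m.2 (0 : Fin (n + 1)) ω /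
        (1 + countDev loc m.1 m.2 (0 : Fin (n + 1)) ω) -
      √(rateSize m.1 m.2 : ℝ) * (driveSum loc m.1 m.2 (err τ r m.1 m.2 (0 : Fin (n + 1))) ω /
        (min m.1 m.2 : ℕ)) / (1 + countDev loc m.1 m.2 (0 : Fin (n + 1)) ω) := by
    rw [he, hroot]
    ring
  rw [e]
  have c1 := abs_div_le_two_mul (x := √(rateSize m.1 m.2 : ℝ) *
    errDev loc τ r m.1 m.2 j.succ ω) (hω j.succ)
  have c2 := abs_div_le_two_mul (x := √(rateSize m.1 m.2 : ℝ) *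
    errDev loc τ r m.1 m.2 (0 : Fin (n + 1)) ω) (hω 0)
  have c3 := abs_div_le_two_mul (x := √(rateSize m.1 m.2 : ℝ) *
    (driveSum loc m.1 m.2 (err τ r m.1 m.2 (0 : Fin (n + 1))) ω / (min m.1 m.2 : ℕ))) (hω 0)
  refine (abs_sub _ _).trans ?_
  refine (add_le_add_left (abs_sub _ _) _).trans ?_
  linarith

end LimitLaws

/-! ### The Kolmogorov distance. -/

section Kolmogorov

lemma bddAbove_kolmogorov (P Q : ProbabilityMeasure ℝ) :
    BddAbove (Set.range fun x : ℝ => |cdf (P : Measure ℝ) x - cdf (Q : Measure ℝ) x|) := by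
  refine ⟨1, ?_⟩
  rintro _ ⟨x, rfl⟩
  have h1 := cdf_nonneg (P : Measure ℝ) x
  have h2 := cdf_nonneg (Q : Measure ℝ) x
  have h3 := cdf_le_one (P : Measure ℝ) x
  have h4 := cdf_le_one (Q : Measure ℝ) x
  exact abs_le.2 ⟨by linarith, by linarith⟩

lemma kolmogorov_le_add (D P Q : ProbabilityMeasure ℝ) :
    kolmogorov P Q ≤ kolmogorov D P + kolmogorov D Q := by
  refine ciSup_le fun x => ?_
  have h1 := le_ciSup (bddAbove_kolmogorov D P) x
  have h2 := le_ciSup (bddAbove_kolmogorov D Q) x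
  refine (abs_sub_le _ (cdf (D : Measure ℝ) x) _).trans (add_le_add ?_ h2)
  rw [abs_sub_comm]
  exact h1

lemma kolmogorov_pos {P Q : ProbabilityMeasure ℝ} (h : (P : Measure ℝ) ≠ Q) :
    0 < kolmogorov P Q := by
  by_contra hn
  refine h (Measure.eq_of_cdf _ _ ?_)
  ext x
  have h1 := le_ciSup (bddAbove_kolmogorov P Q) x
  have h2 : |cdf (P : Measure ℝ) x - cdf (Q : Measure ℝ) x| ≤ 0 := h1.trans (not_lt.1 hn)
  exact sub_eq_zero.1 (abs_nonpos_iff.1 h2)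

end Kolmogorov

/-! ### The two limit laws differ, whatever the normalization. -/

section Separation

variable {H : Submodule ℤ Plane} {M n : ℕ} {loc : Design H} {τ r : ℝ} {N T : ℕ}

/-- Without a compensating value, every type 0 error has the sign of τ or is zero, and so has their
average. This is exact in finite samples. -/
lemma mul_typeMean_nonneg (hτ : |τ| = 1) (hN : 1 ≤ N) (hT : 1 ≤ T) {ω : Latent H}
    (h : ω ∉ exceptional loc n r N T) : 0 ≤ τ * typeMean (n := n) loc τ r N T 0 ω := by
  rw [notMem_exceptional] at h
  have hs : 0 ≤ τ * typeSum (fun (i : Fin N) (t : Fin T) => cellType n (ω.2.2 (i, t)))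
      (fun i t => err τ r N T (cellType n (ω.2.2 (i, t))) (drive loc N T i t ω)) 0 := by
    unfold typeSum
    simp_rw [Finset.mul_sum]
    refine Finset.sum_nonneg fun i _ => Finset.sum_nonneg fun t _ => ?_
    split_ifs with hc
    · rw [hc, err, if_pos rfl, ← mul_assoc, ← abs_mul_abs_self, hτ, one_mul, one_mul]
      exact rare_nonneg (drive_notMem_of_driveSum_eq_zero h.2 i t)
    · simp
  have hN' : (0 : ℝ) < N := by exact_mod_cast hN
  have hT' : (0 : ℝ) < T := by exact_mod_cast hT
  rw [typeSum_cellType hN hT, mul_left_comm] at hs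
  have hs' := nonneg_of_mul_nonneg_right hs (by positivity : (0 : ℝ) < N * T / (n + 1 : ℝ))
  have hd := (abs_lt.1 (h.1 0)).1
  rw [typeMean, ← mul_div_assoc]
  exact div_nonneg hs' (by linarith)

/-- Every limit law of the estimator of the first coefficient is one-sided. -/
lemma limitLaw_apply_eq_zero (hM : 1 ≤ M) (hτ : |τ| = 1) (hr : 0 < r)
    (hloc : ∀ N, Function.Injective (loc N)) {β : Fin (n + 1) → ℝ} {a : ℕ → ℕ → ℝ}
    {L : ProbabilityMeasure ℝ} (hL : (sparseDGP H M n r τ).HasLimitLaw loc β 0 a L) :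
    (L : Measure ℝ) {x | τ * x < 0} = 0 := by
  obtain ⟨ha, hconv, -⟩ := hL
  have hopen : IsOpen {x : ℝ | τ * x < 0} := isOpen_lt (by fun_prop) continuous_const
  -- Portmanteau on an open half-line. A positive normalization preserves signs, so the sign of the
  -- estimation error already determines the conclusion and the limit need not be identified.
  have h1 := ProbabilityMeasure.le_liminf_measure_open_of_tendsto hconv.tendsto hopen
  have h2 : Tendsto (fun m : ℕ × ℕ => ((uniformLatent H).map fun ω : Latent H =>
      a m.1 m.2 * (ols ((sparseDGP H M n r τ).obs loc β m.1 m.2 ω) 0 - β 0)) {x | τ * x < 0})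
      (atTop ×ˢ atTop) (𝓝 0) := by
    refine tendsto_of_tendsto_of_tendsto_of_le_of_le' tendsto_const_nhds
      (tendsto_measure_exceptional (n := n) hloc hr) (.of_forall fun _ => zero_le) ?_
    filter_upwards [eventually_two_le_min] with m hm
    rw [← sparseDGP_latentLaw M n r τ,
      Measure.map_apply_of_aemeasurable (hconv.forall_aemeasurable m) hopen.measurableSet]
    refine measure_mono fun ω hω => ?_
    by_contra hne
    have h3 := mul_typeMean_nonneg hτ (by omega : 1 ≤ m.1) (by omega : 1 ≤ m.2) hne
    simp only [Set.mem_preimage, Set.mem_ofPred_eq] at hω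
    rw [(ols_sparseDGP hM (by omega) (by omega) β (notMem_exceptional.1 hne).1).1,
      mul_left_comm] at hω
    exact absurd hω (not_lt.2 (mul_nonneg (ha _ _).le h3))
  have h4 : (L : Measure ℝ) {x | τ * x < 0} ≤ 0 := by
    have e : ((L : Measure ℝ).map id) {x | τ * x < 0} = (L : Measure ℝ) {x | τ * x < 0} := by
      rw [Measure.map_id]
    rw [← e]
    exact h1.trans h2.liminf_eq.le
  exact le_antisymm h4 zero_le

/-- The opposite one-sided limit laws differ. -/
lemma limitLaw_ne (hM : 1 ≤ M) (hr : 0 < r) (hloc : ∀ N, Function.Injective (loc N))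
    {β : Fin (n + 1) → ℝ} {a₁ a₂ : ℕ → ℕ → ℝ} {L₁ L₂ : ProbabilityMeasure ℝ}
    (h₁ : (sparseDGP H M n r 1).HasLimitLaw loc β 0 a₁ L₁)
    (h₂ : (sparseDGP H M n r (-1)).HasLimitLaw loc β 0 a₂ L₂) : (L₁ : Measure ℝ) ≠ L₂ := by
  intro h
  have e1 := limitLaw_apply_eq_zero hM (by simp) hr hloc h₁
  have e2 := limitLaw_apply_eq_zero hM (by simp) hr hloc h₂
  rw [← h] at e2
  -- A common law would give no mass to either open half-line, hence be the point mass at 0,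
  -- contrary to nondegeneracy.
  refine h₁.2.2 0 ?_
  have e3 : (L₁ : Measure ℝ) {0}ᶜ = 0 := by
    refine measure_mono_null (fun x hx => ?_) (measure_union_null e1 e2)
    rcases lt_or_gt_of_ne (Set.mem_compl_singleton_iff.1 hx) with h' | h'
    · left
      simpa using h'
    · right
      simpa using h'
  have e4 : (L₁ : Measure ℝ) {0} = 1 := (prob_compl_eq_zero_iff (measurableSet_singleton 0)).1 e3
  ext s hs
  rw [Measure.dirac_apply' _ hs]
  by_cases h0 : (0 : ℝ) ∈ s
  · rw [Set.indicator_of_mem h0, Pi.one_apply]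
    exact le_antisymm prob_le_one (e4 ▸ measure_mono (Set.singleton_subset_iff.2 h0))
  · rw [Set.indicator_of_notMem h0]
    exact measure_mono_null (Set.subset_compl_singleton_iff.2 h0) e3

end Separation

/-! ### Coincidence of the data and the two-point inequality. -/

section Coupling

variable {H : Submodule ℤ Plane} {M n : ℕ} {loc : Design H} {r : ℝ} {N T : ℕ}

/-- The event that no rare error occurs. -/
def quiet (loc : Design H) (r : ℝ) (N T : ℕ) : Set (Latent H) :=
  {ω | driveSum loc N T ((central (rareProb N T + rareProb N T / rareHeight r N T)).indicator
    fun _ => 1) ω = 0}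

/-- The parameter τ enters only as a factor of the rare variable, which vanishes at every draw used.
-/
lemma obs_eq_of_mem_quiet (hr : 0 < r) (τ τ' : ℝ) (β : Fin (n + 1) → ℝ) {ω : Latent H}
    (h : ω ∈ quiet loc r N T) :
    (sparseDGP H M n r τ).obs loc β N T ω = (sparseDGP H M n r τ').obs loc β N T ω := by
  have he : ∀ (i : Fin N) (t : Fin T) (κ : Fin (n + 1)),
      err τ r N T κ (drive loc N T i t ω) = err τ' r N T κ (drive loc N T i t ω) := by
    intro i t κ
    have hp : 0 ≤ rareProb N T / rareHeight r N T :=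
      div_nonneg (rareProb_pos N T).le (by linarith [one_le_rareHeight hr N T])
    simp only [err, rare_eq_zero hp (drive_notMem_of_driveSum_eq_zero h i t), mul_zero]
  funext i t
  simp only [DGP.obs, sparseDGP]
  congr 1
  congr 1
  funext m
  exact he i t _

/-- A draw is rare with probability at most 2/m, since h ≥ 1, and (1 - 2/m)^m tends to exp(-2); half
of this limit is a lower bound from some sample size on. -/
lemma eventually_le_measure_quiet (hloc : ∀ N, Function.Injective (loc N)) (hr : 0 < r) :
    ∀ᶠ m : ℕ × ℕ in atTop ×ˢ atTop,
      ENNReal.ofReal (Real.exp (-2) / 2) ≤ uniformLatent H (quiet loc r m.1 m.2) := by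
  have h1 := (Real.tendsto_one_add_div_pow_exp (-2)).comp tendsto_min_prod_atTop
  filter_upwards [eventually_two_le_min,
    h1.eventually_const_le (half_lt_self (Real.exp_pos (-2)))] with m hm hle
  refine (ENNReal.ofReal_le_ofReal hle).trans ?_
  have hh := one_le_rareHeight hr m.1 m.2
  have hp := rareProb_pos m.1 m.2
  have h2 : rareProb m.1 m.2 / rareHeight r m.1 m.2 ≤ rareProb m.1 m.2 :=
    div_le_self hp.le hh
  have h3 := two_mul_rareProb_le m.1 m.2
  have h4 : 0 ≤ rareProb m.1 m.2 / rareHeight r m.1 m.2 := by positivity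
  rw [quiet, measure_driveSum_eq_zero hloc _ _ (measurableSet_central _),
    volume_compl_eq (measurableSet_central _) (volume_real_central (by linarith) (by linarith)),
    ← ENNReal.ofReal_pow (by linarith)]
  refine ENNReal.ofReal_le_ofReal ?_
  simp only [Function.comp]
  have e : 1 + -2 / ((min m.1 m.2 : ℕ) : ℝ) = 1 - 2 * rareProb m.1 m.2 := by
    rw [rareProb, rateSize_eq hm]; ring
  rw [e]
  exact pow_le_pow_left₀ (by linarith) (by linarith) _

/-- Two processes that yield the same data on an event of probability `p` cannot be told apart with
error probabilities both smaller than `p / 2`. -/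
lemma half_le_max_missProb {K : ℕ} {f₁ f₂ : DGP H M K} (hlaw : f₁.latentLaw = f₂.latentLaw)
    {β : Fin K → ℝ} (h₁ : ∀ N T, Measurable (f₁.fn N T)) (h₂ : ∀ N T, Measurable (f₂.fn N T))
    {E : Set (Latent H)} (hE : ∀ ω ∈ E, f₁.obs loc β N T ω = f₂.obs loc β N T ω)
    {L₁ L₂ : ProbabilityMeasure ℝ} {ε : ℝ} (hε : 2 * ε < kolmogorov L₁ L₂)
    (D : Estimator N T M K) :
    f₁.latentLaw E / 2 ≤ max (missProb f₁ loc β D L₁ ε) (missProb f₂ loc β D L₂ ε) := by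
  -- The miss event is not shown to be measurable; this inequality for the image measure holds for
  -- arbitrary sets and is the direction needed.
  have m1 : f₁.latentLaw (f₁.obs loc β N T ⁻¹' {x | ε < kolmogorov (D.1 x) L₁}) ≤
      missProb f₁ loc β D L₁ ε :=
    Measure.le_map_apply (measurable_obs f₁ h₁ β N T).aemeasurable _
  have m2 : f₁.latentLaw (f₂.obs loc β N T ⁻¹' {x | ε < kolmogorov (D.1 x) L₂}) ≤
      missProb f₂ loc β D L₂ ε := by
    rw [hlaw]
    exact Measure.le_map_apply (measurable_obs f₂ h₂ β N T).aemeasurable _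
  -- On the event the estimator takes the same value under both processes, and by the triangle
  -- inequality it is more than ε from at least one of the two limits.
  have hsub : E ⊆ (f₁.obs loc β N T ⁻¹' {x | ε < kolmogorov (D.1 x) L₁}) ∪
      (f₂.obs loc β N T ⁻¹' {x | ε < kolmogorov (D.1 x) L₂}) := by
    intro ω hω
    by_contra hne
    simp only [Set.mem_union, Set.mem_preimage, Set.mem_ofPred_eq, not_or, not_lt] at hne
    rw [hE ω hω] at hne
    have := kolmogorov_le_add (D.1 (f₂.obs loc β N T ω)) L₁ L₂
    linarith [hne.1, hne.2]
  refine ENNReal.div_le_of_le_mul ?_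
  rw [mul_two]
  calc f₁.latentLaw E ≤ _ := measure_mono hsub
    _ ≤ _ := measure_union_le _ _
    _ ≤ _ := add_le_add (m1.trans (le_max_left _ _)) (m2.trans (le_max_right _ _))

lemma sparseDGP_mem_dgpClass (hM : 1 ≤ M) (hn : 1 ≤ n) {τ ζ δ : ℝ} (hτ : |τ| = 1) (hζ : 1 < ζ)
    (hδ : 0 < δ) (hloc : ∀ N, Function.Injective (loc N)) (β : Fin (n + 1) → ℝ) :
    sparseDGP H M n (8 * (ζ + δ)) τ ∈ dgpClass M (n + 1) loc β ζ δ := by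
  have hr : 1 < 8 * (ζ + δ) := by linarith
  have hr0 : 0 < 8 * (ζ + δ) := by linarith
  refine ⟨representation_sparseDGP, spectralRepresentation_sparseDGP hτ hr0,
    momentsVariances_sparseDGP hM hn hτ hr0 hloc, timeMixing_sparseDGP ζ,
    spatialMixing_sparseDGP hζ hδ loc,
    fun k m _ => not_intermediateNonGaussian_sparseDGP hτ hr0 loc k m, fun k => ?_⟩
  refine Fin.cases ?_ (fun j => ?_) k
  · exact ⟨_, _, hasLimitLaw_zero hM hτ hr hloc β⟩
  · exact ⟨_, _, hasLimitLaw_succ hM hτ hr hloc β j⟩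

end Coupling

end TwoWay

/-! ### Conclusion of the two-point argument. -/

open TwoWay in
theorem proposition1 (M K : ℕ) (hM : 1 ≤ M) (hK : 2 ≤ K) (ζ δ : ℝ) (hζ : 1 < ζ) (hδ : 0 < δ)
    (H : Submodule ℤ Plane) [DiscreteTopology H] [IsZLattice ℝ H]
    (loc : Design H) (hloc : ∀ N, Function.Injective (loc N)) (hexp : Expands loc)
    (β : Fin K → ℝ)
    (a : DGP H M K → Fin K → ℕ → ℕ → ℝ) (L : DGP H M K → Fin K → ProbabilityMeasure ℝ)
    (hL : ∀ f ∈ dgpClass M K loc β ζ δ, ∀ k, f.HasLimitLaw loc β k (a f k) (L f k)) :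
    ∃ ε : ℝ, 0 < ε ∧ ∃ k : Fin K,
      0 < liminf (fun n : ℕ × ℕ => ⨅ D : Estimator n.1 n.2 M K,
        ⨆ f ∈ dgpClass M K loc β ζ δ, missProb f loc β D (L f k) ε) (atTop ×ˢ atTop) ∧
      ∃ f₁ ∈ dgpClass M K loc β ζ δ, ∃ f₂ ∈ dgpClass M K loc β ζ δ,
        0 < liminf (fun n : ℕ × ℕ => ⨅ D : Estimator n.1 n.2 M K,
          max (missProb f₁ loc β D (L f₁ k) ε) (missProb f₂ loc β D (L f₂ k) ε))
            (atTop ×ˢ atTop) := by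
  obtain ⟨n, rfl⟩ : ∃ n, K = n + 1 := ⟨K - 1, by omega⟩
  have hn : 1 ≤ n := by omega
  have hr : 0 < 8 * (ζ + δ) := by linarith
  set f₁ := sparseDGP H M n (8 * (ζ + δ)) 1 with hf₁
  set f₂ := sparseDGP H M n (8 * (ζ + δ)) (-1) with hf₂
  have m₁ : f₁ ∈ dgpClass M (n + 1) loc β ζ δ :=
    sparseDGP_mem_dgpClass hM hn (by simp) hζ hδ hloc β
  have m₂ : f₂ ∈ dgpClass M (n + 1) loc β ζ δ :=
    sparseDGP_mem_dgpClass hM hn (by simp) hζ hδ hloc β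
  have hpos := kolmogorov_pos (limitLaw_ne hM hr hloc (hL f₁ m₁ 0) (hL f₂ m₂ 0))
  -- A third of the distance satisfies the strict inequality 2ε < distance. It depends on the limit
  -- laws alone and not on the sample size.
  set ε := kolmogorov (L f₁ 0) (L f₂ 0) / 3 with hε
  have hmax : ∀ᶠ m : ℕ × ℕ in atTop ×ˢ atTop, ∀ D : Estimator m.1 m.2 M (n + 1),
      ENNReal.ofReal (Real.exp (-2) / 2) / 2 ≤
        max (missProb f₁ loc β D (L f₁ 0) ε) (missProb f₂ loc β D (L f₂ 0) ε) := by
    filter_upwards [eventually_le_measure_quiet (H := H) hloc hr] with m hm D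
    refine le_trans ?_ (half_le_max_missProb (f₁ := f₁) (f₂ := f₂) (loc := loc) rfl m₁.1.measurable_fn
      m₂.1.measurable_fn (fun ω hω => obs_eq_of_mem_quiet hr _ _ β hω) (by rw [hε]; linarith) D)
    exact ENNReal.div_le_div_right hm 2
  have hc : 0 < ENNReal.ofReal (Real.exp (-2) / 2) / 2 :=
    ENNReal.div_pos (ENNReal.ofReal_pos.2 (by positivity)).ne' (by simp)
  refine ⟨ε, by positivity, 0, ?_, f₁, m₁, f₂, m₂, ?_⟩
  · refine hc.trans_le (le_liminf_of_le (by isBoundedDefault) ?_)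
    filter_upwards [hmax] with m hm
    refine le_iInf fun D => (hm D).trans (max_le ?_ ?_)
    · exact le_iSup₂ (f := fun f (_ : f ∈ dgpClass M (n + 1) loc β ζ δ) =>
        missProb f loc β D (L f 0) ε) f₁ m₁
    · exact le_iSup₂ (f := fun f (_ : f ∈ dgpClass M (n + 1) loc β ζ δ) =>
        missProb f loc β D (L f 0) ε) f₂ m₂
  · refine hc.trans_le (le_liminf_of_le (by isBoundedDefault) ?_)
    filter_upwards [hmax] with m hm
    exact le_iInf hm
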